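/- Let $G$ be a directed graph consisting of $p$ disjoint nonempty chains (directed paths) comprising $n$ nodes in total, where each node represents either a $P$-operation or a $V$-operation on one common semaphore. A \emph{schedule} of $G$ is a linear ordering of all nodes of $G$ consistent with the arcs of $G$, and a \emph{subschedule} is a prefix of a schedule. A subschedule is \emph{valid} if, in each of its prefixes, the number of $P$-operations does not exceed the number of $V$-operations (that is, the semaphore, initially zero, is never negative). Then there is an algorithm which, given $G$ (as the list of its chains, each chain being given by its length and its sequence of operations) and any two nodes $v$ and $w$ of $G$, determines in $O(n)$ time whether there is a valid subschedule of $G$ that contains both $v$ and $w$ and in which $v$ precedes $w$. Here time is the number of steps of a unit-cost random access machine with instructions for constants, copying, addition, truncated subtraction, indirect load and store, jump, and test for zero, all of whose words stay bounded by $O(n)$ (that is, have $\log_2 n+O(1)$ bits). A single program and absolute constants serve for all $p$, $n$, $G$, $v$ and $w$. -/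

import Mathlib

/-! ### Semaphore operations, schedules, valid subschedules -/

/-- An operation on the single semaphore: `P` (wait, decrement) or `V` (signal, increment). -/
inductive SemOp where
  | P
  | V
  deriving DecidableEq

/-- A schedule of a directed graph: a linear ordering (list) of all its nodes that is consistent
with all arcs; `[a, b].Sublist S` says that `a` occurs in `S` before `b`. -/
def IsSchedule {N : Type*} (G : Digraph N) (S : List N) : Prop :=
  S.Nodup ∧ (∀ x, x ∈ S) ∧ ∀ a b, G.Adj a b → [a, b].Sublist S

/-- A subschedule is a prefix of a schedule. -/
def IsSubschedule {N : Type*} (G : Digraph N) (L : List N) : Prop :=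
  ∃ S, IsSchedule G S ∧ L <+: S

/-- Validity: at each point of the sequence the number of `P`-operations executed so far does not
exceed the number of `V`-operations, i.e. the semaphore (initially zero) is never negative. -/
def IsValid {N : Type*} (op : N → SemOp) (L : List N) : Prop :=
  ∀ L', L' <+: L → (L'.map op).count SemOp.P ≤ (L'.map op).count SemOp.V

/-- There is a valid subschedule in which `v` precedes `w` (both occurring in it). -/
def CanPrecede {N : Type*} (G : Digraph N) (op : N → SemOp) (v w : N) : Prop :=
  ∃ L, IsSubschedule G L ∧ IsValid op L ∧ [v, w].Sublist L

/-! ### Graphs of disjoint chains -/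

/-- `p` disjoint nonempty chains comprising `n` nodes in total, each node carrying an operation:
`chain i` is the sequence of operations along the `i`-th chain. -/
structure ChainTrace (p n : ℕ) where
  chain : Fin p → List SemOp
  chain_ne_nil : ∀ i, chain i ≠ []
  total : ∑ i, (chain i).length = n

namespace ChainTrace

variable {p n : ℕ}

/-- Node `⟨i, k⟩` is the `k`-th node of the `i`-th chain (counting from zero). -/
abbrev Node (T : ChainTrace p n) : Type := (i : Fin p) × Fin (T.chain i).length

/-- The operation at a node. -/
def op (T : ChainTrace p n) (x : T.Node) : SemOp := (T.chain x.1).get x.2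

/-- The directed graph: an arc from each node to the next node of the same chain. -/
def graph (T : ChainTrace p n) : Digraph T.Node where
  Adj x y := x.1 = y.1 ∧ x.2.val + 1 = y.2.val

end ChainTrace

/-! ### The machine model: a random access machine with unit-cost instructions -/

/-- Instructions; `d a b` are register numbers, `c` a constant, `l` a program line.
Subtraction is truncated at zero. There is no multiplication, division or bit operation. -/
inductive RamInstr where
  /-- `reg d := c` -/
  | const (d c : ℕ)
  /-- `reg d := reg a` -/
  | move (d a : ℕ)
  /-- `reg d := reg a + reg b` -/
  | add (d a b : ℕ)
  /-- `reg d := reg a - reg b` -/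
  | sub (d a b : ℕ)
  /-- `reg d := mem (reg a)` -/
  | load (d a : ℕ)
  /-- `mem (reg a) := reg b` -/
  | store (a b : ℕ)
  /-- go to line `l` -/
  | jump (l : ℕ)
  /-- go to line `l` if `reg a = 0` -/
  | jumpZero (a l : ℕ)
  /-- stop -/
  | halt

/-- A configuration: program counter, registers, and memory. -/
structure RamState where
  pc : ℕ
  reg : ℕ → ℕ
  mem : ℕ → ℕ

/-- A program is a fixed finite list of instructions. -/
abbrev RamProgram : Type := List RamInstr

namespace RamState

/-- Write `x` to register `d` and go to the next line. -/
def setReg (s : RamState) (d x : ℕ) : RamState :=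
  { s with pc := s.pc + 1, reg := Function.update s.reg d x }

/-- All registers and all memory cells hold numbers at most `B`. -/
def WordsAtMost (s : RamState) (B : ℕ) : Prop :=
  (∀ r, s.reg r ≤ B) ∧ ∀ a, s.mem a ≤ B

/-- The effect of one instruction. -/
def exec (s : RamState) : RamInstr → RamState
  | .const d c => s.setReg d c
  | .move d a => s.setReg d (s.reg a)
  | .add d a b => s.setReg d (s.reg a + s.reg b)
  | .sub d a b => s.setReg d (s.reg a - s.reg b)
  | .load d a => s.setReg d (s.mem (s.reg a))
  | .store a b => { s with pc := s.pc + 1, mem := Function.update s.mem (s.reg a) (s.reg b) }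
  | .jump l => { s with pc := l }
  | .jumpZero a l => { s with pc := if s.reg a = 0 then l else s.pc + 1 }
  | .halt => s

/-- The start configuration on an input word list: the input is stored in the memory cells
`0, 1, 2, …`; all other cells, all registers and the program counter are zero. -/
def init (input : List ℕ) : RamState where
  pc := 0
  reg _ := 0
  mem a := input.getD a 0

end RamState

namespace RamProgram

/-- The current instruction; running off the program counts as `halt`. -/
def instrAt (Q : RamProgram) (l : ℕ) : RamInstr := List.getD Q l RamInstr.halt

/-- One step of the computation (a halted configuration stays as it is). -/
def step (Q : RamProgram) (s : RamState) : RamState := s.exec (Q.instrAt s.pc)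

/-- The configuration after `t` steps on the given input. -/
def config (Q : RamProgram) (input : List ℕ) (t : ℕ) : RamState := Q.step^[t] (RamState.init input)

/-- On the given input, `Q` halts after at most `time` steps, during which all words stay at most
`B`, and its answer (register `0` at halting: `1` for yes, `0` for no) tells whether `A` holds. -/
def DecidesWithin (Q : RamProgram) (input : List ℕ) (A : Prop) (time B : ℕ) : Prop :=
  ∃ t ≤ time, Q.instrAt (Q.config input t).pc = RamInstr.halt ∧
    (∀ t' ≤ t, (Q.config input t').WordsAtMost B) ∧
    (A → (Q.config input t).reg 0 = 1) ∧ (¬ A → (Q.config input t).reg 0 = 0)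

end RamProgram

/-! ### Encoding of the input -/

/-- A `P`-operation is coded by `1`, a `V`-operation by `0`. -/
def SemOp.code : SemOp → ℕ
  | .P => 1
  | .V => 0

/-- The input word list: the number `p` of chains, the chain index and position of `v`, those of
`w`, and then for each chain its length followed by the codes of its operations in order. -/
def ChainTrace.encode {p n : ℕ} (T : ChainTrace p n) (v w : T.Node) : List ℕ :=
  [p, v.1.val, v.2.val, w.1.val, w.2.val] ++
    (List.ofFn fun i => (T.chain i).length :: (T.chain i).map SemOp.code).flatten

/-! The semaphore value is a sum of heights, one per chain. The chain of `w` is cut off just before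
`w`. By `canPrecede_iff` the question becomes whether some reachable tuple of positions has used up
the cut chain, has passed `v`, and has level at least 1 or 0 according as `w` is a P- or a
V-operation.

With credit r, each chain can be driven to the largest height it has before its drawdown exceeds r.
If the sum `totalPeak` of these peaks exceeds r, the credit grows and the argument repeats. It stops
at the least M with `totalPeak` M ≤ M, where equality holds (`IsTopLevel.eq`). The state with all
chains at their M-peaks is reachable (`reach_peakState`), and no reachable state has a chain with
drawdown beyond M or height above its peak (`Reach.bounds`, `Reach.height_le`). So all other chains
may be parked at their peaks, and the chains of `v` and `w` may first be brought to theirs: this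
normalisation never lowers the level (`pair_of_reach`, `single_of_reach`). What remains is two
chains above a constant K, starting at heights that are never exceeded later.

The two-chain problem is solved backwards. A part traced back to positions i and j is summarised by
its maxima α and β. A chain may be traced back by one more operation if the level there is
nonnegative with the other chain at its maximum. The maxima only grow, so a greedy choice loses
nothing. When neither chain can move, a solution starting outside the traced quadrant would have to
enter it by a step that contradicts this, which gives the criterion `Traced.solvable_iff`. The final
position of the first chain is free, so all its tails beyond V are scanned with their running
maximum and minimum. The pointer into the second chain only moves back as the maximum grows. The
last accepted tail suffices, because its maximum bounds the tails of all solutions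
(`TailDone.tailLE`).

M is found in linear time by sorting the records of all chains into a table by the maximal drawdown
before them; `totalPeak` is then the sequence of its prefix sums (`peak_succ_eq`, `findTop_spec`).
The program is written with structured commands whose step count is part of the state. `Exec.runs`
transfers runs, times and word bounds to the machine. -/

/-! ### Heights, drawdowns and peaks of a single chain -/

/-- The height of a chain after `k` operations (`true` is a `P`-operation). -/
def height (f : ℕ → Bool) : ℕ → ℤ
  | 0 => 0
  | k + 1 => height f k + if f k then -1 else 1

/-- The amount by which the height lies below its running maximum. -/
def drawdown (f : ℕ → Bool) : ℕ → ℕ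
  | 0 => 0
  | k + 1 => if f k then drawdown f k + 1 else drawdown f k - 1

/-- The running maximum of the drawdown. -/
def maxDrawdown (f : ℕ → Bool) : ℕ → ℕ
  | 0 => 0
  | k + 1 => max (maxDrawdown f k) (drawdown f (k + 1))

/-- Operation `k` lifts the height to a new maximum. -/
def IsRecord (f : ℕ → Bool) (k : ℕ) : Prop := f k = false ∧ drawdown f k = 0

instance (f : ℕ → Bool) (k : ℕ) : Decidable (IsRecord f k) :=
  inferInstanceAs (Decidable (_ ∧ _))

/-- The largest height within the first `n` operations before the drawdown exceeds `r`. -/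
def peak (f : ℕ → Bool) (r : ℕ) : ℕ → ℕ
  | 0 => 0
  | k + 1 => if IsRecord f k ∧ maxDrawdown f k ≤ r then peak f r k + 1 else peak f r k

/-- The first position at which the height `peak f r n` is attained. -/
def peakPos (f : ℕ → Bool) (r : ℕ) : ℕ → ℕ
  | 0 => 0
  | k + 1 => if IsRecord f k ∧ maxDrawdown f k ≤ r then k + 1 else peakPos f r k

section Chain

variable (f : ℕ → Bool)

theorem abs_height_le (k : ℕ) : |height f k| ≤ k := by
  induction k with
  | zero => simp [height]
  | succ k ih =>
    rw [abs_le] at ih ⊢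
    simp only [height]
    push_cast
    split_ifs <;> constructor <;> omega

theorem maxDrawdown_mono : Monotone (maxDrawdown f) :=
  monotone_nat_of_le_succ fun _ => le_max_left _ _

theorem drawdown_le_maxDrawdown (k : ℕ) : drawdown f k ≤ maxDrawdown f k := by
  cases k with
  | zero => exact le_rfl
  | succ k => exact le_max_right _ _

theorem drawdown_le (k : ℕ) : drawdown f k ≤ k := by
  induction k with
  | zero => exact le_rfl
  | succ k ih => simp only [drawdown]; split_ifs <;> omega

theorem maxDrawdown_le (k : ℕ) : maxDrawdown f k ≤ k := by
  induction k with
  | zero => exact le_rfl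
  | succ k ih => exact max_le (ih.trans k.le_succ) (drawdown_le f _)

theorem peak_mono (r : ℕ) : Monotone (peak f r) :=
  monotone_nat_of_le_succ fun k => by simp only [peak]; split_ifs <;> omega

theorem peak_le (r k : ℕ) : peak f r k ≤ k := by
  induction k with
  | zero => exact le_rfl
  | succ k ih => simp only [peak]; split_ifs <;> omega

theorem peakPos_le (r n : ℕ) : peakPos f r n ≤ n := by
  induction n with
  | zero => exact le_rfl
  | succ k ih => simp only [peakPos]; split_ifs <;> omega

theorem peakPos_mono_left {r r' : ℕ} (h : r ≤ r') (n : ℕ) : peakPos f r n ≤ peakPos f r' n := by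
  induction n with
  | zero => exact le_rfl
  | succ k ih =>
    have := peakPos_le f r k
    simp only [peakPos]
    split_ifs with h1 h2 h2
    · exact le_rfl
    · exact absurd ⟨h1.1, h1.2.trans h⟩ h2
    · omega
    · exact ih

/-- While the drawdown stays within `r`, every record is counted, so `peak` is the running maximum
of the height itself. -/
theorem height_eq_peak_sub_drawdown {r k : ℕ} (h : maxDrawdown f k ≤ r) :
    height f k = peak f r k - drawdown f k := by
  induction k with
  | zero => simp [height, peak, drawdown]
  | succ k ih =>
    have hk : maxDrawdown f k ≤ r := (maxDrawdown_mono f k.le_succ).trans h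
    have := ih hk
    cases hf : f k
    · by_cases h0 : drawdown f k = 0
      · simp [height, peak, drawdown, IsRecord, hf, hk, h0, this]
      · simp [height, peak, drawdown, IsRecord, hf, h0, this]
        omega
    · simp [height, peak, drawdown, IsRecord, hf, this]
      omega

theorem height_le_peak {r k n : ℕ} (h : maxDrawdown f k ≤ r) (hkn : k ≤ n) :
    height f k ≤ peak f r n := by
  have := height_eq_peak_sub_drawdown f h
  have := peak_mono f r hkn
  omega

/-- Right after a record the drawdown is still zero. So the maximal drawdown has not grown, and the
height equals the running maximum. -/
theorem peakPos_spec (r n : ℕ) :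
    maxDrawdown f (peakPos f r n) ≤ r ∧ height f (peakPos f r n) = peak f r n := by
  induction n with
  | zero => simp [peakPos, maxDrawdown, height, peak]
  | succ k ih =>
    simp only [peakPos, peak]
    split_ifs with h
    · obtain ⟨⟨hf, h0⟩, hD⟩ := h
      have := height_eq_peak_sub_drawdown f hD
      refine ⟨?_, ?_⟩
      · simp [maxDrawdown, drawdown, hf, h0, hD]
      · simp only [height, hf]
        push_cast
        simp
        omega
    · exact ih

theorem height_peakPos (r n : ℕ) : height f (peakPos f r n) = peak f r n := (peakPos_spec f r n).2

theorem height_le_of_le_peakPos {r n x : ℕ} (h : x ≤ peakPos f r n) :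
    height f x ≤ peak f r n :=
  height_le_peak f ((maxDrawdown_mono f h).trans (peakPos_spec f r n).1)
    (h.trans (peakPos_le f r n))

theorem sub_le_height_of_maxDrawdown_le {r x y : ℕ} (h : maxDrawdown f y ≤ r) (hxy : x ≤ y) :
    height f x - r ≤ height f y := by
  have h1 := height_eq_peak_sub_drawdown f h
  have h2 := height_le_peak f ((maxDrawdown_mono f hxy).trans h) hxy
  have h3 := drawdown_le_maxDrawdown f y
  omega

/-- The drawdown rises by at most one per operation, so it passes `r` by reaching exactly `r + 1`,
through a P-operation that leaves the running maximum unchanged. -/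
theorem height_of_lt_maxDrawdown_succ {r k : ℕ} (h : maxDrawdown f k ≤ r)
    (h' : r < maxDrawdown f (k + 1)) : height f (k + 1) = peak f r k - (r + 1) := by
  have h1 := height_eq_peak_sub_drawdown f h
  have h2 := drawdown_le_maxDrawdown f k
  have h3 : r < drawdown f (k + 1) := by
    simp only [maxDrawdown] at h'
    omega
  cases hf : f k
  · simp [drawdown, hf] at h3
    omega
  · simp [drawdown, hf] at h3
    simp only [height, hf]
    simp
    omega

end Chain

/-! ### Reachable positions of several chains -/

section Reach

variable {ι : Type*} [Fintype ι]

/-- The value of the semaphore when `x i` operations of chain `i` have been executed. -/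
def level (F : ι → ℕ → Bool) (x : ι → ℕ) : ℤ := ∑ i, height (F i) (x i)

/-- The height of all chains together before a drawdown exceeds `r`. -/
def totalPeak (F : ι → ℕ → Bool) (L : ι → ℕ) (r : ℕ) : ℕ := ∑ i, peak (F i) r (L i)

/-- The position of each chain at its peak. -/
def peakState (F : ι → ℕ → Bool) (L : ι → ℕ) (r : ℕ) (i : ι) : ℕ := peakPos (F i) r (L i)

theorem level_peakState (F : ι → ℕ → Bool) (L : ι → ℕ) (r : ℕ) : level F (peakState F L r) = totalPeak F L r := by
  simp [level, peakState, totalPeak, height_peakPos]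

variable [DecidableEq ι]

/-- One operation is executed on some chain `i`, of length `L i`. -/
def Step (F : ι → ℕ → Bool) (L : ι → ℕ) (x y : ι → ℕ) : Prop :=
  ∃ i, x i < L i ∧ y = Function.update x i (x i + 1) ∧ 0 ≤ level F y

/-- Positions reachable by valid executions. -/
abbrev Reach (F : ι → ℕ → Bool) (L : ι → ℕ) : (ι → ℕ) → (ι → ℕ) → Prop :=
  Relation.ReflTransGen (Step F L)

variable {F : ι → ℕ → Bool} {L : ι → ℕ}

theorem level_update (x : ι → ℕ) (i : ι) (k : ℕ) :
    level F (Function.update x i k) = level F x - height (F i) (x i) + height (F i) k := by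
  simp only [level]
  rw [← Finset.add_sum_erase _ _ (Finset.mem_univ i),
    ← Finset.add_sum_erase Finset.univ (fun i => height (F i) (x i)) (Finset.mem_univ i)]
  have : ∑ j ∈ Finset.univ.erase i, height (F j) (Function.update x i k j) =
      ∑ j ∈ Finset.univ.erase i, height (F j) (x j) :=
    Finset.sum_congr rfl fun j hj => by
      rw [Function.update_of_ne (Finset.ne_of_mem_erase hj)]
  rw [this]
  simp
  ring

theorem Step.le_bound {x y : ι → ℕ} (h : Step F L x y) (hx : ∀ i, x i ≤ L i) (i : ι) :
    y i ≤ L i := by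
  obtain ⟨j, hj, rfl, -⟩ := h
  by_cases hij : i = j
  · subst hij; simpa using hj
  · simpa [hij] using hx i

theorem Step.le {x y : ι → ℕ} (h : Step F L x y) (i : ι) : x i ≤ y i := by
  obtain ⟨j, hj, rfl, -⟩ := h
  by_cases hij : i = j
  · subst hij; simp
  · simp [hij]

theorem reach_update {x : ι → ℕ} {i : ι} {k : ℕ} (hk : x i ≤ k) (hL : k ≤ L i)
    (h : ∀ j, x i < j → j ≤ k → 0 ≤ level F (Function.update x i j)) :
    Reach F L x (Function.update x i k) := by
  induction k, hk using Nat.le_induction with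
  | base => simp only [Function.update_eq_self]; exact .refl
  | succ k hk ih =>
    refine (ih (by omega) fun j h1 h2 => h j h1 (by omega)).tail ⟨i, ?_, ?_, ?_⟩
    · simp; omega
    · simp
    · exact h _ (by omega) le_rfl

/-- The chains are moved one after another. Each dips at most `r` below its start and ends no lower,
so a level of at least `r` is available again for the next chain. -/
theorem reach_of_climb {x y : ι → ℕ} {r : ℕ} (hxy : ∀ i, x i ≤ y i) (hL : ∀ i, y i ≤ L i)
    (hr : (r : ℤ) ≤ level F x) (hup : ∀ i, height (F i) (x i) ≤ height (F i) (y i))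
    (hdown : ∀ i k, x i ≤ k → k ≤ y i → height (F i) (x i) - r ≤ height (F i) k) :
    Reach F L x y := by
  -- `S` is the set of chains already moved to their targets.
  suffices ∀ S : Finset ι, Reach F L x (S.piecewise y x) ∧
      (r : ℤ) ≤ level F (S.piecewise y x) by
    simpa using (this Finset.univ).1
  intro S
  induction S using Finset.induction_on with
  | empty => exact ⟨by simpa using Relation.ReflTransGen.refl, by simpa using hr⟩
  | insert i S hi ih =>
    rw [Finset.piecewise_insert]
    have hz : S.piecewise y x i = x i := Finset.piecewise_eq_of_notMem _ _ _ hi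
    refine ⟨ih.1.trans (reach_update (by rw [hz]; exact hxy i) (hL i) fun j h1 h2 => ?_), ?_⟩
    · rw [level_update, hz]
      rw [hz] at h1
      have := hdown i j h1.le h2
      linarith [ih.2]
    · rw [level_update, hz]
      linarith [ih.2, hup i]

/-- The level at the old peaks is `totalPeak F L r`, which covers the deepest dip `r'` on the way to
the new ones. -/
theorem reach_peakState_succ {r r' : ℕ} (h : r ≤ r') (hr : r' ≤ totalPeak F L r) :
    Reach F L (peakState F L r) (peakState F L r') := by
  have key : ∀ i, maxDrawdown (F i) (peakState F L r' i) ≤ r' := fun i => (peakPos_spec _ _ _).1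
  refine reach_of_climb (r := r') (fun i => peakPos_mono_left _ h _) (fun i => peakPos_le _ _ _)
    (by rw [level_peakState]; exact_mod_cast hr) (fun i => ?_) fun i k h1 h2 => ?_
  · have := height_le_of_le_peakPos (F i) (r := r') (n := L i) (peakPos_mono_left _ h _)
    simpa [peakState, height_peakPos] using this
  · exact sub_le_height_of_maxDrawdown_le _ ((maxDrawdown_mono _ h2).trans (key i)) h1

theorem reach_peakState {M : ℕ} (hM : ∀ r < M, r < totalPeak F L r) :
    Reach F L 0 (peakState F L M) := by
  induction M with
  | zero =>
    refine reach_of_climb (r := 0) (fun i => Nat.zero_le _) (fun i => peakPos_le _ _ _) ?_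
      (fun i => ?_) fun i k h1 h2 => ?_
    · simp [level, height]
    · simp [peakState, height_peakPos, height]
    · exact sub_le_height_of_maxDrawdown_le _
        ((maxDrawdown_mono _ h2).trans (peakPos_spec _ _ _).1) h1
  | succ M ih =>
    exact (ih fun r hr => hM r (by omega)).trans (reach_peakState_succ M.le_succ (hM M M.lt_succ_self))

/-- The first operation to push a chain's drawdown beyond `M` would leave this chain `M + 1` below
its peak, with all others at most at theirs. As the peaks sum to at most `M`, the level would be
negative. -/
theorem Reach.bounds {M : ℕ} (hM : totalPeak F L M ≤ M) {x : ι → ℕ} (h : Reach F L 0 x) (i : ι) :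
    x i ≤ L i ∧ maxDrawdown (F i) (x i) ≤ M := by
  induction h generalizing i with
  | refl => simp [maxDrawdown]
  | @tail x y _ hs ih =>
    refine ⟨hs.le_bound (fun i => (ih i).1) i, ?_⟩
    by_contra! hlt
    obtain ⟨j, hj, rfl, hlev⟩ := hs
    by_cases hij : i = j
    · subst hij
      simp only [Function.update_self] at hlt
      have h1 := height_of_lt_maxDrawdown_succ (F i) (ih i).2 hlt
      rw [level_update] at hlev
      have h2 : level F x - height (F i) (x i) ≤ totalPeak F L M - peak (F i) M (L i) := by
        rw [level, totalPeak, ← Finset.add_sum_erase _ _ (Finset.mem_univ i),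
          ← Finset.add_sum_erase Finset.univ (fun i => peak (F i) M (L i)) (Finset.mem_univ i)]
        push_cast
        have : ∑ j ∈ Finset.univ.erase i, height (F j) (x j) ≤
            ∑ j ∈ Finset.univ.erase i, (peak (F j) M (L j) : ℤ) :=
          Finset.sum_le_sum fun j _ => height_le_peak _ (ih j).2 (ih j).1
        linarith
      have h3 := peak_mono (F i) M (ih i).1
      omega
    · simp only [Function.update_of_ne hij] at hlt
      exact absurd (ih i).2 (by omega)

theorem Reach.height_le {M : ℕ} (hM : totalPeak F L M ≤ M) {x : ι → ℕ} (h : Reach F L 0 x)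
    (i : ι) : height (F i) (x i) ≤ peak (F i) M (L i) :=
  height_le_peak _ (h.bounds hM i).2 (h.bounds hM i).1

end Reach

/-! ### Two chains on the remaining part of the execution -/

/-- Two chains with heights `a` and `b` run from positions `gv` and `gw`, above a constant height
`K`; the first must get to position at least `V` (and at most `la`), the second exactly to `W`, and
the level at the end must be at least `c`. -/
structure Grid where
  K : ℤ
  a : ℕ → ℤ
  b : ℕ → ℤ
  la : ℕ
  W : ℕ
  V : ℕ
  gv : ℕ
  gw : ℕ
  c : ℤ

namespace Grid

variable (g : Grid)

/-- One valid operation on one of the two chains. -/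
def Step (p q : ℕ × ℕ) : Prop :=
  ((p.1 < g.la ∧ q = (p.1 + 1, p.2)) ∨ (p.2 < g.W ∧ q = (p.1, p.2 + 1))) ∧
    0 ≤ g.K + g.a q.1 + g.b q.2

/-- Reachability by valid operations. -/
abbrev Reach : ℕ × ℕ → ℕ × ℕ → Prop := Relation.ReflTransGen g.Step

/-- The final position `(e, W)` is admissible and reachable from `p`. -/
def EndsAt (p : ℕ × ℕ) (e : ℕ) : Prop :=
  g.V ≤ e ∧ g.Reach p (e, g.W) ∧ g.c ≤ g.K + g.a e + g.b g.W

/-- Some admissible final position is reachable from `p`. -/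
def Solvable (p : ℕ × ℕ) : Prop := ∃ e, g.EndsAt p e

/-- The two chains start at a position whose heights are never exceeded. -/
structure StartsAtPeak : Prop where
  gv_le : g.gv ≤ g.V
  V_le : g.V ≤ g.la
  gw_le : g.gw ≤ g.W
  c_nonneg : 0 ≤ g.c
  start : 0 ≤ g.K + g.a g.gv + g.b g.gw
  peak : ∀ x y, g.Reach (g.gv, g.gw) (x, y) → g.a x ≤ g.a g.gv ∧ g.b y ≤ g.b g.gw

variable {g}

theorem Reach.le {p q : ℕ × ℕ} (h : g.Reach p q) : p.1 ≤ q.1 ∧ p.2 ≤ q.2 := by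
  induction h with
  | refl => simp
  | tail _ h ih =>
    obtain ⟨⟨-, rfl⟩ | ⟨-, rfl⟩, -⟩ := h <;> simp <;> omega

theorem Reach.le_la {p q : ℕ × ℕ} (h : g.Reach p q) (hp : p.1 ≤ g.la) : q.1 ≤ g.la := by
  induction h with
  | refl => exact hp
  | tail _ h ih =>
    obtain ⟨⟨h, rfl⟩ | ⟨-, rfl⟩, -⟩ := h <;> simp <;> omega

theorem Reach.valid {p q : ℕ × ℕ} (h : g.Reach p q) (hp : 0 ≤ g.K + g.a p.1 + g.b p.2) :
    0 ≤ g.K + g.a q.1 + g.b q.2 := by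
  induction h with
  | refl => exact hp
  | tail _ h _ => exact h.2

/-- The first coordinate grows by unit steps and so takes every intermediate value. The path is
split where it first takes the value `z`. -/
theorem Reach.cross_fst {p q : ℕ × ℕ} (h : g.Reach p q) {z : ℕ} (hp : p.1 ≤ z) (hq : z ≤ q.1) :
    ∃ y, g.Reach p (z, y) ∧ g.Reach (z, y) q := by
  induction h with
  | refl =>
    obtain rfl : z = p.1 := le_antisymm hq hp
    exact ⟨p.2, .refl, .refl⟩
  | @tail q r h1 h2 ih =>
    by_cases hz : z ≤ q.1
    · obtain ⟨y, h3, h4⟩ := ih hz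
      exact ⟨y, h3, h4.tail h2⟩
    · have h2' := h2
      obtain ⟨⟨-, rfl⟩ | ⟨-, rfl⟩, -⟩ := h2'
      · simp only at hq
        obtain rfl : z = q.1 + 1 := by omega
        exact ⟨q.2, h1.tail h2, .refl⟩
      · exact absurd hq hz

theorem Reach.cross_snd {p q : ℕ × ℕ} (h : g.Reach p q) {z : ℕ} (hp : p.2 ≤ z) (hq : z ≤ q.2) :
    ∃ x, g.Reach p (x, z) ∧ g.Reach (x, z) q := by
  induction h with
  | refl =>
    obtain rfl : z = p.2 := le_antisymm hq hp
    exact ⟨p.1, .refl, .refl⟩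
  | @tail q r h1 h2 ih =>
    by_cases hz : z ≤ q.2
    · obtain ⟨y, h3, h4⟩ := ih hz
      exact ⟨y, h3, h4.tail h2⟩
    · have h2' := h2
      obtain ⟨⟨-, rfl⟩ | ⟨-, rfl⟩, -⟩ := h2'
      · exact absurd hq hz
      · simp only at hq
        obtain rfl : z = q.2 + 1 := by omega
        exact ⟨q.1, h1.tail h2, .refl⟩

theorem reach_fst {x x' y : ℕ} (hx : x ≤ x') (hla : x' ≤ g.la)
    (h : ∀ z, x ≤ z → z ≤ x' → 0 ≤ g.K + g.a z + g.b y) : g.Reach (x, y) (x', y) := by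
  induction x', hx using Nat.le_induction with
  | base => exact .refl
  | succ k hk ih =>
    exact (ih (by omega) fun z h1 h2 => h z h1 (by omega)).tail
      ⟨.inl ⟨by simp; omega, rfl⟩, h _ (by omega) le_rfl⟩

theorem reach_snd {x y y' : ℕ} (hy : y ≤ y') (hW : y' ≤ g.W)
    (h : ∀ z, y ≤ z → z ≤ y' → 0 ≤ g.K + g.a x + g.b z) : g.Reach (x, y) (x, y') := by
  induction y', hy using Nat.le_induction with
  | base => exact .refl
  | succ k hk ih =>
    exact (ih (by omega) fun z h1 h2 => h z h1 (by omega)).tail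
      ⟨.inr ⟨by simp; omega, rfl⟩, h _ (by omega) le_rfl⟩

/-- The second chain cannot be traced back from position `j` when the first is at height `α`. -/
def Blocked (g : Grid) (j : ℕ) (α : ℤ) : Prop := ¬ (g.gw < j ∧ 0 ≤ g.K + α + g.b (j - 1))

/-- The part of the two chains traced back from the end to positions `i` and `j`, with maxima `α`
and `β`: from the position of these maxima the end can be reached. -/
structure Traced (g : Grid) (i j : ℕ) (α β : ℤ) : Prop where
  gv_le : g.gv ≤ i
  le_V : i ≤ g.V
  gw_le : g.gw ≤ j
  le_W : j ≤ g.W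
  sound : ∃ x y, i ≤ x ∧ x ≤ g.la ∧ j ≤ y ∧ y ≤ g.W ∧ g.a x = α ∧ g.b y = β ∧
    g.Solvable (x, y) ∧ (∀ z, i ≤ z → z ≤ x → 0 ≤ g.K + g.a z + β) ∧
    ∀ z, j ≤ z → z ≤ y → 0 ≤ g.K + α + g.b z
  le_fst : ∀ x, i ≤ x → x ≤ g.V → g.a x ≤ α
  le_snd : ∀ y, j ≤ y → y ≤ g.W → g.b y ≤ β

/-- The first chain does not exceed height `α` after position `V` in any solution. -/
def TailLE (g : Grid) (α : ℤ) : Prop :=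
  ∀ e, g.EndsAt (g.gv, g.gw) e → ∀ x, g.V ≤ x → x ≤ e → g.a x ≤ α

/-- The witness for the maxima is kept unless position `j - 1` is at least as high. In that case the
witness moves to `(x, j - 1)`, from where running the second chain alone leads to the old one. -/
theorem Traced.move_snd {i j : ℕ} {α β : ℤ} (h : g.Traced i j α β)
    (hj : g.gw < j) (h0 : 0 ≤ g.K + α + g.b (j - 1)) :
    g.Traced i (j - 1) α (max β (g.b (j - 1))) := by
  obtain ⟨x, y, hx, hxl, hy, hyW, rfl, rfl, ⟨e, he⟩, ha, hb⟩ := h.sound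
  have hb' : ∀ z, j - 1 ≤ z → z ≤ y → 0 ≤ g.K + g.a x + g.b z := fun z h1 h2 => by
    rcases Nat.lt_or_ge z j with h | h
    · obtain rfl : z = j - 1 := by omega
      exact h0
    · exact hb z h h2
  have := h.le_W
  refine ⟨h.gv_le, h.le_V, by omega, by omega, ?_, h.le_fst, fun z h1 h2 => ?_⟩
  · rcases le_total (g.b (j - 1)) (g.b y) with hle | hle
    · rw [max_eq_left hle]
      exact ⟨x, y, hx, hxl, by omega, hyW, rfl, rfl, ⟨e, he⟩, ha, hb'⟩
    · rw [max_eq_right hle]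
      refine ⟨x, j - 1, hx, hxl, le_rfl, by omega, rfl, rfl,
        ⟨e, he.1, (reach_snd (by omega) hyW hb').trans he.2.1, he.2.2⟩, fun z h1 h2 => ?_,
        fun z h1 h2 => hb' z h1 (by omega)⟩
      linarith [ha z h1 h2]
  · rcases Nat.lt_or_ge z j with h' | h'
    · obtain rfl : z = j - 1 := by omega
      exact le_max_right _ _
    · exact (h.le_snd z h' h2).trans (le_max_left _ _)

theorem Traced.move_fst {i j : ℕ} {α β : ℤ} (h : g.Traced i j α β)
    (hi : g.gv < i) (h0 : 0 ≤ g.K + g.a (i - 1) + β) :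
    g.Traced (i - 1) j (max α (g.a (i - 1))) β := by
  obtain ⟨x, y, hx, hxl, hy, hyW, rfl, rfl, ⟨e, he⟩, ha, hb⟩ := h.sound
  have ha' : ∀ z, i - 1 ≤ z → z ≤ x → 0 ≤ g.K + g.a z + g.b y := fun z h1 h2 => by
    rcases Nat.lt_or_ge z i with h | h
    · obtain rfl : z = i - 1 := by omega
      exact h0
    · exact ha z h h2
  have := h.le_V
  refine ⟨by omega, by omega, h.gw_le, h.le_W, ?_, fun z h1 h2 => ?_, h.le_snd⟩
  · rcases le_total (g.a (i - 1)) (g.a x) with hle | hle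
    · rw [max_eq_left hle]
      exact ⟨x, y, by omega, hxl, hy, hyW, rfl, rfl, ⟨e, he⟩, ha', hb⟩
    · rw [max_eq_right hle]
      refine ⟨i - 1, y, le_rfl, by omega, hy, hyW, rfl, rfl,
        ⟨e, he.1, (reach_fst (by omega) hxl ha').trans he.2.1, he.2.2⟩,
        fun z h1 h2 => ha' z h1 (by omega), fun z h1 h2 => ?_⟩
      linarith [hb z h1 h2]
  · rcases Nat.lt_or_ge z i with h' | h'
    · obtain rfl : z = i - 1 := by omega
      exact le_max_right _ _
    · exact (h.le_fst z h' h2).trans (le_max_left _ _)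

theorem StartsAtPeak.snd_le (hg : g.StartsAtPeak) {e : ℕ} (he : g.EndsAt (g.gv, g.gw) e) {y : ℕ}
    (h1 : g.gw ≤ y) (h2 : y ≤ g.W) : g.b y ≤ g.b g.gw := by
  obtain ⟨x, hx, -⟩ := he.2.1.cross_snd h1 h2
  exact (hg.peak x y hx).2

/-- Every solution ends in the quadrant beyond `i` and `j`. If it started outside, its entering step
would leave column `i - 1` or row `j - 1` with the other chain no higher than its traced maximum, so
the tracing could have continued. If the start is the corner itself, only the comparison of heights
remains. -/
theorem Traced.solvable_iff (hg : g.StartsAtPeak) {i j : ℕ} {α β : ℤ} (h : g.Traced i j α β)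
    (ht : g.TailLE α) (hj : g.Blocked j α)
    (hi : ¬ (g.gv < i ∧ 0 ≤ g.K + g.a (i - 1) + β)) :
    g.Solvable (g.gv, g.gw) ↔
      i = g.gv ∧ j = g.gw ∧ α ≤ g.a g.gv ∧ β ≤ g.b g.gw := by
  obtain ⟨x, y, hx, hxl, hy, hyW, ha, hb, hS, h1, h2⟩ := h.sound
  constructor
  · rintro ⟨e, he⟩
    -- Up to `V` the bound comes from the traced part, and beyond `V` from the search through the
    -- tails.
    have hbound : ∀ z, i ≤ z → z ≤ e → g.a z ≤ α := fun z h1 h2 => by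
      rcases le_total z g.V with h3 | h3
      · exact h.le_fst z h1 h3
      · exact ht e he z h3 h2
    have key : i = g.gv ∧ j = g.gw := by
      by_contra hne
      -- By induction along the path, no point of it lies in the quadrant, which is absurd for its
      -- end point.
      have : ∀ q, g.Reach (g.gv, g.gw) q → q.1 ≤ e → q.2 ≤ g.W → ¬ (i ≤ q.1 ∧ j ≤ q.2) := by
        intro q hq
        induction hq with
        | refl =>
          rintro - - ⟨h3, h4⟩
          have := h.gv_le
          have := h.gw_le
          simp only at h3 h4
          omega
        | @tail q r h3 h4 ih =>
          have hv := Reach.valid h3 hg.start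
          have hle := Reach.le h3
          obtain ⟨⟨-, rfl⟩ | ⟨-, rfl⟩, -⟩ := h4
          · simp only at ih hle ⊢
            rintro h5 h6 ⟨h7, h8⟩
            have h9 : q.1 = i - 1 := by have := ih (by omega) h6; omega
            refine hi ⟨by have := ih (by omega) h6; omega, ?_⟩
            rw [← h9]
            linarith [h.le_snd q.2 h8 h6]
          · simp only at ih hle ⊢
            rintro h5 h6 ⟨h7, h8⟩
            have h9 : q.2 = j - 1 := by have := ih h5 (by omega); omega
            refine hj ⟨by have := ih h5 (by omega); omega, ?_⟩
            rw [← h9]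
            linarith [hbound q.1 h7 h5]
      exact this _ he.2.1 le_rfl le_rfl ⟨h.le_V.trans he.1, h.le_W⟩
    obtain ⟨rfl, rfl⟩ := key
    have hβ : β ≤ g.b g.gw := by rw [← hb]; exact hg.snd_le he hy hyW
    refine ⟨rfl, rfl, ?_, hβ⟩
    -- With the second chain waiting at its start, no lower than `β`, the first can run to where it
    -- attains `α`; the start being a peak then bounds `α`.
    have : g.Reach (g.gv, g.gw) (x, g.gw) := reach_fst hx hxl fun z h3 h4 => by
      linarith [h1 z h3 h4]
    rw [← ha]
    exact (hg.peak _ _ this).1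
  · rintro ⟨rfl, rfl, hα, hβ⟩
    obtain ⟨e, he⟩ := hS
    refine ⟨e, he.1, ?_, he.2.2⟩
    -- The second chain goes first, while the first waits at a height of at least `α`; then the
    -- first chain moves against the height `β`.
    refine ((reach_snd hy hyW fun z h3 h4 => ?_).trans
      (reach_fst hx hxl fun z h3 h4 => ?_)).trans he.2.1
    · linarith [h2 z h3 h4]
    · rw [hb]; exact h1 z h3 h4

/-- The part of the first chain between `V` and `e`, with maximum `top` and minimum `d`, and the
part of the second chain traced back to `j` from the end below the height `top`. -/
structure TailScan (g : Grid) (e j : ℕ) (top d β : ℤ) : Prop where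
  V_le : g.V ≤ e
  le_la : e ≤ g.la
  gw_le : g.gw ≤ j
  le_W : j ≤ g.W
  le_top : ∀ x, g.V ≤ x → x ≤ e → g.a x ≤ top
  top_eq : ∃ x, g.V ≤ x ∧ x ≤ e ∧ g.a x = top
  d_le : ∀ x, g.V ≤ x → x ≤ e → d ≤ g.a x
  d_eq : ∃ x, g.V ≤ x ∧ x ≤ e ∧ g.a x = d
  le_snd : ∀ y, j ≤ y → y ≤ g.W → g.b y ≤ β
  snd_eq : ∃ y, j ≤ y ∧ y ≤ g.W ∧ g.b y = β
  valid : ∀ y, j ≤ y → y < g.W → 0 ≤ g.K + top + g.b y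

/-- In some solution, the first chain has its largest height after `V` at position `e`. -/
def TailPeak (g : Grid) (e : ℕ) : Prop :=
  ∃ e', g.EndsAt (g.gv, g.gw) e' ∧ g.V ≤ e ∧ e ≤ e' ∧ ∀ x, g.V ≤ x → x ≤ e' → g.a x ≤ g.a e

/-- The record kept of the tails ending before `e`: whether a tail was accepted (`ok`), and then the
state in which the last one was. -/
structure TailDone (g : Grid) (e : ℕ) (top : ℤ) (ok : Prop) (j : ℕ) (α β : ℤ) : Prop where
  traced : ok → g.Traced g.V j α β ∧ α ≤ top
  peak : ∀ x, x < e → g.TailPeak x → ok ∧ g.a x ≤ α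

theorem TailScan.init (hg : g.StartsAtPeak) :
    g.TailScan g.V g.W (g.a g.V) (g.a g.V) (g.b g.W) where
  V_le := le_rfl
  le_la := hg.V_le
  gw_le := hg.gw_le
  le_W := le_rfl
  le_top x h1 h2 := by rw [le_antisymm h2 h1]
  top_eq := ⟨_, le_rfl, le_rfl, rfl⟩
  d_le x h1 h2 := by rw [le_antisymm h2 h1]
  d_eq := ⟨_, le_rfl, le_rfl, rfl⟩
  le_snd y h1 h2 := by rw [le_antisymm h2 h1]
  snd_eq := ⟨_, le_rfl, le_rfl, rfl⟩
  valid y h1 h2 := absurd h2 (by omega)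

theorem TailDone.init (top : ℤ) {ok : Prop} (hok : ¬ ok) (j : ℕ) (α β : ℤ) :
    g.TailDone g.V top ok j α β where
  traced h := absurd h hok
  peak x h1 h2 := by
    obtain ⟨e, -, h, -⟩ := h2
    omega

theorem TailScan.move {e j : ℕ} {top d β : ℤ} (h : g.TailScan e j top d β)
    (hj : g.gw < j) (h0 : 0 ≤ g.K + top + g.b (j - 1)) :
    g.TailScan e (j - 1) top d (max β (g.b (j - 1))) := by
  have := h.le_W
  refine { h with gw_le := by omega, le_W := by omega, le_snd := ?_, snd_eq := ?_, valid := ?_ }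
  · intro y h1 h2
    rcases Nat.lt_or_ge y j with h' | h'
    · obtain rfl : y = j - 1 := by omega
      exact le_max_right _ _
    · exact (h.le_snd y h' h2).trans (le_max_left _ _)
  · rcases le_total (g.b (j - 1)) β with hle | hle
    · rw [max_eq_left hle]
      obtain ⟨y, h1, h2, h3⟩ := h.snd_eq
      exact ⟨y, by omega, h2, h3⟩
    · rw [max_eq_right hle]
      exact ⟨j - 1, le_rfl, by omega, rfl⟩
  · intro y h1 h2
    rcases Nat.lt_or_ge y j with h' | h'
    · obtain rfl : y = j - 1 := by omega
      exact h0
    · exact h.valid y h' h2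

theorem TailScan.advance {e j : ℕ} {top d β : ℤ} (h : g.TailScan e j top d β) (he : e < g.la) :
    g.TailScan (e + 1) j (max top (g.a (e + 1))) (min d (g.a (e + 1))) β := by
  have := h.V_le
  refine { h with
    V_le := by omega, le_la := by omega, le_top := ?_, top_eq := ?_, d_le := ?_, d_eq := ?_,
    valid := ?_ }
  · intro x h1 h2
    rcases Nat.lt_or_ge e x with h' | h'
    · obtain rfl : x = e + 1 := by omega
      exact le_max_right _ _
    · exact (h.le_top x h1 h').trans (le_max_left _ _)
  · rcases le_total (g.a (e + 1)) top with hle | hle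
    · rw [max_eq_left hle]
      obtain ⟨y, h1, h2, h3⟩ := h.top_eq
      exact ⟨y, h1, by omega, h3⟩
    · rw [max_eq_right hle]
      exact ⟨e + 1, by omega, le_rfl, rfl⟩
  · intro x h1 h2
    rcases Nat.lt_or_ge e x with h' | h'
    · obtain rfl : x = e + 1 := by omega
      exact min_le_right _ _
    · exact (min_le_left _ _).trans (h.d_le x h1 h')
  · rcases le_total (g.a (e + 1)) d with hle | hle
    · rw [min_eq_right hle]
      exact ⟨e + 1, by omega, le_rfl, rfl⟩
    · rw [min_eq_left hle]
      obtain ⟨y, h1, h2, h3⟩ := h.d_eq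
      exact ⟨y, h1, by omega, h3⟩
  · intro y h1 h2
    linarith [h.valid y h1 h2, le_max_left top (g.a (e + 1))]

/-- The first chain may stop where the tail is highest instead of at `e`, since this only raises the
final level. It gets there against the height `β`, and the second chain then finishes against the
height `top`. -/
theorem TailScan.traced (hg : g.StartsAtPeak) {e j : ℕ} {top d β : ℤ}
    (h : g.TailScan e j top d β) (h1 : 0 ≤ g.K + d + β) (h2 : g.c ≤ g.K + top + g.b g.W) :
    g.Traced g.V j top β := by
  obtain ⟨x, hVx, hxe, hx⟩ := h.top_eq
  obtain ⟨y, hjy, hyW, hy⟩ := h.snd_eq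
  have hle := h.le_la
  have hv : ∀ z, j ≤ z → z ≤ g.W → 0 ≤ g.K + top + g.b z := fun z h3 h4 => by
    rcases h4.lt_or_eq with h5 | rfl
    · exact h.valid z h3 h5
    · exact hg.c_nonneg.trans h2
  refine ⟨hg.gv_le, le_rfl, h.gw_le, h.le_W,
    ⟨x, y, hVx, by omega, hjy, hyW, hx, hy, ⟨x, hVx, reach_snd hyW le_rfl fun z h3 h4 => ?_, ?_⟩,
      fun z h3 h4 => ?_, fun z h3 h4 => hv z h3 (h4.trans hyW)⟩, fun z h3 h4 => ?_, h.le_snd⟩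
  · rw [hx]; exact hv z (by omega) h4
  · rw [hx]; exact h2
  · linarith [h.d_le z h3 (by omega)]
  · obtain rfl := le_antisymm h3 h4
    exact h.le_top _ le_rfl h.V_le

/-- When the solution visits the lowest point of the tail, the second chain is already at `j` or
beyond: otherwise it would later pass `j - 1` with the first chain at most at `top`, which blocking
forbids. Hence the level there is at most `K + d + β`. -/
theorem TailScan.ok_of_tailPeak (hg : g.StartsAtPeak) {e j : ℕ} {top d β : ℤ}
    (h : g.TailScan e j top d β) (hj : g.Blocked j top) (hp : g.TailPeak e) :
    g.a e = top ∧ 0 ≤ g.K + d + β ∧ g.c ≤ g.K + top + g.b g.W := by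
  obtain ⟨e', he', hVe, hee', hmax⟩ := hp
  have htop : g.a e = top := by
    obtain ⟨x, h1, h2, rfl⟩ := h.top_eq
    exact le_antisymm (h.le_top e hVe le_rfl) (hmax x h1 (by omega))
  refine ⟨htop, ?_, ?_⟩
  · obtain ⟨z, h1, h2, rfl⟩ := h.d_eq
    have hgv := hg.gv_le
    obtain ⟨y, h3, h4⟩ := he'.2.1.cross_fst (z := z) (by simp; omega) (by simp; omega)
    have hv := h3.valid hg.start
    have h5 := Reach.le h3
    have h6 := Reach.le h4
    simp only at hv h5 h6
    have : j ≤ y := by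
      by_contra! hlt
      have hjW := h.le_W
      obtain ⟨x, h7, h8⟩ := h4.cross_snd (z := j - 1) (by simp; omega) (by simp; omega)
      have hv' := Reach.valid (h3.trans h7) hg.start
      have h9 := Reach.le h7
      have h10 := Reach.le h8
      simp only at h9 h10 hv'
      refine hj ⟨by omega, ?_⟩
      linarith [hmax x (by omega) h10.1]
    linarith [h.le_snd y this h6.2]
  · linarith [he'.2.2, hmax e' (by omega) le_rfl]

/-- Overwriting an earlier record loses nothing, because `top` bounds the first chain at all tail
positions up to `e`. -/
theorem TailScan.accept (hg : g.StartsAtPeak) {e j : ℕ} {top d β : ℤ} {ok' : Prop}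
    (h : g.TailScan e j top d β)
    (h1 : 0 ≤ g.K + d + β) (h2 : g.c ≤ g.K + top + g.b g.W) (hok : ok') :
    g.TailDone (e + 1) top ok' j top β where
  traced _ := ⟨h.traced hg h1 h2, le_rfl⟩
  peak x hx hp := by
    refine ⟨hok, ?_⟩
    obtain ⟨-, -, hV, -⟩ := hp
    exact h.le_top x hV (by omega)

theorem TailDone.reject (hg : g.StartsAtPeak) {e j jS : ℕ} {top d β αS βS : ℤ} {ok : Prop}
    (hd : g.TailDone e top ok jS αS βS) (h : g.TailScan e j top d β) (hj : g.Blocked j top)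
    (hn : ¬ (0 ≤ g.K + d + β ∧ g.c ≤ g.K + top + g.b g.W)) :
    g.TailDone (e + 1) top ok jS αS βS where
  traced := hd.traced
  peak x hx hp := by
    rcases Nat.lt_or_ge x e with h' | h'
    · exact hd.peak x h' hp
    · obtain rfl : x = e := by omega
      exact absurd (h.ok_of_tailPeak hg hj hp).2 hn

theorem TailDone.mono {e j : ℕ} {top top' α β : ℤ} {ok : Prop}
    (hd : g.TailDone e top ok j α β) (h : top ≤ top') : g.TailDone e top' ok j α β where
  traced hok := ⟨(hd.traced hok).1, (hd.traced hok).2.trans h⟩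
  peak := hd.peak

theorem exists_tailPeak {e : ℕ} (he : g.EndsAt (g.gv, g.gw) e) : 
    ∃ x ≤ e, g.TailPeak x ∧ ∀ y, g.V ≤ y → y ≤ e → g.a y ≤ g.a x := by
  obtain ⟨x, hx, hmax⟩ := (Finset.Icc g.V e).exists_max_image g.a ⟨e, by simp [he.1]⟩
  rw [Finset.mem_Icc] at hx
  have hmax' : ∀ y, g.V ≤ y → y ≤ e → g.a y ≤ g.a x := fun y h1 h2 =>
    hmax y (Finset.mem_Icc.2 ⟨h1, h2⟩)
  exact ⟨x, hx.2, ⟨e, he, hx.1, hx.2, hmax'⟩, hmax'⟩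

theorem EndsAt.le_la (hg : g.StartsAtPeak) {e : ℕ} (he : g.EndsAt (g.gv, g.gw) e) : e ≤ g.la :=
  he.2.1.le_la (hg.gv_le.trans hg.V_le)

/-- The highest tail position of any solution is a `TailPeak`, and the completed scan has bounded
all of these by `α`. -/
theorem TailDone.tailLE (hg : g.StartsAtPeak) {j : ℕ} {top α β : ℤ} {ok : Prop}
    (hd : g.TailDone (g.la + 1) top ok j α β) : g.TailLE α := by
  intro e he x h1 h2
  obtain ⟨y, hy, hp, hmax⟩ := exists_tailPeak he
  have hle := he.le_la hg
  exact (hmax x h1 h2).trans (hd.peak y (by omega) hp).2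

theorem TailDone.not_solvable (hg : g.StartsAtPeak) {j : ℕ} {top α β : ℤ} {ok : Prop}
    (hd : g.TailDone (g.la + 1) top ok j α β) (hok : ¬ ok) : ¬ g.Solvable (g.gv, g.gw) := by
  rintro ⟨e, he⟩
  obtain ⟨y, hy, hp, -⟩ := exists_tailPeak he
  have hle := he.le_la hg
  exact hok (hd.peak y (by omega) hp).1

end Grid

/-! ### Reduction of many chains to two -/

section Reduction

variable {ι : Type*} [Fintype ι] {F : ι → ℕ → Bool} {L : ι → ℕ} {M : ℕ}

theorem level_mono {x y : ι → ℕ} (h : ∀ i, height (F i) (x i) ≤ height (F i) (y i)) :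
    level F x ≤ level F y :=
  Finset.sum_le_sum fun i _ => h i

/-- The least fixed point of `totalPeak`: the largest reachable level. -/
structure IsTopLevel (F : ι → ℕ → Bool) (L : ι → ℕ) (M : ℕ) : Prop where
  le : totalPeak F L M ≤ M
  lt : ∀ r < M, r < totalPeak F L r

/-- The predecessor of `M` lies strictly below its total peak, and total peaks grow with the budget.
-/
theorem IsTopLevel.eq (h : IsTopLevel F L M) : totalPeak F L M = M := by
  refine le_antisymm h.le ?_
  rcases M with _ | M
  · exact Nat.zero_le _
  · have h1 := h.lt M M.lt_succ_self
    have h2 : totalPeak F L M ≤ totalPeak F L (M + 1) := by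
      have : level F (peakState F L M) ≤ level F (peakState F L (M + 1)) := level_mono fun i => by
        simp only [peakState]
        rw [height_peakPos (F i) (M + 1)]
        exact height_le_of_le_peakPos _ (peakPos_mono_left _ M.le_succ _)
      simpa [level_peakState] using this
    omega

theorem height_le_height_max {f : ℕ → Bool} {n x : ℕ} (hx : height f x ≤ peak f M n) :
    height f x ≤ height f (max x (peakPos f M n)) := by
  rcases le_total x (peakPos f M n) with h | h
  · rw [max_eq_right h, height_peakPos]; exact hx
  · rw [max_eq_left h]

variable [DecidableEq ι]

/-- The two chains `v` and `w` once all chains are at their peaks. -/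
def pairGrid (F : ι → ℕ → Bool) (L : ι → ℕ) (M : ℕ) (v w : ι) (V : ℕ) (c : ℤ) : Grid where
  K := M - peak (F v) M (L v) - peak (F w) M (L w)
  a := height (F v)
  b := height (F w)
  la := L v
  W := L w
  V := max V (peakPos (F v) M (L v))
  gv := peakPos (F v) M (L v)
  gw := peakPos (F w) M (L w)
  c := c

/-- The chain `w`, and an empty chain, once all chains are at their peaks. -/
def singleGrid (F : ι → ℕ → Bool) (L : ι → ℕ) (M : ℕ) (w : ι) (c : ℤ) : Grid where
  K := M - peak (F w) M (L w)
  a := height fun _ => false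
  b := height (F w)
  la := 0
  W := L w
  V := 0
  gv := 0
  gw := peakPos (F w) M (L w)
  c := c

/-! ### The two nodes on different chains -/

section Pair

variable {v w : ι} {V : ℕ} {c : ℤ}

theorem level_pair (hM : IsTopLevel F L M) (hvw : v ≠ w) (x y : ℕ) :
    level F (Function.update (Function.update (peakState F L M) v x) w y) =
      (pairGrid F L M v w V c).K + height (F v) x + height (F w) y := by
  rw [level_update, level_update, level_peakState, hM.eq, Function.update_of_ne hvw.symm]
  simp only [pairGrid, peakState, height_peakPos]
  ring

/-- All chains are first brought to their peaks; the path in the grid is then replayed with the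
other chains at rest. -/
theorem reach_of_pair (hM : IsTopLevel F L M) (hvw : v ≠ w) {q : ℕ × ℕ}
    (h : (pairGrid F L M v w V c).Reach (peakPos (F v) M (L v), peakPos (F w) M (L w)) q) :
    Reach F L 0 (Function.update (Function.update (peakState F L M) v q.1) w q.2) := by
  induction h with
  | refl =>
    have h1 : Function.update (peakState F L M) v (peakPos (F v) M (L v)) = peakState F L M :=
      Function.update_eq_self v _
    have h2 : Function.update (peakState F L M) w (peakPos (F w) M (L w)) = peakState F L M :=
      Function.update_eq_self w _
    simp only [h1, h2]
    exact reach_peakState hM.lt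
  | @tail q r _ h ih =>
    refine ih.tail ?_
    have hv := h.2
    obtain ⟨⟨h1, rfl⟩ | ⟨h1, rfl⟩, -⟩ := h
    · refine ⟨v, by simpa [hvw] using show q.1 < L v from h1, ?_,
        by rw [level_pair (V := V) (c := c) hM hvw]; exact hv⟩
      rw [Function.update_comm hvw.symm]
      simp [hvw]
    · refine ⟨w, by simpa using show q.2 < L w from h1, by simp, by rw [level_pair (V := V) (c := c) hM hvw]; exact hv⟩

/-- Other chains are replaced by their peaks, and `v` and `w` by the later of their position and the
peak position. No height drops, so validity survives; steps of other chains and steps before the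
peaks become void. -/
theorem pair_of_reach (hM : IsTopLevel F L M) (hvw : v ≠ w) {x : ι → ℕ} (h : Reach F L 0 x) :
    (pairGrid F L M v w V c).Reach (peakPos (F v) M (L v), peakPos (F w) M (L w))
      (max (x v) (peakPos (F v) M (L v)), max (x w) (peakPos (F w) M (L w))) ∧
    level F x ≤ (pairGrid F L M v w V c).K + height (F v) (max (x v) (peakPos (F v) M (L v))) +
      height (F w) (max (x w) (peakPos (F w) M (L w))) := by
  -- Stated for all reachable tuples, since the induction below applies it at the intermediate ones.
  have key : ∀ {x}, Reach F L 0 x → level F x ≤ (pairGrid F L M v w V c).K +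
      height (F v) (max (x v) (peakPos (F v) M (L v))) +
      height (F w) (max (x w) (peakPos (F w) M (L w))) := by
    intro x h
    rw [← level_pair hM hvw]
    refine level_mono fun i => ?_
    have := h.height_le hM.le i
    by_cases hw : i = w
    · subst hw
      simpa using height_le_height_max this
    · by_cases hv : i = v
      · subst hv
        simpa [hw] using height_le_height_max this
      · simpa [hw, hv, peakState, height_peakPos] using this
  refine ⟨?_, key h⟩
  induction h with
  | refl => simpa using Relation.ReflTransGen.refl
  | @tail x y hx h ih =>
    have hy := key (hx.tail h)
    obtain ⟨i, hi, rfl, hl⟩ := h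
    by_cases hv : i = v
    · subst hv
      simp only [Function.update_self, Function.update_of_ne hvw.symm] at hy ⊢
      rcases Nat.lt_or_ge (x i) (peakPos (F i) M (L i)) with hlt | hge
      · rw [max_eq_right hlt.le] at ih
        rw [max_eq_right (Nat.succ_le_of_lt hlt)]
        exact ih
      · rw [max_eq_left hge] at ih
        rw [max_eq_left (by omega : peakPos (F i) M (L i) ≤ x i + 1)] at hy ⊢
        exact ih.tail ⟨.inl ⟨hi, rfl⟩, hl.trans hy⟩
    · by_cases hw : i = w
      · subst hw
        simp only [Function.update_self, Function.update_of_ne hvw] at hy ⊢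
        rcases Nat.lt_or_ge (x i) (peakPos (F i) M (L i)) with hlt | hge
        · rw [max_eq_right hlt.le] at ih
          rw [max_eq_right (Nat.succ_le_of_lt hlt)]
          exact ih
        · rw [max_eq_left hge] at ih
          rw [max_eq_left (by omega : peakPos (F i) M (L i) ≤ x i + 1)] at hy ⊢
          exact ih.tail ⟨.inr ⟨hi, rfl⟩, hl.trans hy⟩
      · rw [Function.update_of_ne (Ne.symm hv), Function.update_of_ne (Ne.symm hw)]
        exact ih

/-- Paths in the grid are executions of the whole system, whose heights are bounded by the peaks. -/
theorem pairGrid_startsAtPeak (hM : IsTopLevel F L M) (hvw : v ≠ w) (hV : V ≤ L v)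
    (hc : 0 ≤ c) : (pairGrid F L M v w V c).StartsAtPeak where
  gv_le := le_max_right _ _
  V_le := max_le hV (peakPos_le _ _ _)
  gw_le := peakPos_le _ _ _
  c_nonneg := hc
  start := by simp only [pairGrid, height_peakPos]; omega
  peak x y h := by
    have := reach_of_pair hM hvw h
    have h1 := this.height_le hM.le v
    have h2 := this.height_le hM.le w
    simp only [Function.update_self, Function.update_of_ne hvw] at h1 h2
    simp only [pairGrid, height_peakPos]
    exact ⟨h1, h2⟩

theorem exists_reach_iff_pair (hM : IsTopLevel F L M) (hvw : v ≠ w) :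
    (∃ y, Reach F L 0 y ∧ y w = L w ∧ V ≤ y v ∧ c ≤ level F y) ↔
      (pairGrid F L M v w V c).Solvable
        ((pairGrid F L M v w V c).gv, (pairGrid F L M v w V c).gw) := by
  constructor
  · rintro ⟨y, hy, hw, hV, hc⟩
    obtain ⟨h1, h2⟩ := pair_of_reach (V := V) (c := c) hM hvw hy
    have hg := peakPos_le (F w) M (L w)
    rw [hw, max_eq_left hg] at h1 h2
    exact ⟨_, max_le_max_right _ hV, h1, hc.trans h2⟩
  · rintro ⟨e, hV, h, hc⟩
    refine ⟨_, reach_of_pair hM hvw h, by simp [pairGrid], ?_, ?_⟩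
    · simpa [hvw] using (le_max_left _ _).trans hV
    · rw [level_pair (V := V) (c := c) hM hvw]
      exact hc

end Pair

/-! ### The two nodes on the same chain -/

section Single

variable {w : ι} {c : ℤ}

theorem level_single (hM : IsTopLevel F L M) (y : ℕ) :
    level F (Function.update (peakState F L M) w y) =
      (singleGrid F L M w c).K + height (F w) y := by
  rw [level_update, level_peakState, hM.eq]
  simp only [singleGrid, peakState, height_peakPos]

theorem reach_of_single (hM : IsTopLevel F L M) {q : ℕ × ℕ}
    (h : (singleGrid F L M w c).Reach (0, peakPos (F w) M (L w)) q) :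
    q.1 = 0 ∧ Reach F L 0 (Function.update (peakState F L M) w q.2) := by
  induction h with
  | refl =>
    have h2 : Function.update (peakState F L M) w (peakPos (F w) M (L w)) = peakState F L M :=
      Function.update_eq_self w _
    simp only [h2, true_and]
    exact reach_peakState hM.lt
  | @tail q r _ h ih =>
    have hv := h.2
    obtain ⟨⟨h1, rfl⟩ | ⟨h1, rfl⟩, -⟩ := h
    · exact absurd h1 (Nat.not_lt_zero _)
    · refine ⟨ih.1, ih.2.tail ⟨w, by simpa using show q.2 < L w from h1, by simp, ?_⟩⟩
      rw [level_single (c := c) hM]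
      simpa [ih.1, singleGrid, height] using hv

theorem single_of_reach (hM : IsTopLevel F L M) {x : ι → ℕ} (h : Reach F L 0 x) :
    (singleGrid F L M w c).Reach (0, peakPos (F w) M (L w))
      (0, max (x w) (peakPos (F w) M (L w))) ∧
    level F x ≤ (singleGrid F L M w c).K + height (F w) (max (x w) (peakPos (F w) M (L w))) := by
  have key : ∀ {x}, Reach F L 0 x → level F x ≤ (singleGrid F L M w c).K +
      height (F w) (max (x w) (peakPos (F w) M (L w))) := by
    intro x h
    rw [← level_single hM]
    refine level_mono fun i => ?_
    have := h.height_le hM.le i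
    by_cases hw : i = w
    · subst hw
      simpa using height_le_height_max this
    · simpa [hw, peakState, height_peakPos] using this
  refine ⟨?_, key h⟩
  induction h with
  | refl => simpa using Relation.ReflTransGen.refl
  | @tail x y hx h ih =>
    have hy := key (hx.tail h)
    obtain ⟨i, hi, rfl, hl⟩ := h
    by_cases hw : i = w
    · subst hw
      simp only [Function.update_self] at hy ⊢
      rcases Nat.lt_or_ge (x i) (peakPos (F i) M (L i)) with hlt | hge
      · rw [max_eq_right (Nat.succ_le_of_lt hlt)]
      · rw [max_eq_left hge] at ih
        rw [max_eq_left (by omega : peakPos (F i) M (L i) ≤ x i + 1)] at hy ⊢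
        refine ih.tail ⟨.inr ⟨hi, rfl⟩, ?_⟩
        simpa [singleGrid, height] using hl.trans hy
    · rw [Function.update_of_ne (Ne.symm hw)]
      exact ih

theorem singleGrid_startsAtPeak (hM : IsTopLevel F L M) (hc : 0 ≤ c) :
    (singleGrid F L M w c).StartsAtPeak where
  gv_le := le_rfl
  V_le := le_rfl
  gw_le := peakPos_le _ _ _
  c_nonneg := hc
  start := by simp [singleGrid, height_peakPos, height]
  peak x y h := by
    obtain ⟨h0, h1⟩ := reach_of_single hM h
    have h2 := h1.height_le hM.le w
    simp only [Function.update_self] at h0 h2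
    subst h0
    simp only [singleGrid, height_peakPos]
    exact ⟨le_rfl, h2⟩

theorem exists_reach_iff_single (hM : IsTopLevel F L M) :
    (∃ y, Reach F L 0 y ∧ y w = L w ∧ c ≤ level F y) ↔
      (singleGrid F L M w c).Solvable
        ((singleGrid F L M w c).gv, (singleGrid F L M w c).gw) := by
  constructor
  · rintro ⟨y, hy, hw, hc⟩
    obtain ⟨h1, h2⟩ := single_of_reach (c := c) (w := w) hM hy
    have hg := peakPos_le (F w) M (L w)
    rw [hw, max_eq_left hg] at h1 h2
    refine ⟨0, le_rfl, h1, hc.trans ?_⟩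
    simpa [singleGrid, height] using h2
  · rintro ⟨e, hV, h, hc⟩
    obtain ⟨h0, h1⟩ := reach_of_single hM h
    simp only at h0
    subst h0
    refine ⟨_, h1, by simp [singleGrid], ?_⟩
    rw [level_single (c := c) hM]
    simpa [singleGrid, height] using hc

end Single

end Reduction

/-! ### Executions of a trace as lists of nodes -/

namespace ChainTrace

variable {p n : ℕ} (T : ChainTrace p n)

/-- The operations of chain `i`, `true` for a `P`-operation. -/
def bits (i : Fin p) (k : ℕ) : Bool := decide ((T.chain i).getD k .V = .P)

/-- The length of chain `i`. -/
def len (i : Fin p) : ℕ := (T.chain i).length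

/-- The value of the semaphore after the operations of a list. -/
def balance (l : List T.Node) : ℤ := (l.map T.op).count .V - (l.map T.op).count .P

variable {T}

theorem bits_node (x : T.Node) : T.bits x.1 x.2 = decide (T.op x = .P) := by
  simp only [bits, op, List.get_eq_getElem]
  rw [List.getD_eq_getElem _ _ x.2.2]
  exact decide_eq_decide.2 Iff.rfl

theorem balance_concat (l : List T.Node) (x : T.Node) :
    T.balance (l ++ [x]) = T.balance l + if T.bits x.1 x.2 then -1 else 1 := by
  rw [bits_node]
  cases h : T.op x <;> simp [balance, h] <;> ring

theorem isValid_concat (l : List T.Node) (x : T.Node) :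
    IsValid T.op (l ++ [x]) ↔ IsValid T.op l ∧ 0 ≤ T.balance (l ++ [x]) := by
  constructor
  · intro h
    refine ⟨fun l' hl' => h l' (hl'.trans (List.prefix_append _ _)), ?_⟩
    have := h _ List.prefix_rfl
    simp only [balance]
    omega
  · rintro ⟨h, h'⟩ l' hl'
    rcases List.prefix_concat_iff.1 hl' with rfl | hl'
    · simp only [balance] at h'
      omega
    · exact h l' hl'

/-- Without repetitions `x` occurs only at the displayed place, so whatever precedes it lies in `l`.
-/
theorem mem_of_pair_sublist {α : Type*} {l r : List α} {a x : α} (hn : (l ++ x :: r).Nodup)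
    (h : [a, x].Sublist (l ++ x :: r)) : a ∈ l := by
  have hn' := List.nodup_append.1 hn
  have hxr : x ∉ r := (List.nodup_cons.1 hn'.2.1).1
  have hxl : x ∉ l := fun hx => hn'.2.2 x hx x (by simp) rfl
  obtain ⟨l₁, l₂, heq, h1, h2⟩ := List.sublist_append_iff.1 h
  rcases l₁ with _ | ⟨b, l₁⟩
  · simp only [List.nil_append] at heq
    subst heq
    rcases List.sublist_cons_iff.1 h2 with h3 | ⟨r', h3, h4⟩
    · exact absurd (h3.subset (by simp)) hxr
    · simp only [List.cons.injEq] at h3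
      obtain ⟨-, rfl⟩ := h3
      exact absurd (h4.subset (by simp)) hxr
  · simp only [List.cons_append, List.cons.injEq] at heq
    exact h1.subset (by simp [heq.1])

/-- The list executes exactly the first `y i` operations of each chain `i`, in a possible order. -/
structure IsRun (l : List T.Node) (y : Fin p → ℕ) : Prop where
  nodup : l.Nodup
  mem_iff : ∀ x : T.Node, x ∈ l ↔ x.2.val < y x.1
  order : ∀ a b, T.graph.Adj a b → b ∈ l → [a, b].Sublist l

theorem IsRun.nil : IsRun ([] : List T.Node) 0 where
  nodup := List.nodup_nil
  mem_iff := by simp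
  order := by simp

theorem IsRun.concat {l : List T.Node} {y : Fin p → ℕ} (h : IsRun l y) {x : T.Node}
    (hx : y x.1 = x.2) : IsRun (l ++ [x]) (Function.update y x.1 (y x.1 + 1)) where
  nodup := by
    have : x ∉ l := fun hm => by have := (h.mem_iff x).1 hm; omega
    rw [List.nodup_append]
    refine ⟨h.nodup, by simp, ?_⟩
    rintro a ha b hb rfl
    simp only [List.mem_singleton] at hb
    exact this (hb ▸ ha)
  mem_iff z := by
    rw [List.mem_append, h.mem_iff, List.mem_singleton]
    obtain ⟨i, k⟩ := x
    obtain ⟨j, m⟩ := z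
    simp only at hx ⊢
    by_cases hij : j = i
    · subst hij
      simp only [Sigma.mk.injEq, heq_eq_eq, true_and, Function.update_self, Fin.ext_iff]
      omega
    · simp [hij]
  order a b hab hb := by
    rw [List.mem_append, List.mem_singleton] at hb
    rcases hb with hb | rfl
    · exact (h.order a b hab hb).trans (List.sublist_append_left _ _)
    · have ha : a ∈ l := by
        rw [h.mem_iff]
        have h1 := congrArg y hab.1
        have h2 := hab.2
        omega
      exact (List.singleton_sublist.2 ha).append (List.Sublist.refl [b])

theorem IsRun.isSubschedule {l : List T.Node} {y : Fin p → ℕ} (h : IsRun l y) :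
    IsSubschedule T.graph l := by
  induction hm : Fintype.card T.Node - l.length using Nat.strong_induction_on generalizing l y with
  | _ m ih =>
    by_cases hall : ∀ x, x ∈ l
    · exact ⟨l, ⟨h.nodup, hall, fun a b hab => h.order a b hab (hall b)⟩, List.prefix_rfl⟩
    · push Not at hall
      obtain ⟨x, hx⟩ := hall
      rw [h.mem_iff, not_lt] at hx
      -- The missing node may lie further along its chain; what can be appended is the first
      -- unexecuted node of that chain.
      have h' := h.concat (x := ⟨x.1, y x.1, by omega⟩) rfl
      have hlen := h'.nodup.length_le_card
      simp only [List.length_append, List.length_singleton] at hlen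
      obtain ⟨S, hS, hp⟩ := ih _ (by simp only [List.length_append, List.length_singleton]; omega)
        h' rfl
      exact ⟨S, hS, (List.prefix_append _ _).trans hp⟩

/-- Otherwise the predecessor of `x` on its chain would be unexecuted, although the schedule puts it
before `x`. -/
theorem IsRun.eq_of_next {S l r : List T.Node} (hS : IsSchedule T.graph S) {x : T.Node}
    (hl : S = l ++ x :: r) {y : Fin p → ℕ} (h : IsRun l y) : y x.1 = x.2 := by
  have hn := hS.1
  rw [hl] at hn
  have hx : x ∉ l := fun hx => (List.nodup_append.1 hn).2.2 x hx x (by simp) rfl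
  rw [h.mem_iff, not_lt] at hx
  by_contra hne
  have hlt : y x.1 < x.2 := by omega
  have := hS.2.2 ⟨x.1, x.2 - 1, by omega⟩ x ⟨rfl, by simp; omega⟩
  rw [hl] at this
  have := mem_of_pair_sublist hn this
  rw [h.mem_iff] at this
  simp only at this
  omega

theorem level_next (y : Fin p → ℕ) (i : Fin p) :
    level T.bits (Function.update y i (y i + 1)) =
      level T.bits y + if T.bits i (y i) then -1 else 1 := by
  rw [level_update, height]
  ring

theorem IsRun.of_isSubschedule {S l r : List T.Node} (hS : IsSchedule T.graph S) (hl : S = l ++ r)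
    (hv : IsValid T.op l) :
    ∃ y, IsRun l y ∧ Reach T.bits T.len 0 y ∧ level T.bits y = T.balance l := by
  induction l using List.reverseRecOn generalizing r with
  | nil => exact ⟨0, .nil, .refl, by simp [level, height, balance]⟩
  | append_singleton l x ih =>
    rw [isValid_concat] at hv
    obtain ⟨y, h1, h2, h3⟩ := ih (r := x :: r) (by simp [hl]) hv.1
    have hx := h1.eq_of_next hS (x := x) (r := r) (by simp [hl])
    have hlev : level T.bits (Function.update y x.1 (y x.1 + 1)) = T.balance (l ++ [x]) := by
      rw [level_next, h3, balance_concat, hx]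
    refine ⟨_, h1.concat hx, h2.tail ⟨x.1, ?_, rfl, by rw [hlev]; exact hv.2⟩, hlev⟩
    rw [hx]
    exact x.2.2

theorem IsRun.of_reach {y : Fin p → ℕ} (h : Reach T.bits T.len 0 y) :
    ∃ l : List T.Node, IsRun l y ∧ IsValid T.op l ∧ level T.bits y = T.balance l := by
  induction h with
  | refl =>
    refine ⟨[], .nil, fun l hl => ?_, by simp [level, height, balance]⟩
    rw [List.prefix_nil.1 hl]
    simp
  | @tail x y _ hs ih =>
    obtain ⟨l, h1, h2, h3⟩ := ih
    obtain ⟨i, hi, rfl, hlev⟩ := hs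
    have h4 := h1.concat (x := ⟨i, x i, hi⟩) rfl
    have h5 : level T.bits (Function.update x i (x i + 1)) = T.balance (l ++ [⟨i, x i, hi⟩]) := by
      rw [level_next, h3, balance_concat]
    exact ⟨_, h4, (isValid_concat _ _).2 ⟨h2, h5 ▸ hlev⟩, h5⟩

/-- The level needed before `w` is executed. -/
def need (w : T.Node) : ℤ := if T.bits w.1 w.2 then 1 else 0

/-- Positions never decrease, so an execution that ends with chain `w` at most at `k` has respected
this limit throughout. -/
theorem reach_truncate_iff {ι : Type*} [Fintype ι] [DecidableEq ι] {F : ι → ℕ → Bool}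
    {L : ι → ℕ} {w : ι} {k : ℕ} (hk : k ≤ L w) {y : ι → ℕ} :
    Reach F (Function.update L w k) 0 y ↔ Reach F L 0 y ∧ y w ≤ k := by
  constructor
  · intro h
    constructor
    · refine Relation.ReflTransGen.mono (r := Step F (Function.update L w k)) ?_ _ _ h
      rintro x z ⟨i, hi, h⟩
      refine ⟨i, hi.trans_le ?_, h⟩
      by_cases hw : i = w
      · subst hw; simpa using hk
      · simp [hw]
    · induction h with
      | refl => simp
      | tail _ h ih =>
        obtain ⟨i, hi, rfl, -⟩ := h
        by_cases hw : i = w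
        · subst hw; simpa using hi
        · simpa [Ne.symm hw] using ih
  · rintro ⟨h, hy⟩
    induction h with
    | refl => exact .refl
    | tail _ h ih =>
      refine (ih ((h.le w).trans hy)).tail ?_
      obtain ⟨i, hi, rfl, hl⟩ := h
      refine ⟨i, ?_, rfl, hl⟩
      by_cases hw : i = w
      · subst hw; simpa using hy
      · simpa [hw] using hi

/-- The lengths of the chains, that of the chain of `w` cut off before `w`. -/
def lim (w : T.Node) : Fin p → ℕ := Function.update T.len w.1 w.2

/-- Only the part before `w` matters: it contains `v`, stops exactly at `w` on the chain of `w`, and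
leaves what `w` needs. What follows `w` can be dropped, because completing a run to a schedule
requires no validity. -/
theorem canPrecede_iff (v w : T.Node) :
    CanPrecede T.graph T.op v w ↔ ∃ y, Reach T.bits (lim w) 0 y ∧ y w.1 = lim w w.1 ∧
      v.2 + 1 ≤ y v.1 ∧ need w ≤ level T.bits y := by
  have hlim : lim w w.1 = w.2 := by simp [lim]
  have hle : w.2 ≤ T.len w.1 := w.2.2.le
  constructor
  · rintro ⟨l, ⟨S, hS, r, rfl⟩, hv, hsub⟩
    obtain ⟨l₁, l₂, rfl⟩ := List.append_of_mem (hsub.subset (by simp : w ∈ [v, w]))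
    have hnd : (l₁ ++ w :: l₂).Nodup := (List.nodup_append.1 hS.1).1
    have hvl := mem_of_pair_sublist hnd hsub
    have hv' : IsValid T.op (l₁ ++ [w]) := fun l' hl' => hv l' (hl'.trans ⟨l₂, by simp⟩)
    rw [isValid_concat, balance_concat] at hv'
    obtain ⟨y, h1, h2, h3⟩ := IsRun.of_isSubschedule (l := l₁) (r := w :: l₂ ++ r) hS (by simp) hv'.1
    have hw := h1.eq_of_next (x := w) (r := l₂ ++ r) hS (by simp)
    refine ⟨y, (reach_truncate_iff hle).2 ⟨h2, hw.le⟩, hw.trans hlim.symm, (h1.mem_iff v).1 hvl, ?_⟩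
    rw [h3, need]
    have := hv'.2
    have h0 : 0 ≤ T.balance l₁ := by
      have := hv'.1 l₁ List.prefix_rfl
      simp only [balance]
      omega
    split_ifs at this ⊢ <;> omega
  · rintro ⟨y, h1, hw, hv, hlev⟩
    rw [hlim] at hw
    obtain ⟨l, h2, h3, h4⟩ := IsRun.of_reach ((reach_truncate_iff hle).1 h1).1
    have h5 := h2.concat hw
    refine ⟨_, h5.isSubschedule, (isValid_concat _ _).2 ⟨h3, ?_⟩, ?_⟩
    · rw [balance_concat, ← h4]
      rw [need] at hlev
      have : 0 ≤ level T.bits y := by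
        split_ifs at hlev <;> omega
      split_ifs at hlev ⊢ <;> omega
    · exact (List.singleton_sublist.2 ((h2.mem_iff v).2 hv)).append (List.Sublist.refl [w])

theorem need_nonneg (w : T.Node) : 0 ≤ need w := by
  unfold need
  split_ifs <;> simp

/-- Nodes of different chains. -/
theorem canPrecede_iff_pair {v w : T.Node} {M : ℕ} (hM : IsTopLevel T.bits (lim w) M)
    (hvw : v.1 ≠ w.1) :
    CanPrecede T.graph T.op v w ↔ (pairGrid T.bits (lim w) M v.1 w.1 (v.2 + 1) (need w)).Solvable
      (peakPos (T.bits v.1) M (lim w v.1), peakPos (T.bits w.1) M (lim w w.1)) := by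
  rw [canPrecede_iff]
  exact exists_reach_iff_pair hM hvw

/-- Nodes of the same chain. -/
theorem canPrecede_iff_single {v w : T.Node} {M : ℕ} (hM : IsTopLevel T.bits (lim w) M)
    (hvw : v.1 = w.1) :
    CanPrecede T.graph T.op v w ↔ v.2.val < w.2 ∧ (singleGrid T.bits (lim w) M w.1 (need w)).Solvable
      (0, peakPos (T.bits w.1) M (lim w w.1)) := by
  rw [canPrecede_iff]
  have hlim : lim w w.1 = w.2 := by simp [lim]
  refine Iff.trans ?_ (and_congr_right' (exists_reach_iff_single hM))
  -- On a common chain both conditions concern the same position, so passing `v` just means that `v`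
  -- comes before `w`.
  have hy : ∀ y : Fin p → ℕ, y v.1 = y w.1 := fun y => congrArg y hvw
  constructor
  · rintro ⟨y, h1, h2, h3, h4⟩
    exact ⟨by have := hy y; omega, y, h1, h2, h4⟩
  · rintro ⟨h, y, h1, h2, h4⟩
    exact ⟨y, h1, h2, by have := hy y; omega, h4⟩

end ChainTrace

/-! ### Structured programs for the random access machine -/

/-- Structured commands. The conditional runs its first branch if the register is zero; the loop
runs `pre`, stops if the register is then zero, and else runs its body and starts again. -/
inductive Cmd where
  | basic (i : RamInstr)
  | seq (c₁ c₂ : Cmd)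
  | ite (r : ℕ) (c₁ c₂ : Cmd)
  | loop (pre : Cmd) (r : ℕ) (body : Cmd)

/-- Registers, memory, and the number of steps made. -/
@[ext]
structure Mach where
  reg : ℕ → ℕ
  mem : ℕ → ℕ
  time : ℕ

namespace Mach

/-- All words are at most `B`. -/
def Bdd (s : Mach) (B : ℕ) : Prop := (∀ r, s.reg r ≤ B) ∧ ∀ a, s.mem a ≤ B

/-- Write a register, in one step. -/
def set (s : Mach) (d x : ℕ) : Mach := ⟨Function.update s.reg d x, s.mem, s.time + 1⟩

/-- Write a memory cell, in one step. -/
def put (s : Mach) (a x : ℕ) : Mach := ⟨s.reg, Function.update s.mem a x, s.time + 1⟩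

/-- One step without effect on registers and memory. -/
def tick (s : Mach) : Mach := ⟨s.reg, s.mem, s.time + 1⟩

/-- The configuration with program counter `l`. -/
def toRam (s : Mach) (l : ℕ) : RamState := ⟨l, s.reg, s.mem⟩

variable (s : Mach) (d x r : ℕ)

theorem reg_set : (s.set d x).reg r = if r = d then x else s.reg r := by
  simp [set, Function.update_apply]

theorem mem_set : (s.set d x).mem = s.mem := rfl

theorem time_set : (s.set d x).time = s.time + 1 := rfl

theorem mem_put : (s.put d x).mem r = if r = d then x else s.mem r := by
  simp [put, Function.update_apply]

theorem time_put : (s.put d x).time = s.time + 1 := rfl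

theorem reg_tick : s.tick.reg = s.reg := rfl

theorem mem_tick : s.tick.mem = s.mem := rfl

theorem time_tick : s.tick.time = s.time + 1 := rfl

variable {s d x} {B : ℕ}

theorem Bdd.set (h : s.Bdd B) (hx : x ≤ B) : (s.set d x).Bdd B :=
  ⟨fun r => by rw [reg_set]; split_ifs; exacts [hx, h.1 r], h.2⟩

theorem Bdd.put (h : s.Bdd B) (hx : x ≤ B) : (s.put d x).Bdd B :=
  ⟨h.1, fun r => by rw [mem_put]; split_ifs; exacts [hx, h.2 r]⟩

end Mach

/-! ### Compilation of structured commands and its correctness -/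

namespace Cmd

/-- The number of instructions of the compiled command. -/
def size : Cmd → ℕ
  | basic _ => 1
  | seq c₁ c₂ => c₁.size + c₂.size
  | ite _ c₁ c₂ => c₂.size + (c₁.size + 2)
  | loop pre _ body => pre.size + (body.size + 2)

/-- The instructions of a command, placed from line `l` on. -/
def compile : Cmd → ℕ → RamProgram
  | basic i, _ => [i]
  | seq c₁ c₂, l => c₁.compile l ++ c₂.compile (l + c₁.size)
  | ite r c₁ c₂, l =>
      .jumpZero r (l + 1 + c₂.size + 1) :: (c₂.compile (l + 1) ++
        .jump (l + 1 + c₂.size + 1 + c₁.size) :: c₁.compile (l + 1 + c₂.size + 1))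
  | loop pre r body, l =>
      pre.compile l ++ .jumpZero r (l + pre.size + 1 + body.size + 1) ::
        (body.compile (l + pre.size + 1) ++ [.jump l])

theorem length_compile (c : Cmd) (l : ℕ) : (c.compile l).length = c.size := by
  induction c generalizing l with
  | basic => rfl
  | seq _ _ h₁ h₂ => simp [compile, size, h₁, h₂]
  | ite _ _ _ h₁ h₂ => simp [compile, size, h₁, h₂]; omega
  | loop _ _ _ h₁ h₂ => simp [compile, size, h₁, h₂]

/-- The effect of an instruction without jump. -/
inductive Basic : RamInstr → Mach → Mach → Prop
  | const (d c : ℕ) (s : Mach) : Basic (.const d c) s (s.set d c)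
  | move (d a : ℕ) (s : Mach) : Basic (.move d a) s (s.set d (s.reg a))
  | add (d a b : ℕ) (s : Mach) : Basic (.add d a b) s (s.set d (s.reg a + s.reg b))
  | sub (d a b : ℕ) (s : Mach) : Basic (.sub d a b) s (s.set d (s.reg a - s.reg b))
  | load (d a : ℕ) (s : Mach) : Basic (.load d a) s (s.set d (s.mem (s.reg a)))
  | store (a b : ℕ) (s : Mach) : Basic (.store a b) s (s.put (s.reg a) (s.reg b))

/-- The execution of a command with words at most `B`. -/
inductive Exec (B : ℕ) : Cmd → Mach → Mach → Prop
  | basic {i s s'} : Basic i s s' → s'.Bdd B → Exec B (basic i) s s'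
  | seq {c₁ c₂ s s' s''} : Exec B c₁ s s' → Exec B c₂ s' s'' → Exec B (seq c₁ c₂) s s''
  | iteZero {r c₁ c₂ s s'} : s.reg r = 0 → Exec B c₁ s.tick s' → Exec B (ite r c₁ c₂) s s'
  | itePos {r c₁ c₂ s s'} : s.reg r ≠ 0 → Exec B c₂ s.tick s' → Exec B (ite r c₁ c₂) s s'.tick
  | loopDone {pre r body s s'} : Exec B pre s s' → s'.reg r = 0 →
      Exec B (loop pre r body) s s'.tick
  | loopStep {pre r body s s' s'' s'''} : Exec B pre s s' → s'.reg r ≠ 0 →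
      Exec B body s'.tick s'' → Exec B (loop pre r body) s''.tick s''' →
      Exec B (loop pre r body) s s'''

/-- The program leads from one configuration to another with words at most `B`. -/
def Runs (Q : RamProgram) (B : ℕ) (σ : RamState) (t : ℕ) (σ' : RamState) : Prop :=
  Q.step^[t] σ = σ' ∧ ∀ t' ≤ t, (Q.step^[t'] σ).WordsAtMost B

theorem Runs.trans {Q : RamProgram} {B : ℕ} {σ σ' σ'' : RamState} {t t' : ℕ}
    (h : Runs Q B σ t σ') (h' : Runs Q B σ' t' σ'') : Runs Q B σ (t + t') σ'' := by
  refine ⟨by rw [add_comm, Function.iterate_add_apply, h.1, h'.1], fun u hu => ?_⟩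
  rcases le_total u t with h1 | h1
  · exact h.2 u h1
  · obtain ⟨k, rfl⟩ := Nat.exists_eq_add_of_le h1
    rw [add_comm, Function.iterate_add_apply, h.1]
    exact h'.2 k (by omega)

theorem Runs.single {Q : RamProgram} {B : ℕ} {σ σ' : RamState} {i : RamInstr}
    (hi : Q.instrAt σ.pc = i) (h : σ.exec i = σ') (h1 : σ.WordsAtMost B)
    (h2 : σ'.WordsAtMost B) : Runs Q B σ 1 σ' := by
  have : Q.step σ = σ' := by rw [RamProgram.step, hi, h]
  refine ⟨by simpa using this, fun t ht => ?_⟩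
  obtain rfl | rfl : t = 0 ∨ t = 1 := by omega
  · exact h1
  · simpa [this] using h2

/-- The program contains the instructions `P` from line `l` on. -/
def Located (Q : RamProgram) (l : ℕ) (P : RamProgram) : Prop :=
  ∃ Q₁ Q₂, Q = Q₁ ++ (P ++ Q₂) ∧ Q₁.length = l

section Located

variable {Q P P' : RamProgram} {l : ℕ}

theorem Located.left (h : Located Q l (P ++ P')) : Located Q l P := by
  obtain ⟨Q₁, Q₂, rfl, rfl⟩ := h
  exact ⟨Q₁, P' ++ Q₂, by simp, rfl⟩

theorem Located.right (h : Located Q l (P ++ P')) : Located Q (l + P.length) P' := by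
  obtain ⟨Q₁, Q₂, rfl, rfl⟩ := h
  exact ⟨Q₁ ++ P, Q₂, by simp, by simp⟩

theorem Located.tail {i : RamInstr} (h : Located Q l (i :: P)) : Located Q (l + 1) P :=
  Located.right (P := [i]) h

theorem Located.head {i : RamInstr} (h : Located Q l (i :: P)) : Q.instrAt l = i := by
  obtain ⟨Q₁, Q₂, rfl, rfl⟩ := h
  simp [RamProgram.instrAt]

end Located

theorem Exec.bdd {B : ℕ} {c : Cmd} {s s' : Mach} (h : Exec B c s s') : s'.Bdd B := by
  induction h with
  | basic _ h => exact h
  | seq _ _ _ h => exact h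
  | iteZero _ _ h => exact h
  | itePos _ _ h => exact h
  | loopDone _ _ h => exact h
  | loopStep _ _ _ _ _ _ h => exact h

/-- The time recorded in `Mach` is the exact number of machine steps. The ticks stand for the
conditional jumps, the jump over the zero branch of a conditional, and the jump back in a loop. -/
theorem Exec.runs {B : ℕ} {c : Cmd} {s s' : Mach} (h : Exec B c s s') {Q : RamProgram} {l : ℕ}
    (hQ : Located Q l (c.compile l)) (hs : s.Bdd B) :
    ∃ t, s'.time = s.time + t ∧ Runs Q B (s.toRam l) t (s'.toRam (l + c.size)) := by
  induction h generalizing l with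
  | basic hb hB =>
    refine ⟨1, ?_, Runs.single (Located.head hQ) ?_ hs hB⟩
    · cases hb <;> rfl
    · cases hb <;> rfl
  | seq h1 h2 ih1 ih2 =>
    obtain ⟨t, ht, h3⟩ := ih1 hQ.left hs
    have hr := hQ.right
    rw [length_compile] at hr
    obtain ⟨t', ht', h4⟩ := ih2 hr h1.bdd
    refine ⟨t + t', by omega, h3.trans ?_⟩
    rw [size, ← add_assoc]
    exact h4
  | @iteZero r c₁ c₂ s s' hr h1 ih =>
    have h2 := hQ.tail.right
    rw [length_compile] at h2
    obtain ⟨t, ht, h3⟩ := ih h2.tail hs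
    have h4 : Runs Q B (s.toRam l) 1 (s.tick.toRam (l + 1 + c₂.size + 1)) :=
      Runs.single (Located.head hQ) (by simp [RamState.exec, Mach.toRam, Mach.tick, hr]) hs hs
    refine ⟨1 + t, by simp [Mach.tick] at ht; omega, h4.trans ?_⟩
    rw [size]
    convert h3 using 2
    omega
  | @itePos r c₁ c₂ s s' hr h1 ih =>
    obtain ⟨t, ht, h3⟩ := ih hQ.tail.left hs
    have h2 := hQ.tail.right
    rw [length_compile] at h2
    have h4 : Runs Q B (s.toRam l) 1 (s.tick.toRam (l + 1)) :=
      Runs.single (Located.head hQ) (by simp [RamState.exec, Mach.toRam, Mach.tick, hr]) hs hs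
    refine ⟨1 + t + 1, by simp [Mach.tick] at ht ⊢; omega,
      (h4.trans h3).trans (Runs.single (Located.head h2) ?_ h1.bdd h1.bdd)⟩
    · simp [RamState.exec, Mach.toRam, Mach.tick, size]
      omega
  | @loopDone pre r body s s' h1 hr ih =>
    obtain ⟨t, ht, h3⟩ := ih hQ.left hs
    have h2 := hQ.right
    rw [length_compile] at h2
    refine ⟨t + 1, by simp [Mach.tick] at ht ⊢; omega,
      h3.trans (Runs.single (Located.head h2) ?_ h1.bdd h1.bdd)⟩
    simp [RamState.exec, Mach.toRam, Mach.tick, size, hr]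
    omega
  | @loopStep pre r body s s' s'' s''' h1 hr h2 h3 ih1 ih2 ih3 =>
    obtain ⟨t, ht, h4⟩ := ih1 hQ.left hs
    have h5 := hQ.right
    rw [length_compile] at h5
    obtain ⟨t', ht', h6⟩ := ih2 h5.tail.left h1.bdd
    have h7 := h5.tail.right
    rw [length_compile] at h7
    obtain ⟨t'', ht'', h8⟩ := ih3 hQ h2.bdd
    have h9 : Runs Q B (s'.toRam (l + pre.size)) 1 (s'.tick.toRam (l + pre.size + 1)) :=
      Runs.single (Located.head h5) (by simp [RamState.exec, Mach.toRam, Mach.tick, hr])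
        h1.bdd h1.bdd
    have h10 : Runs Q B (s''.toRam (l + pre.size + 1 + body.size)) 1 (s''.tick.toRam l) :=
      Runs.single (Located.head h7) (by simp [RamState.exec, Mach.toRam, Mach.tick]) h2.bdd h2.bdd
    refine ⟨t + 1 + t' + 1 + t'', by simp [Mach.tick] at ht ht' ht'' ⊢; omega,
      (((h4.trans h9).trans h6).trans h10).trans h8⟩

/-! #### Weakest preconditions -/

/-- The registers that a command may write. -/
def writes : Cmd → List ℕ
  | basic (.const d _) => [d]
  | basic (.move d _) => [d]
  | basic (.add d _ _) => [d]
  | basic (.sub d _ _) => [d]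
  | basic (.load d _) => [d]
  | basic _ => []
  | seq c₁ c₂ => c₁.writes ++ c₂.writes
  | ite _ c₁ c₂ => c₁.writes ++ c₂.writes
  | loop pre _ body => pre.writes ++ body.writes

/-- Whether a command contains a store instruction. -/
def stores : Cmd → Bool
  | basic (.store _ _) => true
  | basic _ => false
  | seq c₁ c₂ => c₁.stores || c₂.stores
  | ite _ c₁ c₂ => c₁.stores || c₂.stores
  | loop pre _ body => pre.stores || body.stores

/-- `s'` agrees with `s` on the registers and the memory that the command `c` cannot change. -/
def Frame (c : Cmd) (s s' : Mach) : Prop :=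
  (∀ r, r ∉ c.writes → s'.reg r = s.reg r) ∧ (c.stores = false → s'.mem = s.mem)

theorem Exec.frame {B : ℕ} {c : Cmd} {s s' : Mach} (h : Exec B c s s') : c.Frame s s' := by
  induction h with
  | basic hb =>
    cases hb <;> constructor <;>
      simp +contextual [writes, stores, Mach.set, Mach.put]
  | seq _ _ h1 h2 =>
    simp only [Frame, writes, stores, List.mem_append, Bool.or_eq_false_iff, not_or] at h1 h2 ⊢
    exact ⟨fun r hr => (h2.1 r hr.2).trans (h1.1 r hr.1), fun h => (h2.2 h.2).trans (h1.2 h.1)⟩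
  | iteZero _ _ h =>
    simp only [Frame, writes, stores, List.mem_append, Bool.or_eq_false_iff, not_or] at h ⊢
    exact ⟨fun r hr => h.1 r hr.1, fun h' => h.2 h'.1⟩
  | itePos _ _ h =>
    simp only [Frame, writes, stores, List.mem_append, Bool.or_eq_false_iff, not_or] at h ⊢
    exact ⟨fun r hr => h.1 r hr.2, fun h' => h.2 h'.2⟩
  | loopDone _ _ h =>
    simp only [Frame, writes, stores, List.mem_append, Bool.or_eq_false_iff, not_or] at h ⊢
    exact ⟨fun r hr => h.1 r hr.1, fun h' => h.2 h'.1⟩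
  | loopStep _ _ _ _ h1 h2 h3 =>
    simp only [Frame, writes, stores, List.mem_append, Bool.or_eq_false_iff, not_or] at h1 h2 h3 ⊢
    exact ⟨fun r hr => (h3.1 r hr).trans ((h2.1 r hr.2).trans (h1.1 r hr.1)),
      fun h => (h3.2 h).trans ((h2.2 h.2).trans (h1.2 h.1))⟩

/-- From `s`, the command terminates with words at most `B` in a state satisfying `P`. -/
def WP (B : ℕ) (c : Cmd) (s : Mach) (P : Mach → Prop) : Prop :=
  s.Bdd B → ∃ s', Exec B c s s' ∧ P s'

variable {B : ℕ} {c c₁ c₂ pre body : Cmd} {s : Mach} {P : Mach → Prop} {r : ℕ}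

theorem WP.mono {P' : Mach → Prop} (h : WP B c s P) (h' : ∀ s', c.Frame s s' → P s' → P' s') :
    WP B c s P' := fun hs => by
  obtain ⟨s', h1, h2⟩ := h hs
  exact ⟨s', h1, h' s' h1.frame h2⟩

theorem WP.seq {P' : Mach → Prop} (h : WP B c₁ s P')
    (h' : ∀ s', c₁.Frame s s' → P' s' → WP B c₂ s' P) : WP B (seq c₁ c₂) s P := fun hs => by
  obtain ⟨s', h1, h2⟩ := h hs
  obtain ⟨s'', h3, h4⟩ := h' s' h1.frame h2 h1.bdd
  exact ⟨s'', h1.seq h3, h4⟩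

theorem WP.ite (h₁ : s.reg r = 0 → WP B c₁ s.tick P)
    (h₂ : s.reg r ≠ 0 → WP B c₂ s.tick fun s' => P s'.tick) : WP B (ite r c₁ c₂) s P := fun hs => by
  by_cases hr : s.reg r = 0
  · obtain ⟨s', h1, h2⟩ := h₁ hr hs
    exact ⟨s', .iteZero hr h1, h2⟩
  · obtain ⟨s', h1, h2⟩ := h₂ hr hs
    exact ⟨s'.tick, .itePos hr h1, h2⟩

theorem Frame.refl (c : Cmd) (s : Mach) : c.Frame s s := ⟨fun _ _ => rfl, fun _ => rfl⟩

/-- A loop whose invariant bounds the time terminates. -/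
theorem WP.loop (I : Mach → Prop) (T : ℕ) (hI : I s) (hT : ∀ s', I s' → s'.time ≤ T)
    (hstep : ∀ s', I s' → (loop pre r body).Frame s s' → WP B pre s' fun s₁ =>
      (s₁.reg r = 0 → P s₁.tick) ∧
      (s₁.reg r ≠ 0 → WP B body s₁.tick fun s₂ => I s₂.tick)) :
    WP B (loop pre r body) s P := by
  -- Induction on the time left until `T`: each round consumes some of it through its ticks.
  suffices ∀ k s', T - s'.time = k → I s' → (Cmd.loop pre r body).Frame s s' →
      WP B (Cmd.loop pre r body) s' P from this _ s rfl hI (Frame.refl _ _)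
  intro k
  induction k using Nat.strong_induction_on with
  | _ k ih =>
    intro s' hk hI' hF hs
    obtain ⟨s₁, h1, h2, h3⟩ := hstep s' hI' hF hs
    by_cases hr : s₁.reg r = 0
    · exact ⟨_, .loopDone h1 hr, h2 hr⟩
    · obtain ⟨s₂, h4, h5⟩ := h3 hr h1.bdd
      have ht1 : s'.time ≤ s₁.time := by
        obtain ⟨t, ht, -⟩ := h1.runs (Q := pre.compile 0) (l := 0) ⟨[], [], by simp, rfl⟩ hs
        omega
      have ht2 : s₁.tick.time ≤ s₂.time := by
        obtain ⟨t, ht, -⟩ := h4.runs (Q := body.compile 0) (l := 0) ⟨[], [], by simp, rfl⟩ h1.bdd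
        omega
      have ht3 := hT _ h5
      simp only [Mach.tick] at ht2 ht3
      have hF1 := h1.frame
      have hF2 := h4.frame
      have hF' : (Cmd.loop pre r body).Frame s s₂.tick := by
        simp only [Frame, writes, stores, List.mem_append, Bool.or_eq_false_iff, not_or,
          Mach.tick] at hF hF1 hF2 ⊢
        exact ⟨fun r hr => (hF2.1 r hr.2).trans ((hF1.1 r hr.1).trans (hF.1 r hr)),
          fun h => (hF2.2 h.2).trans ((hF1.2 h.1).trans (hF.2 h))⟩
      obtain ⟨s₃, h6, h7⟩ := ih (T - s₂.tick.time) (by simp only [Mach.tick]; omega) s₂.tick rfl h5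
        hF' h4.bdd
      exact ⟨s₃, .loopStep h1 hr h4 h6, h7⟩

/-- The weakest precondition of a command without loops, as a formula. -/
def wp (B : ℕ) : Cmd → Mach → (Mach → Prop) → Prop
  | basic (.const d c), s, P => c ≤ B ∧ P (s.set d c)
  | basic (.move d a), s, P => P (s.set d (s.reg a))
  | basic (.add d a b), s, P => s.reg a + s.reg b ≤ B ∧ P (s.set d (s.reg a + s.reg b))
  | basic (.sub d a b), s, P => P (s.set d (s.reg a - s.reg b))
  | basic (.load d a), s, P => P (s.set d (s.mem (s.reg a)))
  | basic (.store a b), s, P => P (s.put (s.reg a) (s.reg b))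
  | basic _, _, _ => False
  | seq c₁ c₂, s, P => wp B c₁ s fun s' => wp B c₂ s' P
  | ite r c₁ c₂, s, P => (s.reg r = 0 → wp B c₁ s.tick P) ∧
      (s.reg r ≠ 0 → wp B c₂ s.tick fun s' => P s'.tick)
  | loop _ _ _, _, _ => False

theorem WP.of_wp (h : wp B c s P) : WP B c s P := by
  induction c generalizing s P with
  | basic i =>
    intro hs
    cases i with
    | const d c => exact ⟨_, .basic (.const d c s) (hs.set h.1), h.2⟩
    | move d a => exact ⟨_, .basic (.move d a s) (hs.set (hs.1 a)), h⟩
    | add d a b => exact ⟨_, .basic (.add d a b s) (hs.set h.1), h.2⟩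
    | sub d a b =>
      exact ⟨_, .basic (.sub d a b s) (hs.set ((Nat.sub_le _ _).trans (hs.1 a))), h⟩
    | load d a => exact ⟨_, .basic (.load d a s) (hs.set (hs.2 _)), h⟩
    | store a b => exact ⟨_, .basic (.store a b s) (hs.put (hs.1 b)), h⟩
    | jump | jumpZero | halt => exact h.elim
  | seq c₁ c₂ h₁ h₂ => exact (h₁ h).seq fun _ _ h' => h₂ h'
  | ite r c₁ c₂ h₁ h₂ => exact WP.ite (fun hr => h₁ (h.1 hr)) fun hr => h₂ (h.2 hr)
  | loop => exact h.elim

end Cmd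

/-! ### Notation for commands -/

namespace Cmd

instance : Append Cmd := ⟨seq⟩

theorem append_def (c₁ c₂ : Cmd) : c₁ ++ c₂ = seq c₁ c₂ := rfl

abbrev const (d c : ℕ) : Cmd := basic (.const d c)
abbrev move (d a : ℕ) : Cmd := basic (.move d a)
abbrev add (d a b : ℕ) : Cmd := basic (.add d a b)
abbrev sub (d a b : ℕ) : Cmd := basic (.sub d a b)
abbrev load (d a : ℕ) : Cmd := basic (.load d a)
abbrev store (a b : ℕ) : Cmd := basic (.store a b)
abbrev skip : Cmd := move 10 10

/-! ### Scanning a chain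

Register `6` always holds `1`; registers `10` and `11` are scratch. -/

/-- Scan the operations in the cells from `reg 18` to `reg 19`, with the drawdown in register `16`
and its maximum in register `17`; run `act` at each new maximum of the height. -/
def scan (act : Cmd) : Cmd :=
  (const 16 0 ++ const 17 0) ++
  loop (sub 10 19 18) 10
    ((load 11 18 ++
      ite 11 (ite 16 act (sub 16 16 6)) (add 16 16 6 ++ sub 11 16 17 ++ add 17 17 11)) ++
      add 18 18 6)

variable {B : ℕ}

/-- The cells from `a` on contain the first `n` operations of `f`. -/
def Holds (m : ℕ → ℕ) (a n : ℕ) (f : ℕ → Bool) : Prop := ∀ k < n, m (a + k) = (f k).toNat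

/-- The invariant `J` describes what `act` maintains in registers 22 and 23 and in memory after a
given number of operations. `hmem` guarantees that the cells still to be scanned survive the stores
of `act`. -/
theorem scan_spec {act : Cmd} {f : ℕ → Bool} {a n : ℕ} (J : ℕ → ℕ → ℕ → (ℕ → ℕ) → Prop)
    (s : Mach) (h6 : s.reg 6 = 1) (h18 : s.reg 18 = a) (h19 : s.reg 19 = a + n)
    (hB : a + 2 * n + 1 ≤ B) (h0 : J 0 (s.reg 22) (s.reg 23) s.mem)
    (hw : ∀ r ∈ [6, 16, 17, 18, 19], r ∉ act.writes)
    (hmem : ∀ k x y m, J k x y m → Holds m a n f)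
    (hact : ∀ k < n, IsRecord f k → ∀ s' : Mach, (∀ r, r ∉ (scan act).writes → s'.reg r = s.reg r) →
      s'.reg 17 = maxDrawdown f k → s'.reg 18 = a + k → J k (s'.reg 22) (s'.reg 23) s'.mem →
      WP B act s' fun s'' =>
        J (k + 1) (s''.reg 22) (s''.reg 23) s''.mem ∧ s''.time ≤ s'.time + 10)
    (hskip : ∀ k < n, ¬ IsRecord f k → ∀ x y m, J k x y m → J (k + 1) x y m) :
    WP B (scan act) s fun s' => J n (s'.reg 22) (s'.reg 23) s'.mem ∧ s'.reg 18 = a + n ∧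
      s'.time ≤ s.time + 30 * n + 10 := by
  have hw' : ∀ r ∈ [6, 16, 17, 18, 19], r ∉ act.writes := hw
  simp only [List.mem_cons, List.not_mem_nil, or_false, forall_eq_or_imp, forall_eq] at hw
  obtain ⟨hw6, hw16, hw17, hw18, hw19⟩ := hw
  refine WP.seq (P' := fun s' => s'.reg 16 = 0 ∧ s'.reg 17 = 0 ∧ s'.time = s.time + 2 ∧
    s'.mem = s.mem ∧ ∀ r, r ≠ 16 → r ≠ 17 → s'.reg r = s.reg r) ?_ ?_
  · apply WP.of_wp
    simp +contextual [append_def, wp, Mach.reg_set, Mach.mem_set, Mach.time_set]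
  · rintro s₀ - ⟨h16, h17, ht, hm, hr⟩
    refine WP.loop (fun s' => ∃ k ≤ n, s'.reg 18 = a + k ∧ s'.reg 16 = drawdown f k ∧
      s'.reg 17 = maxDrawdown f k ∧ J k (s'.reg 22) (s'.reg 23) s'.mem ∧
      s'.time ≤ s.time + 2 + 30 * k) (s.time + 2 + 30 * n) ?_ ?_ ?_
    · refine ⟨0, by omega, by rw [hr] <;> simp [h18], h16, h17, ?_, by omega⟩
      rw [hr _ (by simp) (by simp), hr _ (by simp) (by simp), hm]
      exact h0
    · rintro s' ⟨k, hk, -, -, -, -, h⟩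
      omega
    · rintro s' ⟨k, hk, h18', h16', h17', hJ, ht'⟩ hF
      have hF' : ∀ r, r ∉ (scan act).writes → s'.reg r = s.reg r := by
        intro r hr'
        have hr'' := hr'
        simp only [scan, append_def, writes, List.mem_append, not_or, List.mem_cons] at hr''
        rw [hF.1, hr _ (by tauto) (by tauto)]
        simp only [append_def, writes, List.mem_append, not_or, List.mem_cons]
        tauto
      have hs6 : s'.reg 6 = 1 := by
        rw [hF' _ (by simp [scan, append_def, writes, hw6]), h6]
      have hs19 : s'.reg 19 = a + n := by
        rw [hF' _ (by simp [scan, append_def, writes, hw19]), h19]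
      have hd := drawdown_le f k
      have hD := maxDrawdown_le f k
      have hdD := drawdown_le_maxDrawdown f k
      apply WP.of_wp
      simp only [wp, Mach.reg_set, Mach.mem_set, Mach.time_set, Mach.tick, hs19, h18', ↓reduceIte,
        Nat.reduceEqDiff]
      constructor
      · intro hz
        obtain rfl : k = n := by omega
        exact ⟨hJ, rfl, by omega⟩
      · intro hz
        have hkn : k < n := by omega
        have hcode : s'.mem (a + k) = (f k).toNat := hmem _ _ _ _ hJ k hkn
        refine WP.seq (P' := fun s₁ => s₁.reg 18 = a + k ∧ s₁.reg 6 = 1 ∧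
          s₁.reg 16 = drawdown f (k + 1) ∧ s₁.reg 17 = maxDrawdown f (k + 1) ∧
          J (k + 1) (s₁.reg 22) (s₁.reg 23) s₁.mem ∧ s₁.time ≤ s'.time + 25) ?_ ?_
        · cases hf : f k
          · rw [hf] at hcode
            by_cases hd0 : drawdown f k = 0
            · have hrec : IsRecord f k := ⟨hf, hd0⟩
              refine WP.seq (WP.of_wp (P := fun s₁ => s₁ =
                (⟨(s'.set 10 (a + n - (a + k))).reg, s'.mem, s'.time + 2⟩ : Mach).set 11 0) ?_) ?_
              · simp [wp, Mach.reg_set, h18', hcode]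
              rintro s₁ - rfl
              refine WP.ite (fun _ => WP.ite (fun _ => ?_) fun h => ?_) fun h => ?_
              · refine (hact k hkn hrec _ (fun r hr' => ?_) ?_ ?_ ?_).mono ?_
                · have hr'' := hr'
                  simp only [scan, append_def, writes, List.mem_append, not_or, List.mem_cons] at hr''
                  simp only [Mach.reg_tick, Mach.reg_set]
                  rw [if_neg (by tauto), if_neg (by tauto), hF' r hr']
                · simp [Mach.reg_tick, Mach.reg_set, h17']
                · simp [Mach.reg_tick, Mach.reg_set, h18']
                · simpa [Mach.reg_tick, Mach.reg_set, Mach.mem_tick, Mach.mem_set] using hJ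
                · rintro s₂ hF₂ ⟨hJ₂, ht₂⟩
                  rw [hF₂.1 _ hw6, hF₂.1 _ hw16, hF₂.1 _ hw17, hF₂.1 _ hw18]
                  simp only [Mach.reg_tick, Mach.reg_set, Mach.time_tick, Mach.time_set] at ht₂ ⊢
                  simp [hs6, h16', h17', h18', hd0, drawdown, maxDrawdown, hf, hJ₂]
                  omega
              · simp [Mach.reg_tick, Mach.reg_set, h16', hd0] at h
              · simp [Mach.reg_set] at h
            · have hrec : ¬ IsRecord f k := fun h => hd0 h.2
              apply WP.of_wp
              simp [append_def, wp, Mach.reg_set, Mach.mem_set, Mach.time_set, Mach.tick, h18',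
                hcode, hs6, h16', h17', hd0, drawdown, maxDrawdown, hf, hskip k hkn hrec _ _ _ hJ]
              omega
          · rw [hf] at hcode
            have hrec : ¬ IsRecord f k := fun h => by simp [h.1] at hf
            apply WP.of_wp
            simp [append_def, wp, Mach.reg_set, Mach.mem_set, Mach.time_set, Mach.tick, h18',
              hcode, hs6, h16', h17', drawdown, maxDrawdown, hf, hskip k hkn hrec _ _ _ hJ]
            omega
        · rintro s₁ - ⟨h1, h2, h3, h4, h5, h7⟩
          apply WP.of_wp
          simp only [wp, Mach.reg_set, Mach.mem_set, Mach.time_set, h1, h2, ↓reduceIte,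
            Nat.reduceEqDiff]
          exact ⟨by omega, k + 1, hkn, by omega, h3, h4, h5, by omega⟩

/-- The number of new maxima among the first `n` heights with maximal drawdown `r` before. -/
def records (f : ℕ → Bool) (r : ℕ) : ℕ → ℕ
  | 0 => 0
  | k + 1 => if IsRecord f k ∧ maxDrawdown f k = r then records f r k + 1 else records f r k

theorem peak_zero_eq (f : ℕ → Bool) (n : ℕ) : peak f 0 n = records f 0 n := by
  induction n with
  | zero => rfl
  | succ k ih => simp [peak, records, ih]

/-- The records allowed by `r + 1` are those allowed by `r` and those whose maximal drawdown is
exactly `r + 1`. Hence total peaks are prefix sums of a table indexed by drawdown. -/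
theorem peak_succ_eq (f : ℕ → Bool) (r n : ℕ) :
    peak f (r + 1) n = peak f r n + records f (r + 1) n := by
  induction n with
  | zero => rfl
  | succ k ih =>
    by_cases h : IsRecord f k
    · simp only [peak, records, h, true_and, ih]
      split_ifs <;> omega
    · simp [peak, records, h, ih]

/-- Add one to the cell of the table at `reg 15` whose index is the maximal drawdown. -/
def countAct : Cmd := add 10 15 17 ++ load 11 10 ++ add 11 11 6 ++ store 10 11

/-- The table begins at `Z`, beyond the operations being scanned, so incrementing it leaves them
intact. `C` is its content before this chain. -/
theorem count_spec {f : ℕ → Bool} {a n Z : ℕ} {C m₀ : ℕ → ℕ} (s : Mach) (h6 : s.reg 6 = 1)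
    (h15 : s.reg 15 = Z) (h18 : s.reg 18 = a) (h19 : s.reg 19 = a + n) (hZ : a + n ≤ Z)
    (hB : 3 * Z + 1 ≤ B) (hC : ∀ r, C r + n ≤ Z) (hold : Holds m₀ a n f)
    (hlow : ∀ x < Z, s.mem x = m₀ x) (hhigh : ∀ r, s.mem (Z + r) = C r) :
    WP B (scan countAct) s fun s' => (∀ x < Z, s'.mem x = m₀ x) ∧
      (∀ r, s'.mem (Z + r) = C r + records f r n) ∧ s'.time ≤ s.time + 30 * n + 10 := by
  have hrec : ∀ r k, records f r k ≤ k := by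
    intro r k
    induction k with
    | zero => exact le_rfl
    | succ k ih => simp only [records]; split_ifs <;> omega
  refine (scan_spec (f := f) (a := a) (n := n) (fun k _ _ m => (∀ x < Z, m x = m₀ x) ∧
    ∀ r, m (Z + r) = C r + records f r k) s h6 h18 h19 (by omega) ⟨hlow, by simpa [records]⟩
    (by simp [countAct, append_def, writes]) ?_ ?_ ?_).mono ?_
  · rintro k - - m ⟨hm, -⟩ j hj
    rw [hm _ (by omega), hold j hj]
  · rintro k hk hr s' hF h17 h18' ⟨hm1, hm2⟩
    have hD := maxDrawdown_le f k
    have h15' : s'.reg 15 = Z := by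
      rw [hF _ (by simp [scan, countAct, append_def, writes]), h15]
    have h6' : s'.reg 6 = 1 := by
      rw [hF _ (by simp [scan, countAct, append_def, writes]), h6]
    have := hC (maxDrawdown f k)
    have := hrec (maxDrawdown f k) k
    have := hm2 (maxDrawdown f k)
    apply WP.of_wp
    simp [countAct, append_def, wp, Mach.reg_set, Mach.mem_set, Mach.time_set,
      Mach.time_put, Mach.mem_put, h15', h6', h17]
    refine ⟨by omega, by omega, fun x hx => ?_, fun r => ?_⟩
    · rw [if_neg (by omega), hm1 x hx]
    · simp only [records, hr, true_and]
      by_cases h : maxDrawdown f k = r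
      · subst h
        simp
        omega
      · rw [if_neg (by omega), if_neg h, hm2]
  · rintro k hk hr - - m ⟨hm1, hm2⟩
    exact ⟨hm1, fun r => by simp [records, hr, hm2]⟩
  · rintro s' - ⟨⟨h1, h2⟩, -, h3⟩
    exact ⟨h1, h2, h3⟩

/-- Raise the peak, in register `22`, and set its address, in register `23`, if the maximal drawdown
is at most `reg 20`. -/
def peakAct : Cmd := sub 10 17 20 ++ ite 10 (add 22 22 6 ++ add 23 18 6) skip

/-- Find the peak between the addresses `reg 18` and `reg 19`. -/
def peakScan : Cmd := (const 22 0 ++ move 23 18) ++ scan peakAct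

theorem peakScan_spec {f : ℕ → Bool} {a n M : ℕ} (s : Mach) (h6 : s.reg 6 = 1)
    (h20 : s.reg 20 = M) (h18 : s.reg 18 = a) (h19 : s.reg 19 = a + n)
    (hB : a + 2 * n + 1 ≤ B) (hold : Holds s.mem a n f) :
    WP B peakScan s fun s' => s'.reg 22 = peak f M n ∧ s'.reg 23 = a + peakPos f M n ∧
      s'.time ≤ s.time + 30 * n + 12 := by
  refine WP.seq (P' := fun s' => s' = (s.set 22 0).set 23 a) ?_ ?_
  · apply WP.of_wp
    simp [append_def, wp, Mach.reg_set, h18]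
  rintro s₁ - rfl
  refine (scan_spec (f := f) (a := a) (n := n) (fun k x y m => m = s.mem ∧ x = peak f M k ∧
    y = a + peakPos f M k) _ (by simp [Mach.reg_set, h6]) (by simp [Mach.reg_set, h18])
    (by simp [Mach.reg_set, h19]) hB
    (by simp [Mach.reg_set, Mach.mem_set, peak, peakPos])
    (by simp [peakAct, append_def, writes]) ?_ ?_ ?_).mono ?_
  · rintro k - - m ⟨rfl, -⟩
    exact hold
  · rintro k hk hr s' hF h17 h18' ⟨hm, hx, hy⟩
    have h20' : s'.reg 20 = M := by
      rw [hF _ (by simp [scan, peakAct, append_def, writes])]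
      simp [Mach.reg_set, h20]
    have h6' : s'.reg 6 = 1 := by
      rw [hF _ (by simp [scan, peakAct, append_def, writes])]
      simp [Mach.reg_set, h6]
    have hp := peak_le f M k
    apply WP.of_wp
    simp only [peakAct, append_def, wp, Mach.reg_set, Mach.mem_set, Mach.time_set, Mach.reg_tick,
      Mach.time_tick, Mach.mem_tick, h20', h6', h17, h18', hx, hy, hm, ↓reduceIte, Nat.reduceEqDiff,
      peak, peakPos, hr, true_and]
    constructor
    · intro h
      rw [if_pos (by omega), if_pos (by omega)]
      refine ⟨by omega, by omega, ⟨rfl, by omega⟩, by omega⟩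
    · intro h
      rw [if_neg (by omega), if_neg (by omega)]
      exact ⟨⟨rfl, rfl⟩, by omega⟩
  · rintro k hk hr x y m ⟨rfl, rfl, rfl⟩
    simp [peak, peakPos, hr]
  · rintro s' - ⟨⟨-, h1, h2⟩, -, h3⟩
    simp only [Mach.time_set] at h3
    exact ⟨h1, h2, by omega⟩

/-- Compute `reg 15` plus the height after the operations from `reg 18` to `reg 19`. -/
def sumScan : Cmd :=
  move 26 15 ++ loop (sub 10 19 18) 10
    (load 11 18 ++ add 26 26 6 ++ sub 26 26 11 ++ sub 26 26 11 ++ add 18 18 6)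

/-- The offset `Z ≥ n` keeps the stored height nonnegative, and 1 is added before twice the code is
subtracted, so no subtraction is truncated. -/
theorem sumScan_spec {f : ℕ → Bool} {a n Z : ℕ} (s : Mach) (h6 : s.reg 6 = 1)
    (h15 : s.reg 15 = Z) (h18 : s.reg 18 = a) (h19 : s.reg 19 = a + n)
    (hB : a + n + 2 * Z + 1 ≤ B) (hZ : n ≤ Z) (hold : Holds s.mem a n f) :
    WP B sumScan s fun s' => (s'.reg 26 : ℤ) = height f n + Z ∧
      s'.time ≤ s.time + 10 * n + 5 := by
  refine WP.seq (P' := fun s' => s' = s.set 26 Z) ?_ ?_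
  · apply WP.of_wp
    simp [wp, h15]
  rintro s₁ - rfl
  refine WP.loop (fun s' => ∃ k ≤ n, s'.reg 18 = a + k ∧ (s'.reg 26 : ℤ) = height f k + Z ∧
    s'.time ≤ s.time + 1 + 10 * k) (s.time + 1 + 10 * n) ?_ ?_ ?_
  · exact ⟨0, by omega, by simp [Mach.reg_set, h18], by simp [Mach.reg_set, height],
      by simp [Mach.time_set]⟩
  · rintro s' ⟨k, hk, -, -, h⟩
    omega
  · rintro s' ⟨k, hk, h1, h2, h3⟩ hF
    have hs6 : s'.reg 6 = 1 := by
      rw [hF.1 _ (by simp [append_def, writes])]; simp [Mach.reg_set, h6]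
    have hs19 : s'.reg 19 = a + n := by
      rw [hF.1 _ (by simp [append_def, writes])]; simp [Mach.reg_set, h19]
    have hm : s'.mem = s.mem := by
      rw [hF.2 (by simp [append_def, stores])]; rfl
    apply WP.of_wp
    simp only [wp, Mach.reg_set, Mach.time_set, Mach.reg_tick, Mach.time_tick, hs19, h1,
      ↓reduceIte, Nat.reduceEqDiff]
    constructor
    · intro hz
      obtain rfl : k = n := by omega
      exact ⟨h2, by omega⟩
    · intro hz
      have hkn : k < n := by omega
      have hcode := hold k hkn
      have hab := abs_le.1 (abs_height_le f k)
      apply WP.of_wp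
      simp only [append_def, wp, Mach.reg_set, Mach.mem_set, Mach.time_set, Mach.reg_tick,
        Mach.mem_tick, Mach.time_tick, h1, hs6, hm, hcode, ↓reduceIte, Nat.reduceEqDiff]
      refine ⟨by omega, by omega, k + 1, hkn, by omega, ?_, by omega⟩
      cases hf : f k
      · simp only [height, hf, Bool.toNat_false]
        simp
        omega
      · simp only [height, hf, Bool.toNat_true]
        simp
        omega

end Cmd

namespace Cmd

variable {B : ℕ}

/-! ### Solving the problem for two chains

Heights are stored with the offset `Z`. -/

/-- Test whether the chain at address `reg rp`, with height `reg rh`, can be traced back by one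
operation, not below address `reg rg`, when the other chain has height `reg ra`; then register `55`
is zero. Register `53` is the height before the operation. -/
def tryBack (ra rp rh rg : ℕ) : Cmd :=
  const 55 1 ++ sub 10 rp rg ++
    ite 10 skip (sub 11 rp 6 ++ load 11 11 ++ add 53 rh 11 ++ add 53 53 11 ++ sub 53 53 6 ++
      add 54 ra 53 ++ sub 55 31 54)

/-- Undoing an operation adds twice its code minus one to the height. Register 31 holds `2 * Z - K`,
so subtracting both shifted heights leaves zero exactly when the level is nonnegative. The initial 1
in register 55 is the answer for a chain already at its lower end. -/
theorem tryBack_spec {ra rp rh rg : ℕ}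
    (hr : (ra = 37 ∧ rp = 39 ∧ rh = 40 ∧ rg = 35) ∨ (ra = 41 ∧ rp = 48 ∧ rh = 49 ∧ rg = 34))
    {f : ℕ → Bool} {a x lo n Z : ℕ} {α K : ℤ} (s : Mach) (h6 : s.reg 6 = 1)
    (hp : s.reg rp = a + x) (hg : s.reg rg = a + lo) (hh : (s.reg rh : ℤ) = height f x + Z)
    (ha : (s.reg ra : ℤ) = α + Z) (hK : (s.reg 31 : ℤ) = 2 * Z - K) (hold : Holds s.mem a n f)
    (hxn : x ≤ n) (hn : n ≤ Z) (hα : α ≤ Z) (hB : 8 * Z + 8 ≤ B) :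
    WP B (tryBack ra rp rh rg) s fun s' =>
      (s'.reg 55 = 0 ↔ lo < x ∧ 0 ≤ K + α + height f (x - 1)) ∧
      (s'.reg 55 = 0 → (s'.reg 53 : ℤ) = height f (x - 1) + Z) ∧ s'.time ≤ s.time + 15 := by
  have hlast : lo < x → s.mem (a + x - 1) = (f (x - 1)).toNat ∧
      height f x = height f (x - 1) + if f (x - 1) then -1 else 1 := by
    intro h
    obtain ⟨y, rfl⟩ : ∃ y, x = y + 1 := ⟨x - 1, by omega⟩
    exact ⟨hold y (by omega), rfl⟩
  have hab := abs_le.1 (abs_height_le f x)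
  have hab' := abs_le.1 (abs_height_le f (x - 1))
  apply WP.of_wp
  rcases hr with ⟨rfl, rfl, rfl, rfl⟩ | ⟨rfl, rfl, rfl, rfl⟩ <;>
  · simp only [tryBack, append_def, wp, Mach.reg_set, Mach.mem_set, Mach.time_set, Mach.reg_tick,
      Mach.mem_tick, Mach.time_tick, hp, hg, h6, ↓reduceIte, Nat.reduceEqDiff]
    refine ⟨by omega, fun h => ?_, fun h => ?_⟩
    · simp only [false_iff, false_implies, true_and]
      omega
    · have hlt : lo < x := by omega
      obtain ⟨h1, h2⟩ := hlast hlt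
      rw [h1]
      cases hf : f (x - 1) <;> simp only [Bool.toNat_false, Bool.toNat_true] <;>
        simp only [hf, if_true, Bool.false_eq_true, if_false] at h2 <;>
        refine ⟨by omega, by omega, by omega, ?_, by omega, by omega⟩ <;>
        constructor <;> omega

/-- Trace back the second chain by one operation. -/
def moveSnd : Cmd := sub 39 39 6 ++ move 40 53 ++ sub 10 53 41 ++ add 41 41 10

/-- Trace back the first chain by one operation. -/
def moveFst : Cmd := sub 48 48 6 ++ move 49 53 ++ sub 10 53 37 ++ add 37 37 10

/-- Record the current tail if it is acceptable. -/
def check : Cmd :=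
  add 10 38 41 ++ sub 10 31 10 ++ sub 11 42 37 ++ add 10 10 11 ++
    ite 10 (const 43 1 ++ move 44 39 ++ move 45 40 ++ move 46 37 ++ move 47 41) skip

/-- Go to the next tail, or stop. -/
def nextTail : Cmd :=
  sub 10 33 32 ++
    ite 10 (const 52 0) (load 11 32 ++ add 36 36 6 ++ sub 36 36 11 ++ sub 36 36 11 ++
      add 32 32 6 ++ sub 10 36 37 ++ add 37 37 10 ++ sub 10 38 36 ++ sub 38 38 10)

/-- The search through the tails of the first chain. -/
def tail : Cmd :=
  (const 52 1 ++ const 43 0 ++ move 37 36 ++ move 38 36 ++ move 41 40) ++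
  loop skip 52 (tryBack 37 39 40 35 ++ ite 55 moveSnd (check ++ nextTail))

/-- Tracing back both chains. -/
def trace : Cmd :=
  (const 52 1 ++ move 39 44 ++ move 40 45 ++ move 37 46 ++ move 41 47) ++
  loop skip 52 (tryBack 37 39 40 35 ++
    ite 55 moveSnd (tryBack 41 48 49 34 ++ ite 55 moveFst (const 52 0)))

/-- The final test. -/
def verdict : Cmd :=
  sub 10 48 34 ++ sub 11 39 35 ++ add 10 10 11 ++ sub 11 37 50 ++ add 10 10 11 ++ sub 11 41 51 ++
    add 10 10 11 ++ ite 10 (const 0 1) (const 0 0)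

/-- The decision for two chains. -/
def solve : Cmd :=
  (move 48 32 ++ move 49 36) ++ (tail ++ ite 43 (const 0 0) (trace ++ verdict))

/-- The chains of a grid are stored at the addresses `av` and `aw`. -/
structure GridRegs (g : Grid) (fa fb : ℕ → Bool) (av aw Z : ℕ) (s : Mach) : Prop where
  a_eq : g.a = height fa
  b_eq : g.b = height fb
  hold_a : Holds s.mem av g.la fa
  hold_b : Holds s.mem aw g.W fb
  a_le : av + g.la ≤ Z
  b_le : aw + g.W ≤ Z
  K_nonneg : 0 ≤ g.K
  c_le : g.c ≤ 1
  one : s.reg 6 = 1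
  limit : (s.reg 31 : ℤ) = 2 * Z - g.K
  last : s.reg 33 = av + g.la
  peak_a : s.reg 34 = av + g.gv
  peak_b : s.reg 35 = aw + g.gw
  need : (s.reg 42 : ℤ) = max 0 (Z - g.K + g.c - g.b g.W)
  height_a : (s.reg 50 : ℤ) = g.a g.gv + Z
  height_b : (s.reg 51 : ℤ) = g.b g.gw + Z

theorem GridRegs.congr {g : Grid} {fa fb : ℕ → Bool} {av aw Z : ℕ} {s s' : Mach}
    (h : GridRegs g fa fb av aw Z s) (hm : s'.mem = s.mem)
    (hr : ∀ r ∈ [6, 31, 33, 34, 35, 42, 50, 51], s'.reg r = s.reg r) :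
    GridRegs g fa fb av aw Z s' := by
  simp only [List.mem_cons, List.not_mem_nil, or_false, forall_eq_or_imp, forall_eq] at hr
  obtain ⟨h1, h2, h3, h4, h5, h6, h7, h8⟩ := hr
  obtain ⟨k1, k2, k3, k4, k5, k6, k7, k8, k9, k10, k11, k12, k13, k14, k15, k16⟩ := h
  exact ⟨k1, k2, hm ▸ k3, hm ▸ k4, k5, k6, k7, k8, by omega, by omega, by omega, by omega, by omega,
    by omega, by omega, by omega⟩

theorem GridRegs.frame {g : Grid} {fa fb : ℕ → Bool} {av aw Z : ℕ} {s s' : Mach} {c : Cmd}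
    (h : GridRegs g fa fb av aw Z s) (hF : c.Frame s s') (hc : c.stores = false)
    (hr : ∀ r ∈ [6, 31, 33, 34, 35, 42, 50, 51], r ∉ c.writes) :
    GridRegs g fa fb av aw Z s' :=
  h.congr (hF.2 hc) fun r h' => hF.1 r (hr r h')

variable {g : Grid} {fa fb : ℕ → Bool} {av aw Z : ℕ}

/-- The registers used by the search through the tails. -/
structure TailRegs (g : Grid) (av aw Z : ℕ) (s : Mach) (e j : ℕ) (top d β : ℤ) : Prop where
  r32 : s.reg 32 = av + e
  r36 : (s.reg 36 : ℤ) = g.a e + Z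
  r37 : (s.reg 37 : ℤ) = top + Z
  r38 : (s.reg 38 : ℤ) = d + Z
  r39 : s.reg 39 = aw + j
  r40 : (s.reg 40 : ℤ) = g.b j + Z
  r41 : (s.reg 41 : ℤ) = β + Z

/-- The registers in which the last accepted tail is recorded. -/
structure SavedRegs (g : Grid) (aw Z : ℕ) (s : Mach) (j : ℕ) (α β : ℤ) : Prop where
  r44 : s.reg 44 = aw + j
  r45 : (s.reg 45 : ℤ) = g.b j + Z
  r46 : (s.reg 46 : ℤ) = α + Z
  r47 : (s.reg 47 : ℤ) = β + Z

/-- A record of accepted tails is stored in the registers. -/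
def TailSaved (g : Grid) (aw Z : ℕ) (s : Mach) (e : ℕ) (top : ℤ) : Prop :=
  ∃ j α β, g.TailDone e top (s.reg 43 = 1) j α β ∧ s.reg 43 ≤ 1 ∧
    (s.reg 43 = 1 → SavedRegs g aw Z s j α β)

theorem TailRegs.congr {s s' : Mach} {e j : ℕ} {top d β : ℤ} (h : TailRegs g av aw Z s e j top d β)
    (hr : ∀ r ∈ [32, 36, 37, 38, 39, 40, 41], s'.reg r = s.reg r) :
    TailRegs g av aw Z s' e j top d β := by
  simp only [List.mem_cons, List.not_mem_nil, or_false, forall_eq_or_imp, forall_eq] at hr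
  obtain ⟨h1, h2, h3, h4, h5, h6, h7⟩ := hr
  obtain ⟨k1, k2, k3, k4, k5, k6, k7⟩ := h
  constructor <;> omega

theorem SavedRegs.congr {s s' : Mach} {j : ℕ} {α β : ℤ} (h : SavedRegs g aw Z s j α β)
    (hr : ∀ r ∈ [43, 44, 45, 46, 47], s'.reg r = s.reg r) : SavedRegs g aw Z s' j α β := by
  simp only [List.mem_cons, List.not_mem_nil, or_false, forall_eq_or_imp, forall_eq] at hr
  obtain ⟨-, h1, h2, h3, h4⟩ := hr
  obtain ⟨k1, k2, k3, k4⟩ := h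
  constructor <;> omega

theorem TailSaved.congr {s s' : Mach} {e : ℕ} {top : ℤ} (h : TailSaved g aw Z s e top)
    (hr : ∀ r ∈ [43, 44, 45, 46, 47], s'.reg r = s.reg r) : TailSaved g aw Z s' e top := by
  obtain ⟨j, α, β, h1, h2, h3⟩ := h
  have h43 := hr 43 (by simp)
  exact ⟨j, α, β, by rwa [h43], by rwa [h43], fun h => (h3 (h43 ▸ h)).congr hr⟩

theorem TailSaved.mono {s : Mach} {e : ℕ} {top top' : ℤ} (h : TailSaved g aw Z s e top)
    (hle : top ≤ top') : TailSaved g aw Z s e top' := by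
  obtain ⟨j, α, β, h1, h2, h3⟩ := h
  exact ⟨j, α, β, h1.mono hle, h2, h3⟩

theorem GridRegs.abs_a {s : Mach} (h : GridRegs g fa fb av aw Z s) {x : ℕ} (hx : x ≤ g.la) :
    -(Z : ℤ) ≤ g.a x ∧ g.a x ≤ Z := by
  have h1 := h.a_le
  have := abs_le.1 (abs_height_le fa x)
  rw [h.a_eq]
  omega

theorem GridRegs.abs_b {s : Mach} (h : GridRegs g fa fb av aw Z s) {x : ℕ} (hx : x ≤ g.W) :
    -(Z : ℤ) ≤ g.b x ∧ g.b x ≤ Z := by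
  have h1 := h.b_le
  have := abs_le.1 (abs_height_le fb x)
  rw [h.b_eq]
  omega

theorem tailScan_bounds {s : Mach} {e j : ℕ} {top d β : ℤ} (h : GridRegs g fa fb av aw Z s)
    (ht : g.TailScan e j top d β) :
    (-(Z : ℤ) ≤ top ∧ top ≤ Z) ∧ (-(Z : ℤ) ≤ d ∧ d ≤ Z) ∧ (-(Z : ℤ) ≤ β ∧ β ≤ Z) := by
  have hla := ht.le_la
  obtain ⟨x, -, h1, rfl⟩ := ht.top_eq
  obtain ⟨y, -, h2, rfl⟩ := ht.d_eq
  obtain ⟨z, -, h3, rfl⟩ := ht.snd_eq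
  exact ⟨h.abs_a (by omega), h.abs_a (by omega), h.abs_b h3⟩

/-- Register 10 adds up the truncated deficits of both conditions, so it is zero exactly when both
hold. -/
theorem check_spec (hg : g.StartsAtPeak) (s : Mach) (h : GridRegs g fa fb av aw Z s) {e j : ℕ}
    {top d β : ℤ} (hr : TailRegs g av aw Z s e j top d β) (ht : g.TailScan e j top d β)
    (hs : TailSaved g aw Z s e top) (hj : g.Blocked j top) (hB : 8 * Z + 8 ≤ B) :
    WP B check s fun s' => TailSaved g aw Z s' (e + 1) top ∧ s'.time ≤ s.time + 15 := by
  obtain ⟨hb1, hb2, hb3⟩ := tailScan_bounds h ht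
  obtain ⟨r32, r36, r37, r38, r39, r40, r41⟩ := hr
  have hl := h.limit
  have hn := h.need
  have hWb := h.abs_b le_rfl
  apply WP.of_wp
  simp only [check, append_def, wp, Mach.reg_set, Mach.time_set, Mach.reg_tick,
    Mach.time_tick, ↓reduceIte, Nat.reduceEqDiff]
  refine ⟨by omega, ?_, fun h0 => ?_, fun h0 => ?_⟩
  · have hK := h.K_nonneg
    have hc := h.c_le
    omega
  · refine ⟨by omega, ⟨j, top, β, ht.accept hg (by omega) (by omega) ?_, ?_, fun _ => ?_⟩, by omega⟩
    · simp [Mach.reg_set]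
    · simp [Mach.reg_set]
    · constructor <;> simp [Mach.reg_set, r37, r39, r40, r41]
  · obtain ⟨jS, αS, βS, hd, h43, hsv⟩ := hs
    refine ⟨⟨jS, αS, βS, ?_, ?_, ?_⟩, by omega⟩
    · simpa [Mach.reg_set, Mach.reg_tick] using hd.reject hg ht hj (by omega)
    · simpa [Mach.reg_set, Mach.reg_tick] using h43
    · intro h
      have := hsv (by simpa [Mach.reg_set, Mach.reg_tick] using h)
      obtain ⟨q1, q2, q3, q4⟩ := this
      constructor <;> simpa [Mach.reg_set, Mach.reg_tick]

theorem nextTail_spec (s : Mach) (h : GridRegs g fa fb av aw Z s) {e j : ℕ}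
    {top d β : ℤ} (hr : TailRegs g av aw Z s e j top d β) (ht : g.TailScan e j top d β)
    (h52 : s.reg 52 ≠ 0) (hB : 8 * Z + 8 ≤ B) :
    WP B nextTail s fun s' => s'.time ≤ s.time + 15 ∧
      ((e = g.la ∧ s'.reg 52 = 0) ∨ (e < g.la ∧ s'.reg 52 ≠ 0 ∧
        TailRegs g av aw Z s' (e + 1) j (max top (g.a (e + 1))) (min d (g.a (e + 1))) β)) := by
  obtain ⟨hb1, hb2, hb3⟩ := tailScan_bounds h ht
  obtain ⟨r32, r36, r37, r38, r39, r40, r41⟩ := hr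
  have hle := ht.le_la
  have hla := h.last
  have h6 := h.one
  have haz := h.a_le
  apply WP.of_wp
  simp only [nextTail, append_def, wp, Mach.reg_set, Mach.time_set, Mach.mem_set, Mach.reg_tick,
    Mach.time_tick, Mach.mem_tick, ↓reduceIte, Nat.reduceEqDiff]
  refine ⟨fun h0 => ⟨by omega, by omega, .inl ⟨by omega, trivial⟩⟩, fun h0 => ?_⟩
  have hlt : e < g.la := by omega
  have hcode : s.mem (s.reg 32) = (fa e).toNat := by rw [r32]; exact h.hold_a e hlt
  have hbe := h.abs_a hle
  have hbe' := h.abs_a (x := e + 1) hlt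
  have hstep : g.a (e + 1) = g.a e + if fa e then -1 else 1 := by rw [h.a_eq]; rfl
  -- The exact result is a height shifted by `Z`, hence nonnegative, so truncation does not
  -- interfere.
  have key : ((s.reg 36 + s.reg 6 - s.mem (s.reg 32) - s.mem (s.reg 32) : ℕ) : ℤ) =
      g.a (e + 1) + Z ∧ (1 : ℤ) ≤ s.reg 36 + 1 := by
    rw [hcode, hstep]
    rw [hstep] at hbe'
    cases hf : fa e <;> simp only [hf, Bool.toNat_false, Bool.toNat_true, if_true,
      Bool.false_eq_true, if_false] at hbe' ⊢ <;> omega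
  generalize s.reg 36 + s.reg 6 - s.mem (s.reg 32) - s.mem (s.reg 32) = q at key ⊢
  refine ⟨by omega, by omega, by omega, by omega, .inr ⟨hlt, h52, ?_⟩⟩
  constructor <;> simp only [Mach.reg_set, Mach.reg_tick, ↓reduceIte, Nat.reduceEqDiff] <;> omega

theorem moveSnd_spec (s : Mach) {j : ℕ} {β : ℤ} (h6 : s.reg 6 = 1) (hj : 0 < j)
    (h39 : s.reg 39 = aw + j) (h53 : (s.reg 53 : ℤ) = g.b (j - 1) + Z)
    (h41 : (s.reg 41 : ℤ) = β + Z) (hβ : β ≤ Z) (hb : g.b (j - 1) ≤ Z) (hB : 8 * Z + 8 ≤ B) :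
    WP B moveSnd s fun s' => s'.time ≤ s.time + 5 ∧ s'.reg 39 = aw + (j - 1) ∧
      (s'.reg 40 : ℤ) = g.b (j - 1) + Z ∧ (s'.reg 41 : ℤ) = max β (g.b (j - 1)) + Z := by
  apply WP.of_wp
  simp only [moveSnd, append_def, wp, Mach.reg_set, Mach.time_set, ↓reduceIte, Nat.reduceEqDiff]
  omega

theorem moveFst_spec (s : Mach) {i : ℕ} {α : ℤ} (h6 : s.reg 6 = 1) (hi : 0 < i)
    (h48 : s.reg 48 = av + i) (h53 : (s.reg 53 : ℤ) = g.a (i - 1) + Z)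
    (h37 : (s.reg 37 : ℤ) = α + Z) (hα : α ≤ Z) (hb : g.a (i - 1) ≤ Z) (hB : 8 * Z + 8 ≤ B) :
    WP B moveFst s fun s' => s'.time ≤ s.time + 5 ∧ s'.reg 48 = av + (i - 1) ∧
      (s'.reg 49 : ℤ) = g.a (i - 1) + Z ∧ (s'.reg 37 : ℤ) = max α (g.a (i - 1)) + Z := by
  apply WP.of_wp
  simp only [moveFst, append_def, wp, Mach.reg_set, Mach.time_set, ↓reduceIte, Nat.reduceEqDiff]
  omega

/-- Each round before the last moves `j` back or `e` forward, and neither is ever reset. So `e +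
(g.W - j)` grows with each such round and gives linear time. -/
theorem tail_spec (hg : g.StartsAtPeak) (s : Mach) (h : GridRegs g fa fb av aw Z s)
    (h32 : s.reg 32 = av + g.V) (h36 : (s.reg 36 : ℤ) = g.a g.V + Z)
    (h39 : s.reg 39 = aw + g.W) (h40 : (s.reg 40 : ℤ) = g.b g.W + Z) (hB : 8 * Z + 8 ≤ B) :
    WP B tail s fun s' => (∃ top, TailSaved g aw Z s' (g.la + 1) top) ∧
      s'.time ≤ s.time + 70 * (g.la + g.W) + 100 := by
  refine WP.seq (P' := fun s' => s'.reg 52 = 1 ∧ s'.reg 43 = 0 ∧ s'.time = s.time + 5 ∧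
    TailRegs g av aw Z s' g.V g.W (g.a g.V) (g.a g.V) (g.b g.W)) ?_ ?_
  · apply WP.of_wp
    simp only [append_def, wp, Mach.reg_set, Mach.time_set, ↓reduceIte, Nat.reduceEqDiff]
    refine ⟨by omega, by omega, trivial, trivial, by simp, ?_⟩
    constructor <;> simp [Mach.reg_set, *]
  rintro s₀ hF₀ ⟨h52, h43, ht₀, hr₀⟩
  have hG₀ := h.frame hF₀ (by decide) (by decide)
  refine WP.loop (fun s' => (s'.reg 52 ≠ 0 ∧ ∃ e j top d β, GridRegs g fa fb av aw Z s' ∧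
    TailRegs g av aw Z s' e j top d β ∧ g.TailScan e j top d β ∧ TailSaved g aw Z s' e top ∧
      s'.time ≤ s.time + 10 + 70 * (e + (g.W - j))) ∨
    (s'.reg 52 = 0 ∧ ∃ top, TailSaved g aw Z s' (g.la + 1) top ∧
      s'.time ≤ s.time + 80 + 70 * (g.la + g.W))) (s.time + 80 + 70 * (g.la + g.W)) ?_ ?_ ?_
  -- No tail is accepted yet, so the recorded values are irrelevant and zeros serve.
  · refine .inl ⟨by omega, _, _, _, _, _, hG₀, hr₀, .init hg, ⟨0, 0, 0, .init _ (by omega) _ _ _,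
      by omega, fun h => by omega⟩, by omega⟩
  · rintro s' (⟨-, e, j, top, d, β, -, -, hs, -, h⟩ | ⟨-, top, -, h⟩)
    · have := hs.le_la
      omega
    · exact h
  rintro s' hcase -
  apply WP.of_wp
  simp only [wp, Mach.reg_set, Nat.reduceEqDiff, ↓reduceIte]
  rcases hcase with ⟨h52', e, j, top, d, β, hG, hr, hs, hsv, ht'⟩ | ⟨h52', top, hsv, ht'⟩
  swap
  · refine ⟨fun _ => ⟨⟨top, ?_⟩, ?_⟩, fun h => absurd h52' h⟩
    · exact hsv.congr (by simp [Mach.reg_tick, Mach.reg_set])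
    · simp only [Mach.time_tick, Mach.time_set]
      omega
  refine ⟨fun h => absurd h h52', fun _ => ?_⟩
  have hG₁ : GridRegs g fa fb av aw Z (s'.set 10 (s'.reg 10)).tick :=
    hG.congr rfl (by simp [Mach.reg_tick, Mach.reg_set])
  have hr₁ : TailRegs g av aw Z (s'.set 10 (s'.reg 10)).tick e j top d β :=
    hr.congr (by simp [Mach.reg_tick, Mach.reg_set])
  have hsv₁ : TailSaved g aw Z (s'.set 10 (s'.reg 10)).tick e top :=
    hsv.congr (by simp [Mach.reg_tick, Mach.reg_set])
  have h52₁ : (s'.set 10 (s'.reg 10)).tick.reg 52 ≠ 0 := by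
    simpa [Mach.reg_tick, Mach.reg_set] using h52'
  have ht₁ : (s'.set 10 (s'.reg 10)).tick.time = s'.time + 2 := rfl
  generalize (s'.set 10 (s'.reg 10)).tick = s₁ at *
  obtain ⟨hb1, hb2, hb3⟩ := tailScan_bounds hG₁ hs
  have hWZ := hG₁.b_le
  refine WP.seq (tryBack_spec (.inl ⟨rfl, rfl, rfl, rfl⟩) s₁ hG₁.one hr₁.r39 hG₁.peak_b
    (by rw [← hG₁.b_eq]; exact hr₁.r40) hr₁.r37 hG₁.limit hG₁.hold_b hs.le_W (by omega) hb1.2 hB) ?_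
  rintro s₂ hF₂ ⟨h55, h53, ht₂⟩
  rw [← hG₁.b_eq] at h55 h53
  have hG₂ := hG₁.frame hF₂ (by decide) (by decide)
  have hr₂ := hr₁.congr fun r hr => hF₂.1 r (by revert r; decide)
  have hsv₂ := hsv₁.congr fun r hr => hF₂.1 r (by revert r; decide)
  have h52₂ : s₂.reg 52 ≠ 0 := by rwa [hF₂.1 _ (by decide)]
  have hjW := hs.le_W
  refine WP.ite (fun h0 => ?_) (fun h0 => ?_)
  · obtain ⟨hlt, hge⟩ := h55.1 h0
    have hbj := hG₂.abs_b (x := j - 1) (by omega)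
    refine (moveSnd_spec s₂.tick hG₂.one (by omega) hr₂.r39 (h53 h0) hr₂.r41 hb3.2 hbj.2 hB).mono ?_
    rintro s₃ hF₃ ⟨ht₃, h39₃, h40₃, h41₃⟩
    have hFr : ∀ r, r ∉ moveSnd.writes → s₃.tick.reg r = s₂.reg r := fun r hr => hF₃.1 r hr
    refine .inl ⟨?_, e, j - 1, top, d, _,
      hG₂.congr (hF₃.2 rfl) fun r hr => hFr r (by revert r; decide), ?_, hs.move hlt hge, ?_, ?_⟩
    · rwa [hFr _ (by decide)]
    · obtain ⟨q1, q2, q3, q4, -, -, -⟩ := hr₂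
      have f1 := hFr 32 (by decide)
      have f2 := hFr 36 (by decide)
      have f3 := hFr 37 (by decide)
      have f4 := hFr 38 (by decide)
      exact ⟨by omega, by omega, by omega, by omega, h39₃, h40₃, h41₃⟩
    · exact hsv₂.congr fun r hr => hFr r (by revert r; decide)
    · simp only [Mach.time_tick] at ht₃ ⊢
      omega
  · have hj : g.Blocked j top := fun h => h0 (h55.2 h)
    refine WP.seq (check_spec hg s₂.tick (hG₂.congr rfl fun _ _ => rfl) (hr₂.congr fun _ _ => rfl) hs
      (hsv₂.congr fun _ _ => rfl) hj hB) ?_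
    rintro s₃ hF₃ ⟨hsv₃, ht₃⟩
    have hG₃ := hG₂.congr (s' := s₃) (hF₃.2 rfl) fun r hr => hF₃.1 r (by revert r; decide)
    have hr₃ := hr₂.congr (s' := s₃) fun r hr => hF₃.1 r (by revert r; decide)
    have h52₃ : s₃.reg 52 ≠ 0 := by rw [hF₃.1 _ (by decide)]; exact h52₂
    refine (nextTail_spec s₃ hG₃ hr₃ hs h52₃ hB).mono ?_
    rintro s₄ hF₄ ⟨ht₄, hcase⟩
    have hFr : ∀ r, r ∉ nextTail.writes → s₄.tick.tick.reg r = s₃.reg r := fun r hr => hF₄.1 r hr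
    have hG₄ := hG₃.congr (s' := s₄.tick.tick) (hF₄.2 rfl) fun r hr => hFr r (by revert r; decide)
    have hsv₄ := hsv₃.congr (s' := s₄.tick.tick) fun r hr => hFr r (by revert r; decide)
    have hle := hs.le_la
    simp only [Mach.time_tick] at ht₃
    rcases hcase with ⟨he, h52₄⟩ | ⟨he, h52₄, hr₄⟩
    · refine .inr ⟨h52₄, top, he ▸ hsv₄, ?_⟩
      simp only [Mach.time_tick]
      omega
    · refine .inl ⟨h52₄, e + 1, j, _, _, β, hG₄, hr₄.congr fun _ _ => rfl, hs.advance he,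
        hsv₄.mono (le_max_left _ _), ?_⟩
      simp only [Mach.time_tick]
      omega

/-- The registers used when both chains are traced back. -/
structure TraceRegs (g : Grid) (av aw Z : ℕ) (s : Mach) (i j : ℕ) (α β : ℤ) : Prop where
  r48 : s.reg 48 = av + i
  r49 : (s.reg 49 : ℤ) = g.a i + Z
  r37 : (s.reg 37 : ℤ) = α + Z
  r39 : s.reg 39 = aw + j
  r40 : (s.reg 40 : ℤ) = g.b j + Z
  r41 : (s.reg 41 : ℤ) = β + Z

theorem TraceRegs.congr {s s' : Mach} {i j : ℕ} {α β : ℤ} (h : TraceRegs g av aw Z s i j α β)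
    (hr : ∀ r ∈ [48, 49, 37, 39, 40, 41], s'.reg r = s.reg r) :
    TraceRegs g av aw Z s' i j α β := by
  simp only [List.mem_cons, List.not_mem_nil, or_false, forall_eq_or_imp, forall_eq] at hr
  obtain ⟨h1, h2, h3, h4, h5, h6⟩ := hr
  obtain ⟨k1, k2, k3, k4, k5, k6⟩ := h
  constructor <;> omega

theorem traced_bounds {s : Mach} {i j : ℕ} {α β : ℤ} (h : GridRegs g fa fb av aw Z s)
    (ht : g.Traced i j α β) :
    (-(Z : ℤ) ≤ α ∧ α ≤ Z) ∧ (-(Z : ℤ) ≤ β ∧ β ≤ Z) := by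
  obtain ⟨x, y, -, h1, -, h2, rfl, rfl, -⟩ := ht.sound
  exact ⟨h.abs_a h1, h.abs_b h2⟩

/-- Neither chain can be traced back further. -/
def Stuck (g : Grid) (i j : ℕ) (α β : ℤ) : Prop :=
  g.Blocked j α ∧ ¬ (g.gv < i ∧ 0 ≤ g.K + g.a (i - 1) + β)

/-- Every successful move increases `(g.V - i) + (g.W - j)`, and the first round that fails on both
chains stops the loop. The bound on the tails persists because `α` only grows. -/
theorem trace_spec (hg : g.StartsAtPeak) (s : Mach) (h : GridRegs g fa fb av aw Z s)
    (h48 : s.reg 48 = av + g.V) (h49 : (s.reg 49 : ℤ) = g.a g.V + Z) {jS : ℕ} {αS βS : ℤ}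
    (hsv : SavedRegs g aw Z s jS αS βS) (htr : g.Traced g.V jS αS βS) (htail : g.TailLE αS)
    (hB : 8 * Z + 8 ≤ B) :
    WP B trace s fun s' => (∃ i j α β, TraceRegs g av aw Z s' i j α β ∧ g.Traced i j α β ∧
      g.TailLE α ∧ Stuck g i j α β) ∧ s'.time ≤ s.time + 70 * (g.la + g.W) + 100 := by
  obtain ⟨r44, r45, r46, r47⟩ := hsv
  refine WP.seq (P' := fun s' => s'.reg 52 = 1 ∧ s'.time = s.time + 5 ∧
    TraceRegs g av aw Z s' g.V jS αS βS) ?_ ?_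
  · apply WP.of_wp
    simp only [append_def, wp, Mach.reg_set, Mach.time_set, ↓reduceIte, Nat.reduceEqDiff]
    refine ⟨by omega, trivial, by simp, ?_⟩
    constructor <;> simp [Mach.reg_set, *]
  rintro s₀ hF₀ ⟨h52, ht₀, hr₀⟩
  have hG₀ := h.frame hF₀ (by decide) (by decide)
  have hVla := hg.V_le
  have hjSW := htr.le_W
  refine WP.loop (fun s' => ∃ i j α β, GridRegs g fa fb av aw Z s' ∧
    TraceRegs g av aw Z s' i j α β ∧ g.Traced i j α β ∧ g.TailLE α ∧
    ((s'.reg 52 ≠ 0 ∧ s'.time ≤ s.time + 10 + 70 * ((g.V - i) + (g.W - j))) ∨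
    (s'.reg 52 = 0 ∧ Stuck g i j α β ∧ s'.time ≤ s.time + 80 + 70 * (g.la + g.W))))
    (s.time + 80 + 70 * (g.la + g.W)) ?_ ?_ ?_
  · exact ⟨_, _, _, _, hG₀, hr₀, htr, htail, .inl ⟨by omega, by omega⟩⟩
  · rintro s' ⟨i, j, α, β, -, -, -, -, ⟨-, h⟩ | ⟨-, -, h⟩⟩ <;> omega
  rintro s' ⟨i, j, α, β, hG, hr, hs, hT, hcase⟩ -
  apply WP.of_wp
  simp only [wp, Mach.reg_set, Nat.reduceEqDiff, ↓reduceIte]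
  rcases hcase with ⟨h52', ht'⟩ | ⟨h52', hst, ht'⟩
  swap
  · refine ⟨fun _ => ⟨⟨i, j, α, β, ?_, hs, hT, hst⟩, ?_⟩, fun h => absurd h52' h⟩
    · exact hr.congr (by simp [Mach.reg_tick, Mach.reg_set])
    · simp only [Mach.time_tick, Mach.time_set]
      omega
  refine ⟨fun h => absurd h h52', fun _ => ?_⟩
  have hG₁ : GridRegs g fa fb av aw Z (s'.set 10 (s'.reg 10)).tick :=
    hG.congr rfl (by simp [Mach.reg_tick, Mach.reg_set])
  have hr₁ : TraceRegs g av aw Z (s'.set 10 (s'.reg 10)).tick i j α β :=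
    hr.congr (by simp [Mach.reg_tick, Mach.reg_set])
  have h52₁ : (s'.set 10 (s'.reg 10)).tick.reg 52 ≠ 0 := by
    simpa [Mach.reg_tick, Mach.reg_set] using h52'
  have ht₁ : (s'.set 10 (s'.reg 10)).tick.time = s'.time + 2 := rfl
  generalize (s'.set 10 (s'.reg 10)).tick = s₁ at *
  obtain ⟨hb1, hb2⟩ := traced_bounds hG₁ hs
  have hWZ := hG₁.b_le
  have haZ := hG₁.a_le
  refine WP.seq (tryBack_spec (.inl ⟨rfl, rfl, rfl, rfl⟩) s₁ hG₁.one hr₁.r39 hG₁.peak_b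
    (by rw [← hG₁.b_eq]; exact hr₁.r40) hr₁.r37 hG₁.limit hG₁.hold_b hs.le_W (by omega) hb1.2 hB) ?_
  rintro s₂ hF₂ ⟨h55, h53, ht₂⟩
  rw [← hG₁.b_eq] at h55 h53
  have hG₂ := hG₁.frame hF₂ (by decide) (by decide)
  have hr₂ := hr₁.congr fun r hr => hF₂.1 r (by revert r; decide)
  have h52₂ : s₂.reg 52 ≠ 0 := by rwa [hF₂.1 _ (by decide)]
  have hjW := hs.le_W
  have hiV := hs.le_V
  refine WP.ite (fun h0 => ?_) (fun h0 => ?_)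
  · obtain ⟨hlt, hge⟩ := h55.1 h0
    have hbj := hG₂.abs_b (x := j - 1) (by omega)
    refine (moveSnd_spec s₂.tick hG₂.one (by omega) hr₂.r39 (h53 h0) hr₂.r41 hb2.2 hbj.2 hB).mono ?_
    rintro s₃ hF₃ ⟨ht₃, h39₃, h40₃, h41₃⟩
    have hFr : ∀ r, r ∉ moveSnd.writes → s₃.tick.reg r = s₂.reg r := fun r hr => hF₃.1 r hr
    refine ⟨i, j - 1, α, _, hG₂.congr (hF₃.2 rfl) fun r hr => hFr r (by revert r; decide), ?_,
      hs.move_snd hlt hge, hT, .inl ⟨?_, ?_⟩⟩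
    · obtain ⟨q1, q2, q3, -, -, -⟩ := hr₂
      have f1 := hFr 48 (by decide)
      have f2 := hFr 49 (by decide)
      have f3 := hFr 37 (by decide)
      exact ⟨by omega, by omega, by omega, h39₃, h40₃, h41₃⟩
    · rwa [hFr _ (by decide)]
    · simp only [Mach.time_tick] at ht₃ ⊢
      omega
  have hj : g.Blocked j α := fun h => h0 (h55.2 h)
  refine WP.seq (tryBack_spec (.inr ⟨rfl, rfl, rfl, rfl⟩) s₂.tick hG₂.one hr₂.r48 hG₂.peak_a
    (by rw [← hG₂.a_eq]; exact hr₂.r49) hr₂.r41 hG₂.limit hG₂.hold_a (hiV.trans hVla) (by omega)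
    hb2.2 hB) ?_
  rintro s₃ hF₃ ⟨h55', h53', ht₃⟩
  rw [← hG₂.a_eq] at h55' h53'
  have hG₃ := hG₂.congr (s' := s₃) (hF₃.2 rfl) fun r hr => hF₃.1 r (by revert r; decide)
  have hr₃ := hr₂.congr (s' := s₃) fun r hr => hF₃.1 r (by revert r; decide)
  have h52₃ : s₃.reg 52 ≠ 0 := by rw [hF₃.1 _ (by decide)]; exact h52₂
  have e1 : g.K + β + g.a (i - 1) = g.K + g.a (i - 1) + β := by ring
  rw [e1] at h55'
  refine WP.ite (fun h1 => ?_) (fun h1 => ?_)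
  · obtain ⟨hlt, hge⟩ := h55'.1 h1
    have hai := hG₃.abs_a (x := i - 1) (by omega)
    refine (moveFst_spec s₃.tick hG₃.one (by omega) hr₃.r48 (h53' h1) hr₃.r37 hb1.2 hai.2 hB).mono ?_
    rintro s₄ hF₄ ⟨ht₄, h48₄, h49₄, h37₄⟩
    have hFr : ∀ r, r ∉ moveFst.writes → s₄.tick.tick.reg r = s₃.reg r := fun r hr => hF₄.1 r hr
    refine ⟨i - 1, j, _, β, hG₃.congr (hF₄.2 rfl) fun r hr => hFr r (by revert r; decide), ?_,
      hs.move_fst hlt hge, fun e he x hx1 hx2 => (hT e he x hx1 hx2).trans (le_max_left _ _),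
      .inl ⟨?_, ?_⟩⟩
    · obtain ⟨-, -, -, q4, q5, q6⟩ := hr₃
      have f1 := hFr 39 (by decide)
      have f2 := hFr 40 (by decide)
      have f3 := hFr 41 (by decide)
      exact ⟨h48₄, h49₄, h37₄, by omega, by omega, by omega⟩
    · rwa [hFr _ (by decide)]
    · simp only [Mach.time_tick] at ht₃ ht₄ ⊢
      omega
  · apply WP.of_wp
    refine ⟨by omega, i, j, α, β, hG₃.congr rfl ?_, hr₃.congr ?_, hs, hT,
      .inr ⟨?_, ⟨hj, fun h => h1 (h55'.2 h)⟩, ?_⟩⟩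
    · simp [Mach.reg_set, Mach.reg_tick]
    · simp [Mach.reg_set, Mach.reg_tick]
    · simp [Mach.reg_set, Mach.reg_tick]
    · simp only [Mach.time_tick, Mach.time_set] at ht₃ ⊢
      omega

/-- Four truncated differences are added, one for each condition of `Traced.solvable_iff`. For the
two equalities one difference suffices, as `i` and `j` never fall below the start. -/
theorem verdict_spec (hg : g.StartsAtPeak) (s : Mach) (h : GridRegs g fa fb av aw Z s) {i j : ℕ}
    {α β : ℤ} (hr : TraceRegs g av aw Z s i j α β) (hs : g.Traced i j α β) (hT : g.TailLE α)
    (hst : Stuck g i j α β) (hB : 8 * Z + 8 ≤ B) :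
    WP B verdict s fun s' => (g.Solvable (g.gv, g.gw) → s'.reg 0 = 1) ∧
      (¬ g.Solvable (g.gv, g.gw) → s'.reg 0 = 0) ∧ s'.time ≤ s.time + 20 := by
  rw [hs.solvable_iff hg hT hst.1 hst.2]
  obtain ⟨hb1, hb2⟩ := traced_bounds h hs
  obtain ⟨r48, r49, r37, r39, r40, r41⟩ := hr
  have h34 := h.peak_a
  have h35 := h.peak_b
  have h50 := h.height_a
  have h51 := h.height_b
  have haz := h.a_le
  have hbz := h.b_le
  have h1 := hs.gv_le
  have h2 := hs.gw_le
  have h3 := hs.le_V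
  have h4 := hs.le_W
  have h5 := hg.V_le
  apply WP.of_wp
  simp only [verdict, append_def, wp, Mach.reg_set, Mach.time_set, Mach.reg_tick,
    Mach.time_tick, ↓reduceIte, Nat.reduceEqDiff]
  refine ⟨by omega, by omega, by omega, fun h0 => ⟨by omega, by simp, fun h => absurd ?_ h, by omega⟩,
    fun h0 => ⟨by omega, fun h => absurd h ?_, by simp, by omega⟩⟩
  · exact ⟨by omega, by omega, by omega, by omega⟩
  · omega

theorem solve_spec (hg : g.StartsAtPeak) (s : Mach) (h : GridRegs g fa fb av aw Z s)
    (h32 : s.reg 32 = av + g.V) (h36 : (s.reg 36 : ℤ) = g.a g.V + Z)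
    (h39 : s.reg 39 = aw + g.W) (h40 : (s.reg 40 : ℤ) = g.b g.W + Z) (hB : 8 * Z + 8 ≤ B) :
    WP B solve s fun s' => (g.Solvable (g.gv, g.gw) → s'.reg 0 = 1) ∧
      (¬ g.Solvable (g.gv, g.gw) → s'.reg 0 = 0) ∧
      s'.time ≤ s.time + 140 * (g.la + g.W) + 300 := by
  refine WP.seq (P' := fun s' => s'.reg 48 = av + g.V ∧ (s'.reg 49 : ℤ) = g.a g.V + Z ∧
    s'.time = s.time + 2) ?_ ?_
  · apply WP.of_wp
    simp [append_def, wp, Mach.reg_set, Mach.time_set, h32, h36]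
  rintro s₁ hF₁ ⟨h48, h49, ht₁⟩
  have hG₁ := h.frame hF₁ (by decide) (by decide)
  rw [← hF₁.1 32 (by decide)] at h32
  rw [← hF₁.1 36 (by decide)] at h36
  rw [← hF₁.1 39 (by decide)] at h39
  rw [← hF₁.1 40 (by decide)] at h40
  refine WP.seq (tail_spec hg s₁ hG₁ h32 h36 h39 h40 hB) ?_
  rintro s₂ hF₂ ⟨⟨top, jS, αS, βS, hd, h43, hsv⟩, ht₂⟩
  have hG₂ := hG₁.frame hF₂ (by decide) (by decide)
  rw [← hF₂.1 48 (by decide)] at h48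
  rw [← hF₂.1 49 (by decide)] at h49
  refine WP.ite (fun h0 => ?_) (fun h0 => ?_)
  · have hn := hd.not_solvable hg (by omega)
    apply WP.of_wp
    refine ⟨by omega, fun h => absurd h hn, fun _ => ?_, ?_⟩
    · simp [Mach.reg_set]
    · simp only [Mach.time_set, Mach.time_tick]
      omega
  · have hok : s₂.reg 43 = 1 := by omega
    have hG₂' : GridRegs g fa fb av aw Z s₂.tick := hG₂.congr rfl fun _ _ => rfl
    refine WP.seq (trace_spec hg s₂.tick hG₂' h48 h49 ((hsv hok).congr fun _ _ => rfl)
      (hd.traced hok).1 (hd.tailLE hg) hB) ?_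
    rintro s₃ hF₃ ⟨⟨i, j, α, β, hr, hs, hT, hst⟩, ht₃⟩
    have hG₃ := hG₂'.frame hF₃ (by decide) (by decide)
    refine (verdict_spec hg s₃ hG₃ hr hs hT hst hB).mono ?_
    rintro s₄ - ⟨k1, k2, k3⟩
    simp only [Mach.reg_tick, Mach.time_tick] at k1 k2 k3 ht₃ ⊢
    exact ⟨k1, k2, by omega⟩

end Cmd

namespace Cmd

variable {B : ℕ}

/-! ### Reading the input -/

/-- The address of the length of chain `i`. -/
def offset (len : ℕ → ℕ) : ℕ → ℕ
  | 0 => 5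
  | i + 1 => offset len i + len i + 1

theorem offset_mono (len : ℕ → ℕ) : Monotone (offset len) :=
  monotone_nat_of_le_succ fun i => by simp only [offset]; omega

theorem offset_succ_le {len : ℕ → ℕ} {i p : ℕ} (h : i < p) :
    offset len i + len i + 1 ≤ offset len p := offset_mono len h

theorem le_offset (len : ℕ → ℕ) (i : ℕ) : i + 5 ≤ offset len i := by
  induction i with
  | zero => exact le_rfl
  | succ i ih => simp only [offset]; omega

/-- The memory contains the input: `p` chains of lengths `len i` with operations `f i`, and two nodes
given by chain and position. -/
structure Input (p : ℕ) (len : ℕ → ℕ) (f : ℕ → ℕ → Bool) (v₁ v₂ w₁ w₂ : ℕ) (m : ℕ → ℕ) : Prop where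
  cell0 : m 0 = p
  cell1 : m 1 = v₁
  cell2 : m 2 = v₂
  cell3 : m 3 = w₁
  cell4 : m 4 = w₂
  len_eq : ∀ i < p, m (offset len i) = len i
  hold : ∀ i < p, Holds m (offset len i + 1) (len i) (f i)
  zero : ∀ a, offset len p ≤ a → m a = 0
  v₁_lt : v₁ < p
  v₂_lt : v₂ < len v₁
  w₁_lt : w₁ < p
  w₂_lt : w₂ < len w₁

/-- Read the two nodes, and find the addresses of their chains and of the end of the input. -/
def locate : Cmd :=
  (const 6 1 ++ const 10 0 ++ load 1 10 ++ const 10 1 ++ load 2 10 ++ const 10 2 ++ load 3 10 ++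
    const 10 3 ++ load 4 10 ++ const 10 4 ++ load 5 10 ++ const 7 5 ++ const 8 0) ++
  (loop (sub 10 1 8) 10
    (load 9 7 ++
      (sub 10 8 2 ++ sub 11 2 8 ++ add 10 10 11 ++ ite 10 (add 12 7 6 ++ move 13 9) skip) ++
      (sub 10 8 4 ++ sub 11 4 8 ++ add 10 10 11 ++ ite 10 (add 14 7 6) skip) ++
      (add 7 7 9 ++ add 7 7 6 ++ add 8 8 6)) ++
    move 15 7)

/-- The registers set by `locate`. -/
structure LocRegs (p : ℕ) (len : ℕ → ℕ) (v₁ v₂ w₁ w₂ : ℕ) (s : Mach) : Prop where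
  r1 : s.reg 1 = p
  r2 : s.reg 2 = v₁
  r3 : s.reg 3 = v₂
  r4 : s.reg 4 = w₁
  r5 : s.reg 5 = w₂
  r6 : s.reg 6 = 1
  r12 : s.reg 12 = offset len v₁ + 1
  r13 : s.reg 13 = len v₁
  r14 : s.reg 14 = offset len w₁ + 1
  r15 : s.reg 15 = offset len p

variable {p : ℕ} {len : ℕ → ℕ} {f : ℕ → ℕ → Bool} {v₁ v₂ w₁ w₂ : ℕ}

theorem LocRegs.congr {s s' : Mach} (h : LocRegs p len v₁ v₂ w₁ w₂ s)
    (hr : ∀ r ∈ [1, 2, 3, 4, 5, 6, 12, 13, 14, 15], s'.reg r = s.reg r) :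
    LocRegs p len v₁ v₂ w₁ w₂ s' := by
  simp only [List.mem_cons, List.not_mem_nil, or_false, forall_eq_or_imp, forall_eq] at hr
  obtain ⟨h1, h2, h3, h4, h5, h6, h7, h8, h9, h10⟩ := hr
  obtain ⟨k1, k2, k3, k4, k5, k6, k7, k8, k9, k10⟩ := h
  constructor <;> omega

theorem LocRegs.frame {s s' : Mach} {c : Cmd} (h : LocRegs p len v₁ v₂ w₁ w₂ s) (hF : c.Frame s s')
    (hr : ∀ r ∈ [1, 2, 3, 4, 5, 6, 12, 13, 14, 15], r ∉ c.writes) :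
    LocRegs p len v₁ v₂ w₁ w₂ s' :=
  h.congr fun r h' => hF.1 r (hr r h')

/-- A chain's address is known only after the lengths of its predecessors have been added up. The
chains of the two nodes are recognised by the vanishing of the sum of both truncated differences of
the indices. -/
theorem locate_spec {m : ℕ → ℕ} (h : Input p len f v₁ v₂ w₁ w₂ m) (s : Mach) (hm : s.mem = m)
    (hB : 8 * offset len p + 8 ≤ B) :
    WP B locate s fun s' => LocRegs p len v₁ v₂ w₁ w₂ s' ∧
      s'.time ≤ s.time + 40 * offset len p := by
  have hp := le_offset len p
  refine WP.seq (P' := fun s' => s'.reg 1 = p ∧ s'.reg 2 = v₁ ∧ s'.reg 3 = v₂ ∧ s'.reg 4 = w₁ ∧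
    s'.reg 5 = w₂ ∧ s'.reg 6 = 1 ∧ s'.reg 7 = 5 ∧ s'.reg 8 = 0 ∧ s'.time = s.time + 13) ?_ ?_
  · apply WP.of_wp
    simp only [append_def, wp, Mach.reg_set, Mach.mem_set, Mach.time_set, hm, h.cell0, h.cell1,
      h.cell2, h.cell3, h.cell4, ↓reduceIte, Nat.reduceEqDiff]
    simp
    omega
  rintro s₁ hF₁ ⟨r1, r2, r3, r4, r5, r6, r7, r8, ht₁⟩
  have hm₁ : s₁.mem = m := (hF₁.2 (by decide)).trans hm
  refine WP.seq (P' := fun s' => s'.reg 7 = offset len p ∧ s'.reg 12 = offset len v₁ + 1 ∧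
    s'.reg 13 = len v₁ ∧ s'.reg 14 = offset len w₁ + 1 ∧
    s'.time ≤ s.time + 20 + 30 * p) ?_ ?_
  · refine WP.loop (fun s' => ∃ i ≤ p, s'.reg 7 = offset len i ∧ s'.reg 8 = i ∧
      (v₁ < i → s'.reg 12 = offset len v₁ + 1 ∧ s'.reg 13 = len v₁) ∧
      (w₁ < i → s'.reg 14 = offset len w₁ + 1) ∧ s'.time ≤ s.time + 13 + 30 * i)
      (s.time + 13 + 30 * p) ?_ ?_ ?_
    · exact ⟨0, by omega, r7, r8, fun h => by omega, fun h => by omega, by omega⟩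
    · rintro s' ⟨i, hi, -, -, -, -, h⟩
      omega
    rintro s' ⟨i, hi, h7, h8, hv, hw, ht⟩ hF
    have h1 : s'.reg 1 = p := (hF.1 _ (by decide)).trans r1
    have h2 : s'.reg 2 = v₁ := (hF.1 _ (by decide)).trans r2
    have h4 : s'.reg 4 = w₁ := (hF.1 _ (by decide)).trans r4
    have h6 : s'.reg 6 = 1 := (hF.1 _ (by decide)).trans r6
    have hm' : s'.mem = m := (hF.2 (by decide)).trans hm₁
    apply WP.of_wp
    simp only [wp, Mach.reg_set, Mach.time_set, Mach.reg_tick, Mach.time_tick, h1, h8, ↓reduceIte,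
      Nat.reduceEqDiff]
    constructor
    · intro hz
      obtain rfl : i = p := by omega
      obtain ⟨k1, k2⟩ := hv h.v₁_lt
      exact ⟨h7, k1, k2, hw h.w₁_lt, by omega⟩
    intro hz
    have hip : i < p := by omega
    have hl := h.len_eq i hip
    have hoff := offset_succ_le (len := len) hip
    have hle := le_offset len i
    have hvp := h.v₁_lt
    have hwp := h.w₁_lt
    apply WP.of_wp
    simp only [append_def, wp, Mach.reg_set, Mach.mem_set, Mach.time_set, Mach.reg_tick,
      Mach.mem_tick, Mach.time_tick, h2, h4, h6, h7, h8, hm', hl, ↓reduceIte, Nat.reduceEqDiff]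
    refine ⟨by omega, fun hiv => ⟨by omega, by omega, fun hiw => ⟨by omega, by omega, by omega,
      by omega, i + 1, hip, rfl, rfl, ?_, ?_, by omega⟩, fun hiw => ⟨by omega, by omega, by omega,
      i + 1, hip, rfl, rfl, ?_, ?_, by omega⟩⟩, fun hiv => ⟨by omega, fun hiw => ⟨by omega, by omega,
      by omega, by omega, i + 1, hip, rfl, rfl, ?_, ?_, by omega⟩, fun hiw => ⟨by omega, by omega,
      by omega, i + 1, hip, rfl, rfl, ?_, ?_, by omega⟩⟩⟩
    · obtain rfl : i = v₁ := by omega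
      exact fun _ => ⟨rfl, rfl⟩
    · obtain rfl : i = w₁ := by omega
      exact fun _ => rfl
    · obtain rfl : i = v₁ := by omega
      exact fun _ => ⟨rfl, rfl⟩
    · exact fun _ => hw (by omega)
    · exact fun _ => hv (by omega)
    · obtain rfl : i = w₁ := by omega
      exact fun _ => rfl
    · exact fun _ => hv (by omega)
    · exact fun _ => hw (by omega)
  rintro s₂ hF₂ ⟨r7', r12, r13, r14, ht₂⟩
  rw [← hF₂.1 _ (by decide)] at r1 r2 r3 r4 r5 r6
  apply WP.of_wp
  refine ⟨?_, by simp only [Mach.time_set]; omega⟩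
  constructor <;> simp [Mach.reg_set, *]

/-- Build the table of the new maxima of all chains, by maximal drawdown. -/
def countAll : Cmd :=
  (const 7 5 ++ const 8 0) ++
  loop (sub 10 1 8) 10
    ((load 9 7 ++ add 18 7 6 ++ sub 10 8 4 ++ sub 11 4 8 ++ add 10 10 11 ++
        ite 10 (add 19 18 5) (add 19 18 9)) ++
      (scan countAct ++ (add 7 7 9 ++ add 7 7 6 ++ add 8 8 6)))

/-- The length of chain `i`, cut off before the second node. -/
def cutLen (len : ℕ → ℕ) (w₁ w₂ i : ℕ) : ℕ := if i = w₁ then w₂ else len i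

/-- The entries of the table after the first `i` chains. -/
def table (len : ℕ → ℕ) (f : ℕ → ℕ → Bool) (w₁ w₂ r : ℕ) : ℕ → ℕ
  | 0 => 0
  | i + 1 => table len f w₁ w₂ r i + records (f i) r (cutLen len w₁ w₂ i)

theorem records_le (f : ℕ → Bool) (r n : ℕ) : records f r n ≤ n := by
  induction n with
  | zero => exact le_rfl
  | succ k ih => simp only [records]; split_ifs <;> omega

theorem cutLen_le {len : ℕ → ℕ} {w₁ w₂ : ℕ} (h : w₂ ≤ len w₁) (i : ℕ) :
    cutLen len w₁ w₂ i ≤ len i := by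
  unfold cutLen
  split_ifs with h'
  · rw [h']; exact h
  · exact le_rfl

theorem table_le {len : ℕ → ℕ} {w₁ w₂ : ℕ} (h : w₂ ≤ len w₁) (f : ℕ → ℕ → Bool) (r i : ℕ) :
    table len f w₁ w₂ r i ≤ offset len i := by
  induction i with
  | zero => exact Nat.zero_le _
  | succ i ih =>
    have := records_le (f i) r (cutLen len w₁ w₂ i)
    have := cutLen_le h i
    simp only [table, offset]
    omega

theorem countAll_spec {m : ℕ → ℕ} (h : Input p len f v₁ v₂ w₁ w₂ m) (s : Mach) (hm : s.mem = m)
    (hr : LocRegs p len v₁ v₂ w₁ w₂ s) (hB : 8 * offset len p + 8 ≤ B) :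
    WP B countAll s fun s' => (∀ x < offset len p, s'.mem x = m x) ∧
      (∀ r, s'.mem (offset len p + r) = table len f w₁ w₂ r p) ∧
      s'.time ≤ s.time + 70 * offset len p := by
  have hp := le_offset len p
  refine WP.seq (P' := fun s' => s'.reg 7 = 5 ∧ s'.reg 8 = 0 ∧ s'.time = s.time + 2 ∧
    s'.mem = m) ?_ ?_
  · apply WP.of_wp
    simp [append_def, wp, Mach.reg_set, Mach.time_set, Mach.mem_set, hm]
    omega
  rintro s₁ hF₁ ⟨r7, r8, ht₁, hm₁⟩
  have hr₁ := hr.frame hF₁ (by decide)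
  refine WP.loop (fun s' => ∃ i ≤ p, s'.reg 7 = offset len i ∧ s'.reg 8 = i ∧
    (∀ x < offset len p, s'.mem x = m x) ∧
    (∀ r, s'.mem (offset len p + r) = table len f w₁ w₂ r i) ∧
    s'.time ≤ s.time + 2 + 60 * offset len i) (s.time + 2 + 60 * offset len p) ?_ ?_ ?_
  · refine ⟨0, by omega, r7, r8, fun x _ => by rw [hm₁], fun r => ?_, by omega⟩
    -- Cells beyond the input start as zero, so the table needs no initialisation.
    rw [hm₁, h.zero _ (by omega), table]
  · rintro s' ⟨i, hi, -, -, -, -, h⟩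
    have := offset_mono len hi
    omega
  rintro s' ⟨i, hi, h7, h8, hlow, hhigh, ht⟩ hF
  have hr' := hr₁.frame hF (by decide)
  apply WP.of_wp
  simp only [wp, Mach.reg_set, Mach.time_set, Mach.mem_set, Mach.reg_tick, Mach.time_tick,
    Mach.mem_tick, hr'.r1, h8, ↓reduceIte]
  constructor
  · intro hz
    obtain rfl : i = p := by omega
    exact ⟨hlow, hhigh, by omega⟩
  intro hz
  have hip : i < p := by omega
  have hoff := offset_succ_le (len := len) hip
  have hcut := cutLen_le h.w₂_lt.le i
  have hl : s'.mem (offset len i) = len i := by rw [hlow _ (by omega), h.len_eq i hip]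
  have hle := le_offset len i
  refine WP.seq (P' := fun s₂ => s₂.reg 9 = len i ∧ s₂.reg 18 = offset len i + 1 ∧
    s₂.reg 19 = offset len i + 1 + cutLen len w₁ w₂ i ∧ s₂.time ≤ s'.time + 12) ?_ ?_
  · apply WP.of_wp
    have hw := h.w₁_lt
    have hw2 := h.w₂_lt
    have hwo := offset_succ_le (len := len) hw
    simp only [append_def, wp, Mach.reg_set, Mach.mem_set, Mach.time_set, Mach.reg_tick,
      Mach.mem_tick, Mach.time_tick, hr'.r4, hr'.r5, hr'.r6, h7, h8, hl, ↓reduceIte,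
      Nat.reduceEqDiff]
    refine ⟨by omega, by omega, fun hz => ⟨by omega, trivial, trivial, ?_, by omega⟩,
      fun hz => ⟨by omega, trivial, trivial, ?_, by omega⟩⟩
    · rw [cutLen, if_pos (by omega)]
    · rw [cutLen, if_neg (by omega)]
  rintro s₂ hF₂ ⟨r9, r18, r19, ht₂⟩
  have hm₂ : s₂.mem = s'.mem := hF₂.2 (by decide)
  have hr₂ := (hr'.congr (s' := (s'.set 10 (p - i)).tick)
    (by simp [Mach.reg_tick, Mach.reg_set])).frame hF₂ (by decide)
  have h7₂ : s₂.reg 7 = offset len i := by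
    rw [hF₂.1 _ (by decide)]; simpa [Mach.reg_tick, Mach.reg_set] using h7
  have h8₂ : s₂.reg 8 = i := by
    rw [hF₂.1 _ (by decide)]; simpa [Mach.reg_tick, Mach.reg_set] using h8
  refine WP.seq (count_spec (f := f i) (C := fun r => table len f w₁ w₂ r i) (m₀ := m) s₂ hr₂.r6
    hr₂.r15 r18 r19 (by omega) (by omega) (fun r => ?_)
    (fun k hk => h.hold i hip k (by omega)) (by rw [hm₂]; exact hlow) (by rw [hm₂]; exact hhigh)) ?_
  · have := table_le h.w₂_lt.le f r i
    omega
  rintro s₃ hF₃ ⟨hlow₃, hhigh₃, ht₃⟩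
  rw [← hF₃.1 _ (by decide)] at r9 h7₂ h8₂
  have h6₃ := (hF₃.1 6 (by decide)).trans hr₂.r6
  apply WP.of_wp
  simp only [append_def, wp, Mach.reg_set, Mach.mem_set, Mach.time_set, r9, h7₂, h8₂, h6₃, ↓reduceIte, Nat.reduceEqDiff]
  refine ⟨by omega, by omega, by omega, i + 1, hip, rfl, rfl, hlow₃, fun r => ?_, ?_⟩
  · rw [hhigh₃, table]
  · simp only [offset]
    omega

/-- Find the least level `M` not exceeded by the number of new maxima with drawdown at most `M`. -/
def findTop : Cmd :=
  (const 21 0 ++ load 20 15) ++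
  loop (sub 10 20 21) 10 (add 21 21 6 ++ add 10 15 21 ++ load 11 10 ++ add 20 20 11)

/-- Every `r` passed satisfies `r < N r ≤ Z`, so there are at most `Z` rounds that continue, each
adding one table entry to the prefix sum. -/
theorem findTop_spec {N : ℕ → ℕ} {Z : ℕ} (s : Mach) (h6 : s.reg 6 = 1) (h15 : s.reg 15 = Z)
    (h0 : N 0 = s.mem Z) (hs : ∀ r, N (r + 1) = N r + s.mem (Z + (r + 1))) (hN : ∀ r, N r ≤ Z)
    (hB : 8 * Z + 8 ≤ B) :
    WP B findTop s fun s' => ∃ M, s'.reg 20 = N M ∧ N M ≤ M ∧ (∀ r < M, r < N r) ∧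
      s'.time ≤ s.time + 10 * Z + 20 := by
  refine WP.seq (P' := fun s' => s'.reg 20 = N 0 ∧ s'.reg 21 = 0 ∧ s'.time = s.time + 2) ?_ ?_
  · apply WP.of_wp
    simp [append_def, wp, Mach.reg_set, Mach.time_set, Mach.mem_set, h0, h15]
  rintro s₁ hF₁ ⟨r20, r21, ht₁⟩
  refine WP.loop (fun s' => ∃ r, s'.reg 20 = N r ∧ s'.reg 21 = r ∧ (∀ r' < r, r' < N r') ∧
    r ≤ Z ∧ s'.time ≤ s.time + 2 + 10 * r) (s.time + 2 + 10 * Z) ?_ ?_ ?_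
  · exact ⟨0, r20, r21, by omega, by omega, by omega⟩
  · rintro s' ⟨r, -, -, -, h1, h2⟩
    omega
  rintro s' ⟨r, h20, h21, hlt, hrZ, ht⟩ hF
  have h6' : s'.reg 6 = 1 := by rw [hF.1 _ (by decide), hF₁.1 _ (by decide), h6]
  have h15' : s'.reg 15 = Z := by rw [hF.1 _ (by decide), hF₁.1 _ (by decide), h15]
  have hm' : s'.mem = s.mem := by rw [hF.2 (by decide), hF₁.2 (by decide)]
  have hNr := hN r
  have hNr' := hN (r + 1)
  have hsr := hs r
  apply WP.of_wp
  simp only [wp, Mach.reg_set, Mach.time_set, Mach.reg_tick, Mach.time_tick, h20, h21, ↓reduceIte,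
    Nat.reduceEqDiff]
  refine ⟨fun hz => ⟨r, rfl, by omega, hlt, by omega⟩, fun hz => ?_⟩
  apply WP.of_wp
  simp only [append_def, wp, Mach.reg_set, Mach.mem_set, Mach.time_set, Mach.reg_tick,
    Mach.mem_tick, Mach.time_tick, h6', h15', h20, h21, hm', ↓reduceIte, Nat.reduceEqDiff]
  refine ⟨by omega, by omega, by omega, r + 1, by omega, rfl, fun r' hr' => ?_, by omega, by omega⟩
  rcases Nat.lt_or_ge r' r with h | h
  · exact hlt r' h
  · obtain rfl : r' = r := by omega
    omega

/-- Find the peaks of the two chains, and the height of the second node. -/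
def prepare : Cmd :=
  (move 18 12 ++ add 19 12 13) ++ (peakScan ++ ((move 34 23 ++ move 50 22 ++
    move 18 14 ++ add 19 14 5) ++ (peakScan ++ ((move 35 23 ++ move 51 22 ++
    move 18 14 ++ add 19 14 5) ++ (sumScan ++ (move 40 26 ++ add 39 14 5 ++ load 53 39))))))

theorem prepare_spec {m : ℕ → ℕ} (h : Input p len f v₁ v₂ w₁ w₂ m) (s : Mach)
    (hm : ∀ x < offset len p, s.mem x = m x) (hr : LocRegs p len v₁ v₂ w₁ w₂ s) {M : ℕ}
    (h20 : s.reg 20 = M) (hB : 8 * offset len p + 8 ≤ B) :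
    WP B prepare s fun s' => s'.reg 34 = offset len v₁ + 1 + peakPos (f v₁) M (len v₁) ∧
      s'.reg 50 = peak (f v₁) M (len v₁) ∧
      s'.reg 35 = offset len w₁ + 1 + peakPos (f w₁) M w₂ ∧
      s'.reg 51 = peak (f w₁) M w₂ ∧
      (s'.reg 40 : ℤ) = height (f w₁) w₂ + offset len p ∧
      s'.reg 39 = offset len w₁ + 1 + w₂ ∧ s'.reg 53 = (f w₁ w₂).toNat ∧
      s'.time ≤ s.time + 100 * offset len p + 60 := by
  have hv := offset_succ_le (len := len) h.v₁_lt
  have hw := offset_succ_le (len := len) h.w₁_lt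
  have hw2 := h.w₂_lt
  have hold : ∀ {i}, i < p → Holds s.mem (offset len i + 1) (len i) (f i) := fun {i} hi k hk => by
    have := offset_succ_le (len := len) hi
    rw [hm _ (by omega), h.hold i hi k hk]
  refine WP.seq (P' := fun s' => s'.reg 18 = offset len v₁ + 1 ∧
    s'.reg 19 = offset len v₁ + 1 + len v₁ ∧ s'.time = s.time + 2) ?_ ?_
  · apply WP.of_wp
    simp [append_def, wp, Mach.reg_set, Mach.time_set, hr.r12, hr.r13]
    omega
  rintro s₁ hF₁ ⟨r18, r19, ht₁⟩
  have hr₁ := hr.frame hF₁ (by decide)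
  have hm₁ : s₁.mem = s.mem := hF₁.2 (by decide)
  rw [← hF₁.1 _ (by decide)] at h20
  refine WP.seq (peakScan_spec (f := f v₁) s₁ hr₁.r6 h20 r18 r19 (by omega)
    (by rw [hm₁]; exact hold h.v₁_lt)) ?_
  rintro s₂ hF₂ ⟨r22, r23, ht₂⟩
  have hr₂ := hr₁.frame hF₂ (by decide)
  have hm₂ : s₂.mem = s.mem := (hF₂.2 (by decide)).trans hm₁
  rw [← hF₂.1 _ (by decide)] at h20
  refine WP.seq (P' := fun s' => s'.reg 34 = offset len v₁ + 1 + peakPos (f v₁) M (len v₁) ∧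
    s'.reg 50 = peak (f v₁) M (len v₁) ∧ s'.reg 18 = offset len w₁ + 1 ∧
    s'.reg 19 = offset len w₁ + 1 + w₂ ∧ s'.time = s₂.time + 4) ?_ ?_
  · apply WP.of_wp
    simp [append_def, wp, Mach.reg_set, Mach.time_set, hr₂.r14, hr₂.r5, r22, r23]
    omega
  rintro s₃ hF₃ ⟨r34, r50, r18, r19, ht₃⟩
  have hr₃ := hr₂.frame hF₃ (by decide)
  have hm₃ : s₃.mem = s.mem := (hF₃.2 (by decide)).trans hm₂
  rw [← hF₃.1 _ (by decide)] at h20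
  have holdw : Holds s.mem (offset len w₁ + 1) w₂ (f w₁) := fun k hk =>
    hold h.w₁_lt k (by omega)
  refine WP.seq (peakScan_spec (f := f w₁) s₃ hr₃.r6 h20 r18 r19 (by omega)
    (by rw [hm₃]; exact holdw)) ?_
  rintro s₄ hF₄ ⟨r22, r23, ht₄⟩
  have hr₄ := hr₃.frame hF₄ (by decide)
  have hm₄ : s₄.mem = s.mem := (hF₄.2 (by decide)).trans hm₃
  rw [← hF₄.1 _ (by decide)] at r34 r50
  refine WP.seq (P' := fun s' => s'.reg 35 = offset len w₁ + 1 + peakPos (f w₁) M w₂ ∧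
    s'.reg 51 = peak (f w₁) M w₂ ∧ s'.reg 18 = offset len w₁ + 1 ∧
    s'.reg 19 = offset len w₁ + 1 + w₂ ∧ s'.time = s₄.time + 4) ?_ ?_
  · apply WP.of_wp
    simp [append_def, wp, Mach.reg_set, Mach.time_set, hr₄.r14, hr₄.r5, r22, r23]
    omega
  rintro s₅ hF₅ ⟨r35, r51, r18, r19, ht₅⟩
  have hr₅ := hr₄.frame hF₅ (by decide)
  have hm₅ : s₅.mem = s.mem := (hF₅.2 (by decide)).trans hm₄
  rw [← hF₅.1 _ (by decide)] at r34 r50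
  refine WP.seq (sumScan_spec (f := f w₁) s₅ hr₅.r6 hr₅.r15 r18 r19 (by omega) (by omega)
    (by rw [hm₅]; exact holdw)) ?_
  rintro s₆ hF₆ ⟨r26, ht₆⟩
  have hr₆ := hr₅.frame hF₆ (by decide)
  have hm₆ : s₆.mem = s.mem := (hF₆.2 (by decide)).trans hm₅
  rw [← hF₆.1 _ (by decide)] at r34 r50 r35 r51
  -- The cell just past the cut chain holds the operation of `w`; its code is the level that `w`
  -- needs.
  have hcode := hold h.w₁_lt w₂ h.w₂_lt
  apply WP.of_wp
  simp only [append_def, wp, Mach.reg_set, Mach.mem_set, Mach.time_set, hr₆.r14, hr₆.r5, hm₆, hcode,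
    r34, r50, r35, r51, r26, ↓reduceIte, Nat.reduceEqDiff]
  refine ⟨by omega, trivial, trivial, trivial, trivial, trivial, trivial, trivial, by omega⟩

/-- Set up the two chains of nodes in different chains. -/
def setPair : Cmd :=
  (add 10 12 3 ++ add 10 10 6 ++ sub 32 34 10 ++ add 32 32 10 ++ add 33 12 13 ++ move 18 12 ++
    move 19 32) ++ (sumScan ++ move 36 26)

/-- Set up an empty first chain. -/
def setSingle : Cmd := move 32 12 ++ move 33 12 ++ move 34 12 ++ move 36 15 ++ const 50 0

/-- Set up the limits for the sums of two heights. -/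
def setLimits : Cmd :=
  add 31 15 15 ++ add 31 31 50 ++ add 31 31 51 ++ sub 31 31 20 ++ add 50 50 15 ++ add 51 51 15 ++
    add 42 31 53 ++ sub 42 42 40

/-- The registers before `setLimits`. -/
structure PreRegs (g : Grid) (fa fb : ℕ → Bool) (av aw Z Na Nb M : ℕ) (s : Mach) : Prop where
  a_eq : g.a = height fa
  b_eq : g.b = height fb
  hold_a : Holds s.mem av g.la fa
  hold_b : Holds s.mem aw g.W fb
  a_le : av + g.la ≤ Z
  b_le : aw + g.W ≤ Z
  K_eq : g.K = M - Na - Nb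
  le_M : Na + Nb ≤ M
  M_le : M ≤ Z
  a_gv : g.a g.gv = Na
  b_gw : g.b g.gw = Nb
  c_le : g.c ≤ 1
  r6 : s.reg 6 = 1
  r15 : s.reg 15 = Z
  r20 : s.reg 20 = M
  r32 : s.reg 32 = av + g.V
  r33 : s.reg 33 = av + g.la
  r34 : s.reg 34 = av + g.gv
  r35 : s.reg 35 = aw + g.gw
  r36 : (s.reg 36 : ℤ) = g.a g.V + Z
  r39 : s.reg 39 = aw + g.W
  r40 : (s.reg 40 : ℤ) = g.b g.W + Z
  r50 : s.reg 50 = Na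
  r51 : s.reg 51 = Nb
  r53 : (s.reg 53 : ℤ) = g.c

/-- Adding before subtracting and `M ≤ Z` keep `2 * Z - K` from being truncated. Register 42 may be
truncated, which the maximum with zero in `GridRegs` allows for. -/
theorem setLimits_spec {g : Grid} {fa fb : ℕ → Bool} {av aw Z Na Nb M : ℕ} (hg : g.StartsAtPeak)
    (s : Mach) (h : PreRegs g fa fb av aw Z Na Nb M s) (hB : 8 * Z + 8 ≤ B) :
    WP B (setLimits ++ solve) s fun s' => (g.Solvable (g.gv, g.gw) → s'.reg 0 = 1) ∧
      (¬ g.Solvable (g.gv, g.gw) → s'.reg 0 = 0) ∧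
      s'.time ≤ s.time + 300 * Z + 310 := by
  have hb := abs_le.1 (abs_height_le fb g.W)
  have hbz := h.b_le
  have haz := h.a_le
  rw [← h.b_eq] at hb
  refine WP.seq (P' := fun s' => GridRegs g fa fb av aw Z s' ∧ s'.time = s.time + 8) ?_ ?_
  · obtain ⟨k1, k2, k3, k4, k5, k6, k7, k8, k9, k10, k11, k12, r6, r15, r20, r32, r33, r34, r35, r36,
      r39, r40, r50, r51, r53⟩ := h
    apply WP.of_wp
    simp only [setLimits, append_def, wp, Mach.reg_set, Mach.time_set, r15, r50, r51, r20,
      ↓reduceIte, Nat.reduceEqDiff]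
    refine ⟨by omega, by omega, by omega, by omega, by omega, by omega, ?_, trivial⟩
    constructor <;>
      first
        | assumption
        | (simp only [Mach.reg_set, ↓reduceIte, Nat.reduceEqDiff]
           first | assumption | omega)
        | omega
  rintro s₁ hF₁ ⟨hG, ht₁⟩
  refine (solve_spec hg s₁ hG ?_ ?_ ?_ ?_ hB).mono ?_
  · rw [hF₁.1 _ (by decide)]; exact h.r32
  · rw [hF₁.1 _ (by decide)]; exact h.r36
  · rw [hF₁.1 _ (by decide)]; exact h.r39
  · rw [hF₁.1 _ (by decide)]; exact h.r40
  · rintro s₂ - ⟨k1, k2, k3⟩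
    exact ⟨k1, k2, by omega⟩

end Cmd

/-! ### The complete decision procedure -/

namespace Cmd

/-- The decision procedure. -/
def decideAll : Cmd :=
  locate ++ (countAll ++ (findTop ++ (prepare ++ ((sub 10 2 4 ++ sub 11 4 2 ++ add 10 10 11) ++
    ite 10
      (sub 10 5 3 ++ ite 10 (const 0 0) (setSingle ++ (setLimits ++ solve)))
      (setPair ++ (setLimits ++ solve))))))

end Cmd

/-! ### The input of a trace -/

namespace ChainTrace

open Cmd

variable {p n : ℕ} (T : ChainTrace p n)

/-- The length of chain `i`, and zero if there is no such chain. -/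
def lenN (i : ℕ) : ℕ := if h : i < p then T.len ⟨i, h⟩ else 0

/-- The operations of chain `i`. -/
def bitsN (i k : ℕ) : Bool := if h : i < p then T.bits ⟨i, h⟩ k else false

theorem lenN_coe (i : Fin p) : T.lenN i = T.len i := by simp [lenN]

theorem bitsN_coe (i : Fin p) : T.bitsN i = T.bits i := by
  funext k
  simp [bitsN]

theorem offset_eq (len : ℕ → ℕ) (i : ℕ) :
    offset len i = 5 + i + ∑ j ∈ Finset.range i, len j := by
  induction i with
  | zero => rfl
  | succ i ih => rw [offset, ih, Finset.sum_range_succ]; omega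

theorem sum_lenN : ∑ i ∈ Finset.range p, T.lenN i = n := by
  rw [Finset.sum_range]
  exact (Finset.sum_congr rfl fun i _ => T.lenN_coe i).trans T.total

theorem offset_lenN : offset T.lenN p = 5 + p + n := by rw [offset_eq, sum_lenN]

theorem p_le_n {p n : ℕ} (T : ChainTrace p n) : p ≤ n := by
  calc p = ∑ _i : Fin p, 1 := by simp
    _ ≤ ∑ i, (T.chain i).length :=
      Finset.sum_le_sum fun i _ => List.length_pos_iff.2 (T.chain_ne_nil i)
    _ = n := T.total

theorem len_le_n (i : Fin p) : T.len i ≤ n := by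
  refine le_of_le_of_eq ?_ T.total
  exact Finset.single_le_sum (f := fun i => (T.chain i).length) (fun _ _ => Nat.zero_le _)
    (Finset.mem_univ i)

/-- The part of the input for chain `i`. -/
def chunk (i : ℕ) : List ℕ :=
  if h : i < p then (T.chain ⟨i, h⟩).length :: (T.chain ⟨i, h⟩).map SemOp.code else []

theorem chunks_eq : (List.ofFn fun i => (T.chain i).length :: (T.chain i).map SemOp.code) =
    (List.range p).map T.chunk := by
  apply List.ext_getElem
  · simp
  · intro i h1 h2
    simp only [List.length_ofFn] at h1
    simp [chunk, h1]

theorem length_chunks {i : ℕ} (hi : i ≤ p) :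
    ((List.range i).map T.chunk).flatten.length + 5 = offset T.lenN i := by
  induction i with
  | zero => rfl
  | succ i ih =>
    have := ih (by omega)
    have hip : i < p := hi
    have hc : (T.chunk i).length = T.lenN i + 1 := by simp [chunk, hip, lenN, len]
    rw [List.range_succ, List.map_append, List.flatten_append, List.length_append, offset]
    simp only [List.map_cons, List.map_nil, List.flatten_cons, List.flatten_nil, List.append_nil]
    omega

theorem chunks_split {i : ℕ} (hi : i < p) : ∃ r, ((List.range p).map T.chunk).flatten =
    ((List.range i).map T.chunk).flatten ++ (T.chunk i ++ r) := by
  suffices ∀ m, i < m → ∃ r, ((List.range m).map T.chunk).flatten =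
      ((List.range i).map T.chunk).flatten ++ (T.chunk i ++ r) from this p hi
  intro m hm
  induction m, hm using Nat.le_induction with
  | base => exact ⟨[], by simp [List.range_succ]⟩
  | succ m _ ih =>
    obtain ⟨r, hr⟩ := ih
    exact ⟨r ++ T.chunk m, by simp [List.range_succ, hr]⟩

theorem encode_chunk (v w : T.Node) {i k : ℕ} (hi : i < p) (hk : k < (T.chunk i).length) :
    (T.encode v w).getD (offset T.lenN i + k) 0 = (T.chunk i).getD k 0 := by
  obtain ⟨r, hr⟩ := T.chunks_split hi
  rw [encode, chunks_eq, hr, ← T.length_chunks hi.le,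
    add_right_comm]
  -- The five header words cancel against the 5 at which `offset` starts.
  show (((List.range i).map T.chunk).flatten ++ (T.chunk i ++ r)).getD _ 0 = _
  rw [List.getD_append_right _ _ _ _ (by omega), Nat.add_sub_cancel_left,
    List.getD_append _ _ _ _ hk]

theorem input_encode (v w : T.Node) :
    Input p T.lenN T.bitsN v.1 v.2 w.1 w.2 fun a => (T.encode v w).getD a 0 where
  cell0 := rfl
  cell1 := rfl
  cell2 := rfl
  cell3 := rfl
  cell4 := rfl
  len_eq i hi := by
    rw [← add_zero (offset _ i), T.encode_chunk v w hi (by simp [chunk, hi])]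
    simp [chunk, hi, lenN, len]
  hold i hi k hk := by
    have hk' : k < (T.chain ⟨i, hi⟩).length := by simpa [lenN, hi, len] using hk
    show (T.encode v w).getD _ 0 = _
    rw [add_assoc, add_comm 1, T.encode_chunk v w hi (by simp [chunk, hi, hk'])]
    simp only [chunk, hi, bitsN, bits, dite_true, List.getD_cons_succ]
    rw [List.getD_eq_getElem _ _ (by simpa using hk'), List.getD_eq_getElem _ _ hk', List.getElem_map]
    cases (T.chain ⟨i, hi⟩)[k] <;> rfl
  zero a ha := by
    apply List.getD_eq_default
    rw [← T.length_chunks le_rfl] at ha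
    rw [encode, chunks_eq, List.length_append]
    simp only [List.length_cons, List.length_nil]
    omega
  v₁_lt := v.1.2
  v₂_lt := by rw [lenN_coe]; exact v.2.2
  w₁_lt := w.1.2
  w₂_lt := by rw [lenN_coe]; exact w.2.2

theorem encode_le (v w : T.Node) (a : ℕ) : (T.encode v w).getD a 0 ≤ n := by
  have hv : v.2.val < n := v.2.2.trans_le (T.len_le_n v.1)
  have hw : w.2.val < n := w.2.2.trans_le (T.len_le_n w.1)
  have hp := T.p_le_n
  have hv1 := v.1.2
  have hw1 := w.1.2
  rcases Nat.lt_or_ge a (T.encode v w).length with h | h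
  · rw [List.getD_eq_getElem _ _ h]
    have hall : ∀ x ∈ T.encode v w, x ≤ n := by
      intro x hx
      simp only [encode, List.mem_append, List.mem_cons, List.not_mem_nil, or_false,
        List.mem_flatten, List.mem_ofFn] at hx
      rcases hx with (rfl | rfl | rfl | rfl | rfl) | ⟨l, ⟨i, rfl⟩, hx⟩
      · omega
      · omega
      · omega
      · omega
      · omega
      · simp only [List.mem_cons, List.mem_map] at hx
        rcases hx with rfl | ⟨o, -, rfl⟩
        · exact T.len_le_n i
        · cases o <;> simp only [SemOp.code] <;> omega
    exact hall _ (List.getElem_mem h)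
  · rw [List.getD_eq_default _ _ h]
    exact Nat.zero_le _

theorem cutLen_eq (w : T.Node) (i : Fin p) : cutLen T.lenN w.1 w.2 i = lim w i := by
  unfold cutLen lim
  by_cases h : i = w.1
  · subst h; simp
  · rw [if_neg fun h' => h (Fin.ext h'), Function.update_of_ne h, lenN_coe]

theorem table_eq (w : T.Node) (r : ℕ) : table T.lenN T.bitsN w.1 w.2 r p =
    ∑ i, records (T.bits i) r (lim w i) := by
  have : ∀ i, table T.lenN T.bitsN w.1 w.2 r i =
      ∑ j ∈ Finset.range i, records (T.bitsN j) r (cutLen T.lenN w.1 w.2 j) := by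
    intro i
    induction i with
    | zero => rfl
    | succ i ih => rw [table, ih, Finset.sum_range_succ]
  rw [this, Finset.sum_range]
  exact Finset.sum_congr rfl fun i _ => by rw [cutLen_eq, bitsN_coe]

theorem lim_le (w : T.Node) (i : Fin p) : lim w i ≤ T.len i := by
  rw [← cutLen_eq, ← lenN_coe]
  exact cutLen_le (by rw [lenN_coe]; exact w.2.2.le) _

theorem totalPeak_le (w : T.Node) (r : ℕ) : totalPeak T.bits (lim w) r ≤ n := by
  refine le_of_le_of_eq ?_ T.total
  exact Finset.sum_le_sum fun i _ => (peak_le _ _ _).trans (T.lim_le w i)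

/-- The two peaks are among the nonnegative summands of `totalPeak`, which equals `M`; this makes
the constant of the two-chain problem nonnegative. -/
theorem isTopLevel_pair_le {ι : Type*} [Fintype ι] [DecidableEq ι] {F : ι → ℕ → Bool}
    {L : ι → ℕ} {M : ℕ} (hM : IsTopLevel F L M) {v w : ι} (hvw : v ≠ w) :
    peak (F v) M (L v) + peak (F w) M (L w) ≤ M := by
  conv_rhs => rw [← hM.eq]
  rw [← Finset.sum_pair (f := fun i => peak (F i) M (L i)) hvw]
  exact Finset.sum_le_sum_of_subset (Finset.subset_univ _)

theorem isTopLevel_single_le {ι : Type*} [Fintype ι] {F : ι → ℕ → Bool}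
    {L : ι → ℕ} {M : ℕ} (hM : IsTopLevel F L M) (w : ι) : peak (F w) M (L w) ≤ M := by
  conv_rhs => rw [← hM.eq]
  exact Finset.single_le_sum (f := fun i => peak (F i) M (L i)) (fun _ _ => Nat.zero_le _)
    (Finset.mem_univ w)

theorem lim_self (w : T.Node) : lim w w.1 = w.2 := by simp [lim]

theorem lim_of_ne {v w : T.Node} (h : v.1 ≠ w.1) : lim w v.1 = T.len v.1 :=
  Function.update_of_ne h _ _

theorem need_eq (w : T.Node) : need w = ((T.bits w.1 w.2).toNat : ℤ) := by
  unfold need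
  cases T.bits w.1 w.2 <;> rfl

/-- The prefix sums of the table are identified with `totalPeak`, so the level found satisfies
`IsTopLevel`. Both cases then go through the same two-chain solver, with an empty first chain if the
nodes share a chain. -/
theorem decideAll_spec {B : ℕ} (v w : T.Node) (s : Mach)
    (hs : s.mem = fun a => (T.encode v w).getD a 0) (hB : 8 * (5 + p + n) + 8 ≤ B) :
    WP B decideAll s fun s' => (CanPrecede T.graph T.op v w → s'.reg 0 = 1) ∧
      (¬ CanPrecede T.graph T.op v w → s'.reg 0 = 0) ∧
      s'.time ≤ s.time + 1000 * (5 + p + n) := by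
  have hI := T.input_encode v w
  rw [← hs] at hI
  have hZ := T.offset_lenN
  rw [← hZ] at hB ⊢
  refine WP.seq (locate_spec hI s rfl hB) ?_
  rintro s₁ hF₁ ⟨hr₁, ht₁⟩
  have hm₁ : s₁.mem = s.mem := hF₁.2 (by decide)
  refine WP.seq (countAll_spec hI s₁ hm₁ hr₁ hB) ?_
  rintro s₂ hF₂ ⟨hlow, hhigh, ht₂⟩
  have hr₂ := hr₁.frame hF₂ (by decide)
  refine WP.seq (findTop_spec (N := totalPeak T.bits (lim w)) s₂ hr₂.r6 hr₂.r15 ?_ (fun r => ?_)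
    (fun r => ?_) hB) ?_
  · rw [← add_zero (offset T.lenN p), hhigh, table_eq, totalPeak]
    exact Finset.sum_congr rfl fun i _ => peak_zero_eq _ _
  · rw [hhigh, table_eq, totalPeak, totalPeak, ← Finset.sum_add_distrib]
    exact Finset.sum_congr rfl fun i _ => peak_succ_eq _ _ _
  · have := T.totalPeak_le w r
    omega
  rintro s₃ hF₃ ⟨M, r20, hM1, hM2, ht₃⟩
  have hM : IsTopLevel T.bits (lim w) M := ⟨hM1, hM2⟩
  have hMZ := T.totalPeak_le w M
  rw [hM.eq] at r20 hMZ
  have hr₃ := hr₂.frame hF₃ (by decide)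
  have hlow₃ : ∀ x < offset T.lenN p, s₃.mem x = s.mem x := fun x hx => by
    rw [hF₃.2 (by decide), hlow x hx]
  refine WP.seq (prepare_spec hI s₃ hlow₃ hr₃ r20 hB) ?_
  rintro s₄ hF₄ ⟨r34, r50, r35, r51, r40, r39, r53, ht₄⟩
  have hr₄ := hr₃.frame hF₄ (by decide)
  have hlow₄ : ∀ x < offset T.lenN p, s₄.mem x = s.mem x := fun x hx => by
    rw [hF₄.2 (by decide), hlow₃ x hx]
  rw [← hF₄.1 _ (by decide)] at r20
  rw [bitsN_coe, lenN_coe] at r34 r50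
  rw [bitsN_coe] at r35 r51 r40 r53
  have hv1 := hI.v₁_lt
  have hw1 := hI.w₁_lt
  have hv2 := hI.v₂_lt
  have hw2 := hI.w₂_lt
  have hov := offset_succ_le (len := T.lenN) hv1
  have how := offset_succ_le (len := T.lenN) hw1
  have hold : ∀ i : Fin p, Holds s₄.mem (offset T.lenN i + 1) (T.len i) (T.bits i) := by
    intro i k hk
    rw [← lenN_coe] at hk
    have := offset_succ_le (len := T.lenN) i.2
    rw [hlow₄ _ (by omega), hI.hold i i.2 k hk, bitsN_coe]
  rw [lenN_coe] at hv2 hw2 hov how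
  refine WP.seq (P' := fun s' => (s'.reg 10 = 0 ↔ v.1 = w.1) ∧ s'.time = s₄.time + 3) ?_ ?_
  · apply WP.of_wp
    simp only [append_def, wp, Mach.reg_set, Mach.time_set, hr₄.r2, hr₄.r4, ↓reduceIte,
      Nat.reduceEqDiff]
    refine ⟨by omega, ?_, trivial⟩
    rw [Fin.ext_iff]
    omega
  rintro s₅ hF₅ ⟨r10, ht₅⟩
  have hr₅ := hr₄.frame hF₅ (by decide)
  have hm₅ : s₅.mem = s₄.mem := hF₅.2 (by decide)
  rw [← hF₅.1 _ (by decide)] at r34 r50 r35 r51 r40 r39 r53 r20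
  have hlim := T.lim_self w
  have hcn : ((T.bits w.1 w.2).toNat : ℤ) ≤ 1 := by exact_mod_cast Bool.toNat_le _
  refine WP.ite (fun h0 => ?_) (fun h0 => ?_)
  · have heq := r10.1 h0
    rw [canPrecede_iff_single hM heq]
    refine WP.seq (P' := fun s' => s'.reg 10 = w.2 - v.2 ∧ s'.time = s₅.time + 2) ?_ ?_
    · apply WP.of_wp
      simp [wp, Mach.reg_set, Mach.reg_tick, Mach.time_set, Mach.time_tick, hr₅.r3, hr₅.r5]
    rintro s₆ hF₆ ⟨r10', ht₆⟩
    -- The truncated difference vanishes exactly when `w` does not come after `v` on their chain;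
    -- the answer is then no.
    refine WP.ite (fun h1 => ?_) (fun h1 => ?_)
    · apply WP.of_wp
      refine ⟨by omega, fun h => ?_, fun _ => ?_, ?_⟩
      · omega
      · simp [Mach.reg_set]
      · simp only [Mach.time_set, Mach.time_tick]
        omega
    have h00 : height (fun _ => false) 0 = 0 := by simp [height]
    have hr₆ := hr₅.frame hF₆ (by decide)
    have hm₆ : s₆.mem = s₄.mem := (hF₆.2 (by decide)).trans hm₅
    have hG₆ : ∀ r ∈ [35, 51, 40, 39, 53, 20], s₆.reg r = s₅.reg r := fun r hr =>
      hF₆.1 r (by revert r; decide)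
    rw [← hG₆ _ (by decide)] at r35 r51 r40 r39 r53 r20
    refine WP.seq (P' := fun s' => PreRegs (singleGrid T.bits (lim w) M w.1 (need w))
      (fun _ => false) (T.bits w.1) (offset T.lenN v.1 + 1) (offset T.lenN w.1 + 1)
      (offset T.lenN p) 0 (peak (T.bits w.1) M (lim w w.1)) M s' ∧
      s'.time = s₆.time + 6) ?_ ?_
    · have hle := isTopLevel_single_le hM w.1
      apply WP.of_wp
      simp only [setSingle, append_def, wp, Mach.reg_set, Mach.reg_tick, Mach.time_set,
        Mach.time_tick, hr₆.r12, hr₆.r15, ↓reduceIte, Nat.reduceEqDiff]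
      refine ⟨by omega, ?_, trivial⟩
      rw [hlim] at hle ⊢
      constructor <;>
        try simp only [singleGrid, hlim, h00, height_peakPos, Mach.reg_set, Mach.mem_set, Mach.reg_tick,
          Mach.mem_tick, hm₆, hr₆.r6, hr₆.r15, r20, r35, r39, r40, r51, r53, need_eq, ↓reduceIte,
          Nat.reduceEqDiff]
      · intro k hk
        omega
      · exact fun k hk => hold w.1 k (by omega)
      all_goals omega
    rintro s₇ - ⟨hp, ht₇⟩
    refine (setLimits_spec (singleGrid_startsAtPeak hM (need_nonneg w)) s₇ hp hB).mono ?_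
    rintro s₈ - ⟨k1, k2, k3⟩
    refine ⟨fun h => k1 h.2, fun h => k2 fun h' => h ⟨by omega, h'⟩, ?_⟩
    simp only [Mach.time_tick] at *
    omega
  · have hne : v.1 ≠ w.1 := fun h => h0 (r10.2 h)
    rw [canPrecede_iff_pair hM hne]
    have hlimv := T.lim_of_ne hne
    have hle := isTopLevel_pair_le hM hne
    have hpos := peakPos_le (T.bits v.1) M (T.len v.1)
    have hsp := pairGrid_startsAtPeak (V := v.2 + 1) hM hne (by rw [hlimv]; exact hv2) (need_nonneg w)
    rw [hlimv, hlim] at hle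
    obtain ⟨V, hV⟩ : ∃ V, V = max (v.2.val + 1) (peakPos (T.bits v.1) M (T.len v.1)) := ⟨_, rfl⟩
    have hVl : V ≤ T.len v.1 := hV ▸ max_le hv2 hpos
    refine WP.seq (P' := fun s' => PreRegs (pairGrid T.bits (lim w) M v.1 w.1 (v.2 + 1) (need w))
      (T.bits v.1) (T.bits w.1) (offset T.lenN v.1 + 1) (offset T.lenN w.1 + 1) (offset T.lenN p)
      (peak (T.bits v.1) M (T.len v.1)) (peak (T.bits w.1) M w.2) M s' ∧
      s'.time ≤ s₅.time + 10 * offset T.lenN p + 20) ?_ ?_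
    -- Truncated subtraction followed by addition of the same number yields the maximum that defines
    -- `V`.
    · refine WP.seq (P' := fun s' => s'.reg 32 = offset T.lenN v.1 + 1 + V ∧
        s'.reg 33 = offset T.lenN v.1 + 1 + T.len v.1 ∧ s'.reg 18 = offset T.lenN v.1 + 1 ∧
        s'.reg 19 = offset T.lenN v.1 + 1 + V ∧ s'.time = s₅.time + 8) ?_ ?_
      · apply WP.of_wp
        simp only [append_def, wp, Mach.reg_set, Mach.reg_tick, Mach.time_set, Mach.time_tick,
          hr₅.r12, hr₅.r3, hr₅.r6, hr₅.r13, r34, lenN_coe, ↓reduceIte, Nat.reduceEqDiff]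
        refine ⟨by omega, by omega, by omega, by omega, by omega, trivial, trivial, by omega, trivial⟩
      rintro s₆ hF₆ ⟨r32, r33, r18, r19, ht₆⟩
      have hr₆ := (hr₅.congr (s' := s₅.tick) fun _ _ => rfl).frame hF₆ (by decide)
      have hm₆ : s₆.mem = s₄.mem := (hF₆.2 (by decide)).trans hm₅
      have hG₆ : ∀ r ∈ [34, 50, 35, 51, 40, 39, 53, 20], s₆.reg r = s₅.reg r := fun r hr =>
        hF₆.1 r (by revert r; decide)
      rw [← hG₆ _ (by decide)] at r34 r50 r35 r51 r40 r39 r53 r20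
      refine WP.seq (sumScan_spec (f := T.bits v.1) s₆ hr₆.r6 hr₆.r15 r18 r19 (by omega) (by omega)
        (by rw [hm₆]; exact fun k hk => hold v.1 k (by omega))) ?_
      rintro s₇ hF₇ ⟨r26, ht₇⟩
      have hr₇ := hr₆.frame hF₇ (by decide)
      have hm₇ : s₇.mem = s₄.mem := (hF₇.2 (by decide)).trans hm₆
      rw [← hF₇.1 _ (by decide)] at r34 r50 r35 r51 r40 r39 r53 r20 r32 r33
      apply WP.of_wp
      simp only [wp, Mach.time_set]
      refine ⟨?_, by omega⟩
      constructor <;>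
        try simp only [pairGrid, hlim, hlimv, ← hV, height_peakPos, Mach.reg_set, Mach.mem_set, hm₇,
          hr₇.r6, hr₇.r15, r20, r26, r32, r33, r34, r35, r39, r40, r50, r51, r53, need_eq,
          ↓reduceIte, Nat.reduceEqDiff]
      · exact hold v.1
      · exact fun k hk => hold w.1 k (by omega)
      all_goals omega
    rintro s₆ - ⟨hp, ht₆⟩
    refine (setLimits_spec hsp s₆ hp hB).mono ?_
    rintro s₇ - ⟨k1, k2, k3⟩
    refine ⟨k1, k2, ?_⟩
    simp only [Mach.time_tick] at *
    omega

end ChainTrace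

/-- A single program decides, in time `O(n)` and with words bounded by `O(n)`, whether some valid
subschedule of a graph of `p` disjoint chains comprising `n` nodes has `v` before `w`. -/
theorem mainTheorem2 :
    ∃ (Q : RamProgram) (C : ℕ), ∀ (p n : ℕ) (T : ChainTrace p n) (v w : T.Node),
      Q.DecidesWithin (T.encode v w) (CanPrecede T.graph T.op v w) (C * n) (C * n) := by
  -- Since `p ≤ n` and `1 ≤ n`, the time `1000 * (5 + p + n)` is at most `7000 * n`; the words need
  -- far less.
  refine ⟨Cmd.decideAll.compile 0, 7000, fun p n T v w => ?_⟩
  have hp := T.p_le_n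
  have hn : 1 ≤ n := v.1.pos.trans_le hp
  let s : Mach := ⟨fun _ => 0, fun a => (T.encode v w).getD a 0, 0⟩
  have hs : s.Bdd (7000 * n) :=
    ⟨fun _ => Nat.zero_le _, fun a => (T.encode_le v w a).trans (by omega)⟩
  obtain ⟨s', hE, hyes, hno, ht⟩ := T.decideAll_spec (B := 7000 * n) v w s rfl (by omega) hs
  obtain ⟨t, ht', hrun, hw⟩ := hE.runs (Q := Cmd.decideAll.compile 0) (l := 0) ⟨[], [], by simp, rfl⟩ hs
  have hinit : s.toRam 0 = RamState.init (T.encode v w) := rfl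
  rw [hinit] at hrun hw
  have hst : s.time = 0 := rfl
  refine ⟨t, by omega, ?_, hw, ?_, ?_⟩
  · rw [RamProgram.config, hrun]
    -- The program counter has run past the last instruction, which counts as halting.
    simp [RamProgram.instrAt, Mach.toRam, Cmd.length_compile]
  · rw [RamProgram.config, hrun]
    exact hyes
  · rw [RamProgram.config, hrun]
    exact hno
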